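/- **Setting.** A covering ILP with $n$ variables and $m$ constraints consists of $A\in\mathbb{R}_{\ge 0}^{m\times n}$, $b\in\mathbb{R}_{\ge 0}^{m}$ and $w\in\mathbb{Z}_{\ge 0}^{n}$; the task is to minimise $w^{\top}x$ over $x\in\{0,1\}^n$ subject to $Ax\ge b$. Its hypergraph $H$ has a vertex for each variable and, for each constraint $j$, the hyperedge $e_j=\{i: A_{j,i}\neq 0\}$. In the randomized $\mathsf{LOCAL}$ model on $H$ the vertices are anonymous and compute in synchronous rounds; in each round every vertex can exchange messages of arbitrary size with every other vertex that shares a hyperedge with it, and perform arbitrary local computation. Each vertex has a private infinite string of independent fair random bits and initially knows the weight of its variable, the constraints in which its variable occurs (with the coefficients of the variables in them, these being identified with its communication links), the accuracy $\varepsilon$ and a number $\tilde n$, but not $n$. At the end each vertex outputs the value in $\{0,1\}$ of its variable. **Theorem 3.** For every integer $k\ge 0$ there is a family of randomized $\mathsf{LOCAL}$ algorithms $\mathcal{A}_{\tilde n,\varepsilon}$ such that, for every integer $c\ge 0$, there is a constant $C=C(k,c)$ with the following property. Let $n\ge 3$ and $0<\varepsilon\le 1$. Consider any covering ILP with $n$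 variables that has an optimal solution $Q^*$ and satisfies $\sum_{i} w_i\le n^{c}$, put $M=\max(n,w^{\top}Q^*)$, and let $\tilde n$ be an integer with $M\le \tilde n\le M^{c}$. Then $\mathcal{A}_{\tilde n,\varepsilon}$, run on the hypergraph of this ILP, takes at most $$C\cdot\frac{\bigl(\log\log n+\log(1/\varepsilon)\bigr)^{3}\,\log n}{\varepsilon}$$ rounds (with natural logarithms), and with probability at least $1-n^{-k}$ its output $x$ is a $(1+\varepsilon)$-approximate solution, that is, $Ax\ge b$ and $w^{\top}x\le(1+\varepsilon)\,w^{\top}y$ for every feasible $y\in\{0,1\}^n$. -/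

import Mathlib

open MeasureTheory

noncomputable section

/-! ### Covering integer linear programs -/

/-- A covering ILP with `n` binary variables and `m` constraints: minimise `wᵀ x` over
`x ∈ {0,1}ⁿ` subject to `A x ≥ b`, where `A` and `b` have nonnegative real entries and `w` has
nonnegative integer entries. -/
structure CoveringILP (m n : ℕ) where
  A : Matrix (Fin m) (Fin n) ℝ
  b : Fin m → ℝ
  w : Fin n → ℕ
  A_nonneg : ∀ j i, 0 ≤ A j i
  b_nonneg : ∀ j, 0 ≤ b j

namespace CoveringILP

variable {m n : ℕ}

/-- `x ∈ {0,1}ⁿ` satisfies all constraints: `A x ≥ b`. -/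
def Feasible (I : CoveringILP m n) (x : Fin n → Bool) : Prop :=
  ∀ j, I.b j ≤ I.A.mulVec (fun i => if x i then (1 : ℝ) else 0) j

/-- The objective value `wᵀ x`. -/
def weight (I : CoveringILP m n) (x : Fin n → Bool) : ℕ :=
  ∑ i, if x i then I.w i else 0

/-- `x` is an optimal solution. -/
def IsOptimal (I : CoveringILP m n) (x : Fin n → Bool) : Prop :=
  I.Feasible x ∧ ∀ y, I.Feasible y → I.weight x ≤ I.weight y

/-- `x` is a `ρ`-approximate solution: it is feasible, and its weight is at most `ρ` times the
weight of every feasible solution, hence at most `ρ` times the optimum. -/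
def IsApprox (I : CoveringILP m n) (ρ : ℝ) (x : Fin n → Bool) : Prop :=
  I.Feasible x ∧ ∀ y, I.Feasible y → (I.weight x : ℝ) ≤ ρ * (I.weight y : ℝ)

/-- The hypergraph of the ILP: a vertex for each variable, and for each constraint `j` the
hyperedge `{i | A j i ≠ 0}` of the variables that occur in it. -/
def hypergraph (I : CoveringILP m n) : Hypergraph (Fin n) where
  vertexSet := Set.univ
  edgeSet := Set.range fun j => {i | I.A j i ≠ 0}
  subset_vertexSet_of_mem_edgeSet' := fun _ _ => Set.subset_univ _

end CoveringILP

/-- The communication graph of a hypergraph: two distinct vertices can communicate if and only if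
some hyperedge contains both. -/
def Hypergraph.commGraph {V : Type} (H : Hypergraph V) : SimpleGraph V where
  Adj u v := u ≠ v ∧ H.Adj u v
  symm := ⟨fun _ _ h => ⟨h.1.symm, h.2.symm⟩⟩
  loopless := ⟨fun _ h => h.1 rfl⟩

/-! ### The randomized LOCAL model -/

/-- A numbering of the communication links at each vertex: vertex `v` has `deg v` links, numbered
by `Fin (deg v)`, one for each neighbour. Numberings at different vertices are unrelated. -/
structure PortNumbering {V : Type} (G : SimpleGraph V) where
  deg : V → ℕ
  port : ∀ v, Fin (deg v) ≃ {u : V // G.Adj v u}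

/-- A randomized algorithm in the `LOCAL` model for anonymous vertices. A vertex with `d` links has
an initial local input from `Input d`. Every vertex runs the same program: its initial state depends
on the number of its links, its local input and its private infinite string of random bits; in each
synchronous round it sends an arbitrary message over each of its links, receives the messages sent
by its neighbours, and updates its state by an arbitrary computation. After `rounds` rounds every
vertex outputs one bit, computed from its state. -/
structure LocalAlgorithm (Input : ℕ → Type) where
  State : Type
  Message : Type
  init : (d : ℕ) → Input d → (ℕ → Bool) → State
  send : (d : ℕ) → State → Fin d → Message
  update : (d : ℕ) → State → (Fin d → Message) → State
  output : State → Bool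
  rounds : ℕ

namespace LocalAlgorithm

variable {Input : ℕ → Type} {V : Type} {G : SimpleGraph V}

/-- The states of the vertices after `t` rounds, where `r v` is the random string of `v`. In each
round, `v` receives over its link `p`, leading to the neighbour `u`, the message that `u` sends over
the link of `u` that leads to `v`. -/
def stateAfter (𝒜 : LocalAlgorithm Input) (P : PortNumbering G)
    (input : (v : V) → Input (P.deg v)) (r : V → ℕ → Bool) : ℕ → V → 𝒜.State
  | 0, v => 𝒜.init (P.deg v) (input v) (r v)
  | t + 1, v =>
      𝒜.update (P.deg v) (stateAfter 𝒜 P input r t v) fun p =>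
        𝒜.send (P.deg (P.port v p).1) (stateAfter 𝒜 P input r t (P.port v p).1)
          ((P.port (P.port v p).1).symm ⟨v, (P.port v p).2.symm⟩)

/-- The outputs of the vertices at the end of the execution. -/
def run (𝒜 : LocalAlgorithm Input) (P : PortNumbering G)
    (input : (v : V) → Input (P.deg v)) (r : V → ℕ → Bool) (v : V) : Bool :=
  𝒜.output (𝒜.stateAfter P input r 𝒜.rounds v)

end LocalAlgorithm

/-- The law of the random bits: every vertex has an infinite string of fair bits, all of them
independent. -/
def randomBits (V : Type) [Fintype V] : Measure (V → ℕ → Bool) :=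
  Measure.pi fun _ => Measure.infinitePi fun _ => (PMF.uniformOfFintype Bool).toMeasure

/-! ### Covering ILPs as inputs of LOCAL algorithms -/

/-- A constraint as seen by a vertex with `d` links that takes part in it: the vertex's own
coefficient, the coefficient of the neighbour behind each link, and the right-hand side. -/
structure LocalConstraint (d : ℕ) where
  own : ℝ
  nbr : Fin d → ℝ
  rhs : ℝ

/-- The initial knowledge of a vertex with `d` links: the weight of its variable and the
constraints in which its variable occurs. -/
structure CoveringInput (d : ℕ) where
  weight : ℕ
  constraints : Set (LocalConstraint d)

/-- The initial knowledge of the vertex `v` of the hypergraph of a covering ILP. -/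
def CoveringILP.localInput {m n : ℕ} (I : CoveringILP m n)
    (P : PortNumbering I.hypergraph.commGraph) (v : Fin n) : CoveringInput (P.deg v) where
  weight := I.w v
  constraints := {κ | ∃ j, I.A j v ≠ 0 ∧
    κ = { own := I.A j v, nbr := fun p => I.A j (P.port v p).1, rhs := I.b j }}

end

/-! Every vertex draws a random identifier and random numbers, gathers all information within a
fixed radius, and applies a deterministic rule to what it sees. By `LocEq.mem_output_iff` and
`run_floodAlg_iff` this simulates an algorithm on the whole instance, so it suffices that the latter
has cost at most `1 + 1 / E` times the optimum with high probability (`CovInst.pr_output_le`). Here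
`E` is about `1 / ε`, `A` is of order `log n`, and the number `t` of stages is of order `log log n +
log (1 / ε)`.

The algorithm ends with a random sparse cover. Each `u` gets a nearly geometric shift `T u`, reaches
a point at distance `d` at level `T u - d`, and claims the points that it reaches within two of
their highest level. Every constraint lies in some cluster, so the union of optimal solutions of the
clusters is feasible, and it costs at most an optimal solution weighted by multiplicities. Since the
shifts are nearly memoryless, the mean multiplicity is `1 + O(1 / E)` (`expect_mult_le`).
Multiplicities of distant variables are independent, so a moment bound gives concentration
(`pr_sum_mult_le`), provided that no ball of the relevant radius carries more than about `1 / (E * A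
^ 2)` of the optimum.

The preceding stages create this situation. Stage `i` samples centers at a rate proportional to `2 ^
i` times a local density, whose sums over balls approximate the optima of balls, divided by the
optimum of a larger ball of the whole instance. Around a variable that is still too heavy, order `A`
centers are expected, so it is very likely carved away; the lightness inherited from the previous
stage keeps the number of centers `O(A)` around every surviving variable. Thus each stage halves the
relative weight of what survives (`pr_stage_le`), and `2 ^ t ≥ 16 * E * A ^ 2` suffices. Beyond the
optimum, a carved ball pays only for the cheapest of many disjoint annuli (`carve_cost`,
`layers_mul_sum_opt_annulus_le`); with `2 * E * t` times as many layers as overlapping balls, all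
stages together lose a fraction `1 / (2 * E)`.

A stage thus has order `E * t * A` layers, the radii add up over `t` stages, and the normalising
balls grow by that sum in each stage. This is where `t ^ 3 * E * A` comes from. -/

open scoped BigOperators
set_option linter.unusedSectionVars false

/-! ### Bounded distance for a relation -/

/-- `Near adj k x y`: the point `y` can be reached from `x` by at most `k` steps along `adj`. -/
def Near {W : Type*} (adj : W → W → Prop) : ℕ → W → W → Prop
  | 0, x, y => x = y
  | k + 1, x, y => Near adj k x y ∨ ∃ z, Near adj k x z ∧ adj z y

namespace Near

variable {W : Type*} {adj : W → W → Prop}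

theorem refl (k : ℕ) (x : W) : Near adj k x x := by
  induction k with
  | zero => rfl
  | succ k ih => exact Or.inl ih

theorem mono {a b : ℕ} (hab : a ≤ b) {x y : W} (h : Near adj a x y) : Near adj b x y := by
  induction b, hab using Nat.le_induction with
  | base => exact h
  | succ b _ ih => exact Or.inl ih

theorem of_adj {x y : W} (h : adj x y) : Near adj 1 x y := Or.inr ⟨x, rfl, h⟩

theorem trans {a b : ℕ} {x y z : W} (h₁ : Near adj a x y) (h₂ : Near adj b y z) :
    Near adj (a + b) x z := by
  induction b generalizing z with
  | zero => cases h₂; exact h₁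
  | succ b ih =>
    rcases h₂ with h | ⟨u, hu, huz⟩
    · exact Or.inl (ih h)
    · exact Or.inr ⟨u, ih hu, huz⟩

theorem step {a : ℕ} {x y z : W} (h₁ : Near adj a x y) (h₂ : adj y z) :
    Near adj (a + 1) x z := Or.inr ⟨y, h₁, h₂⟩

theorem symm (hs : ∀ x y, adj x y → adj y x) {a : ℕ} {x y : W} (h : Near adj a x y) :
    Near adj a y x := by
  induction a generalizing x y with
  | zero => cases h; rfl
  | succ a ih =>
    rcases h with h | ⟨u, hu, huy⟩
    · exact Or.inl (ih h)
    · have := trans (of_adj (hs _ _ huy)) (ih hu)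
      rwa [add_comm] at this

end Near

/-! ### Covering instances on an arbitrary finite type -/

/-- A covering problem on the variables `W`: a weight for each variable and a set of constraints,
each consisting of its coefficients and its right-hand side. -/
structure CovInst (W : Type) where
  wt : W → ℕ
  cons : Set ((W → ℝ) × ℝ)

namespace CovInst

variable {W : Type}

/-- Two variables are adjacent if they occur in a common constraint. -/
def Adj (J : CovInst W) (x y : W) : Prop := ∃ c ∈ J.cons, c.1 x ≠ 0 ∧ c.1 y ≠ 0

theorem Adj.symm {J : CovInst W} {x y : W} (h : J.Adj x y) : J.Adj y x := by
  obtain ⟨c, hc, h1, h2⟩ := h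
  exact ⟨c, hc, h2, h1⟩

/-- `y` is within distance `k` of `x`. -/
abbrev Near (J : CovInst W) (k : ℕ) (x y : W) : Prop := _root_.Near J.Adj k x y

theorem near_symm {J : CovInst W} {k : ℕ} {x y : W} (h : J.Near k x y) : J.Near k y x :=
  _root_.Near.symm (fun _ _ => Adj.symm) h

theorem near_comm {J : CovInst W} {k : ℕ} {x y : W} : J.Near k x y ↔ J.Near k y x :=
  ⟨near_symm, near_symm⟩

/-- The set `X` satisfies all constraints whose nonempty support lies in `S`. -/
def Covers (J : CovInst W) (S X : Finset W) : Prop :=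
  ∀ c ∈ J.cons, (∃ x, c.1 x ≠ 0) → (∀ x, c.1 x ≠ 0 → x ∈ S) → c.2 ≤ ∑ x ∈ X, c.1 x

/-- The total weight of a set of variables. -/
def cost (J : CovInst W) (X : Finset W) : ℕ := ∑ x ∈ X, J.wt x

/-- `X` is an optimal solution of the problem induced by `S`. -/
def IsOpt (J : CovInst W) (S X : Finset W) : Prop :=
  X ⊆ S ∧ J.Covers S X ∧ ∀ Y ⊆ S, J.Covers S Y → J.cost X ≤ J.cost Y

open Classical in
/-- A choice of an optimal solution of the problem induced by `S`. -/
noncomputable def sol (J : CovInst W) (S : Finset W) : Finset W :=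
  Classical.epsilon (J.IsOpt S)

/-- The optimum of the problem induced by `S`. -/
noncomputable def opt (J : CovInst W) (S : Finset W) : ℕ := J.cost (J.sol S)

/-- All coefficients are nonnegative and the all-ones assignment is feasible. -/
structure WellFormed [Fintype W] (J : CovInst W) : Prop where
  nonneg : ∀ c ∈ J.cons, ∀ x, 0 ≤ c.1 x
  feasible : ∀ c ∈ J.cons, c.2 ≤ ∑ x, c.1 x

theorem cost_mono (J : CovInst W) {X Y : Finset W} (h : X ⊆ Y) : J.cost X ≤ J.cost Y :=
  Finset.sum_le_sum_of_subset h

theorem cost_biUnion_le [DecidableEq W] (J : CovInst W) {α : Type*} (A : Finset α) (X : α → Finset W) :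
    J.cost (A.biUnion X) ≤ ∑ a ∈ A, J.cost (X a) := by
  classical
  induction A using Finset.induction_on with
  | empty => simp [cost]
  | insert a A ha ih =>
    rw [Finset.biUnion_insert, Finset.sum_insert ha]
    refine le_trans ?_ (Nat.add_le_add_left ih _)
    unfold cost
    have := Finset.sum_union_inter (s₁ := X a) (s₂ := A.biUnion X) (f := J.wt)
    omega

theorem cost_union_le [DecidableEq W] (J : CovInst W) (X Y : Finset W) :
    J.cost (X ∪ Y) ≤ J.cost X + J.cost Y := by
  unfold cost
  have := Finset.sum_union_inter (s₁ := X) (s₂ := Y) (f := J.wt)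
  omega

section

variable [Fintype W] {J : CovInst W} (hJ : J.WellFormed)
include hJ

theorem Covers.mono {S X Y : Finset W} (h : J.Covers S X) (hXY : X ⊆ Y) : J.Covers S Y :=
  fun c hc h1 h2 => (h c hc h1 h2).trans
    (Finset.sum_le_sum_of_subset_of_nonneg hXY fun x _ _ => hJ.nonneg c hc x)

theorem covers_self (S : Finset W) : J.Covers S S := fun c hc _ h2 => by
  refine (hJ.feasible c hc).trans (le_of_eq ?_)
  symm
  refine Finset.sum_subset (Finset.subset_univ _) fun x _ hx => ?_
  by_contra h
  exact hx (h2 x h)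

omit [Fintype W] hJ in
theorem Covers.inter [DecidableEq W] {S S' X : Finset W} (h : J.Covers S X) (hS : S' ⊆ S) :
    J.Covers S' (X ∩ S') := fun c hc h1 h2 => by
  refine (h c hc h1 fun x hx => hS (h2 x hx)).trans (le_of_eq ?_)
  symm
  refine Finset.sum_subset Finset.inter_subset_left fun x hx hx' => ?_
  by_contra h
  exact hx' (Finset.mem_inter.2 ⟨hx, h2 x h⟩)

theorem sol_isOpt (S : Finset W) : J.IsOpt S (J.sol S) := by
  classical
  refine Classical.epsilon_spec (p := J.IsOpt S) ?_
  obtain ⟨X, hX, hmin⟩ := Finset.exists_min_image (S.powerset.filter (J.Covers S)) J.cost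
    ⟨S, by simp [covers_self hJ]⟩
  simp only [Finset.mem_filter, Finset.mem_powerset, and_imp] at hX hmin
  exact ⟨X, hX.1, hX.2, hmin⟩

theorem sol_subset (S : Finset W) : J.sol S ⊆ S := (sol_isOpt hJ S).1

theorem sol_covers (S : Finset W) : J.Covers S (J.sol S) := (sol_isOpt hJ S).2.1

theorem opt_le_cost {S X : Finset W} (h : J.Covers S X) : J.opt S ≤ J.cost X := by
  classical
  exact ((sol_isOpt hJ S).2.2 _ Finset.inter_subset_right (h.inter subset_rfl)).trans
    (J.cost_mono Finset.inter_subset_left)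

theorem opt_le_cost_inter [DecidableEq W] {S S' : Finset W} (h : S' ⊆ S) :
    J.opt S' ≤ J.cost (J.sol S ∩ S') :=
  opt_le_cost hJ ((sol_covers hJ S).inter h)

theorem opt_mono {S S' : Finset W} (h : S' ⊆ S) : J.opt S' ≤ J.opt S := by
  classical
  exact (opt_le_cost_inter hJ h).trans (J.cost_mono Finset.inter_subset_left)

/-- An optimal solution of `S`, cut down to `B a`, covers the constraints inside `B a`. Exchanging
sums counts each chosen variable once for every part that contains it. -/
theorem sum_opt_le [DecidableEq W] {α : Type*} (A : Finset α) (S : Finset W) (B : α → Finset W)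
    (h : ∀ a ∈ A, B a ⊆ S) :
    ∑ a ∈ A, J.opt (B a) ≤ ∑ x ∈ J.sol S, J.wt x * (A.filter fun a => x ∈ B a).card := by
  calc ∑ a ∈ A, J.opt (B a) ≤ ∑ a ∈ A, J.cost (J.sol S ∩ B a) :=
        Finset.sum_le_sum fun a ha => opt_le_cost_inter hJ (h a ha)
    _ = ∑ a ∈ A, ∑ x ∈ J.sol S, if x ∈ B a then J.wt x else 0 := by
        refine Finset.sum_congr rfl fun a _ => ?_
        rw [cost, Finset.sum_ite_mem]
    _ = _ := by
        rw [Finset.sum_comm]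
        refine Finset.sum_congr rfl fun x _ => ?_
        rw [← Finset.sum_filter, Finset.sum_const, smul_eq_mul, mul_comm]

/-- The optima of disjoint parts add up to at most the optimum of the whole. -/
theorem sum_opt_le_opt {α : Type*} (A : Finset α) (S : Finset W) (B : α → Finset W)
    (h : ∀ a ∈ A, B a ⊆ S)
    (hd : ∀ a ∈ A, ∀ b ∈ A, ∀ x, x ∈ B a → x ∈ B b → a = b) :
    ∑ a ∈ A, J.opt (B a) ≤ J.opt S := by
  classical
  refine (sum_opt_le hJ A S B h).trans ?_
  rw [opt, cost]
  refine Finset.sum_le_sum fun x _ => ?_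
  have : (A.filter fun a => x ∈ B a).card ≤ 1 := by
    rw [Finset.card_le_one]
    intro a ha b hb
    simp only [Finset.mem_filter] at ha hb
    exact hd a ha.1 b hb.1 x ha.2 hb.2
  nlinarith

end

/-! ### Balls -/

section Ball

variable [Fintype W]

open Classical in
/-- The variables within distance `k` of `x`. -/
noncomputable def ball (J : CovInst W) (k : ℕ) (x : W) : Finset W :=
  Finset.univ.filter fun y => J.Near k x y

@[simp] theorem mem_ball {J : CovInst W} {k : ℕ} {x y : W} :
    y ∈ J.ball k x ↔ J.Near k x y := by simp [ball]

theorem ball_mono {J : CovInst W} {a b : ℕ} (h : a ≤ b) (x : W) : J.ball a x ⊆ J.ball b x :=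
  fun y hy => by
    rw [mem_ball] at hy ⊢
    exact hy.mono h

theorem ball_subset {J : CovInst W} {a b : ℕ} {x y : W} (k : ℕ) (h : J.Near k y x)
    (hab : k + a ≤ b) : J.ball a x ⊆ J.ball b y := fun z hz => by
  rw [mem_ball] at hz ⊢
  exact (h.trans hz).mono hab

/-- An optimal solution is locally not more expensive than the optimum of a slightly larger
ball. -/
theorem cost_sol_inter_ball_le [DecidableEq W] {J : CovInst W} (hJ : J.WellFormed) (S : Finset W) (k : ℕ) (x : W) :
    J.cost (J.sol S ∩ J.ball k x) ≤ J.opt (J.ball (k + 1) x ∩ S) := by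
  set B := J.ball k x
  set B' := J.ball (k + 1) x ∩ S
  -- Exchange: inside the ball, the optimal solution of `S` is replaced by one of the next larger
  -- ball. Constraints meeting the ball lie in the larger one, and all others lose nothing.
  have hcov : J.Covers S (J.sol S \ B ∪ J.sol B') := by
    intro c hc h1 h2
    by_cases h : ∃ y, c.1 y ≠ 0 ∧ y ∈ B
    · obtain ⟨y, hy, hyB⟩ := h
      refine (Covers.mono hJ (sol_covers hJ B') Finset.subset_union_right) c hc h1 fun z hz => ?_
      refine Finset.mem_inter.2 ⟨?_, h2 z hz⟩
      rw [mem_ball]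
      exact (mem_ball.1 hyB).step ⟨c, hc, hy, hz⟩
    · push Not at h
      refine (sol_covers hJ S c hc h1 h2).trans ?_
      have hsub : (J.sol S \ B) ⊆ J.sol S \ B ∪ J.sol B' := Finset.subset_union_left
      refine le_trans (le_of_eq ?_)
        (Finset.sum_le_sum_of_subset_of_nonneg hsub fun x _ _ => hJ.nonneg c hc x)
      symm
      refine Finset.sum_subset Finset.sdiff_subset fun z hz hz' => ?_
      by_contra h0
      exact hz' (Finset.mem_sdiff.2 ⟨hz, h z h0⟩)
  have h1 := opt_le_cost hJ hcov
  have h2 := J.cost_union_le (J.sol S \ B) (J.sol B')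
  have h3 : J.cost (J.sol S \ B) + J.cost (J.sol S ∩ B) = J.opt S := by
    unfold opt cost
    rw [add_comm]
    exact Finset.sum_inter_add_sum_sdiff _ _ _
  change _ ≤ J.cost (J.sol B')
  omega

end Ball

end CovInst

/-! ### Expectations over finite uniform spaces -/

namespace FinProb

/-- Independence is handled without measure theory: several facts below come from involutions that
exchange coordinates between independent copies of the sample. -/
theorem expect_comp_involutive {Ω : Type*} [Fintype Ω] {σ : Ω → Ω}
    (hσ : Function.Involutive σ) (F : Ω → ℝ) : 𝔼 p, F (σ p) = 𝔼 p, F p :=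
  Fintype.expect_bijective σ hσ.bijective _ _ fun _ => rfl

theorem expect_prod_type {α β : Type*} [Fintype α] [Fintype β] (F : α × β → ℝ) :
    𝔼 p, F p = 𝔼 a, 𝔼 b, F (a, b) := by
  rw [← Finset.univ_product_univ, Finset.expect_product]

variable {W X : Type*} [Fintype W] [DecidableEq W] [Fintype X] [Nonempty X]

omit [Nonempty X] in
theorem expect_prod_apply (g : W → X → ℝ) :
    𝔼 ω : W → X, ∏ v, g v (ω v) = ∏ v, 𝔼 x, g v x := by
  simp only [Fintype.expect_eq_sum_div_card]
  rw [Finset.prod_div_distrib, Finset.prod_univ_sum, Fintype.piFinset_univ]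
  simp

/-- Exchanging coordinate `u` with a fresh sample preserves the law. The inner expectation is then a
conditional expectation given all other coordinates. -/
theorem expect_update (u : W) (g : (W → X) → ℝ) :
    𝔼 ω, g ω = 𝔼 ω, 𝔼 x, g (Function.update ω u x) := by
  have hσ : Function.Involutive
      (fun p : (W → X) × X => (Function.update p.1 u p.2, p.1 u)) := by
    rintro ⟨ω, x⟩
    simp
  have h := expect_comp_involutive hσ fun p => g p.1
  rw [expect_prod_type, expect_prod_type] at h
  rw [h]
  simp

/-- Serves to discard the random numbers at identifiers that no vertex holds. -/
theorem expect_comp_injective {V : Type*} [Fintype V] [DecidableEq V] {e : V → W} (he : Function.Injective e)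
    (g : (V → X) → ℝ) : 𝔼 ω : W → X, g (fun v => ω (e v)) = 𝔼 ω : V → X, g ω := by
  classical
  have hσ : Function.Involutive (fun p : (W → X) × (V → X) =>
      ((fun w => if h : ∃ v, e v = w then p.2 h.choose else p.1 w), fun v => p.1 (e v))) := by
    rintro ⟨ω, ν⟩
    refine Prod.ext ?_ ?_
    · funext w
      by_cases h : ∃ v, e v = w
      · simp [h, h.choose_spec]
      · simp [h]
    · funext v
      have h : ∃ v', e v' = e v := ⟨v, rfl⟩
      simp only [h, dif_pos]
      rw [he h.choose_spec]
  have h := expect_comp_involutive hσ fun p => g p.2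
  rw [expect_prod_type, expect_prod_type] at h
  simpa using h

/-- Exchange the coordinates in `B` of two independent samples: `g` still sees the first sample
while `h` sees the second, so the expectation factors. -/
theorem expect_mul_of_dependsOn {A B : Set W} (hAB : Disjoint A B) {g h : (W → X) → ℝ}
    (hg : DependsOn g A) (hh : DependsOn h B) :
    𝔼 ω, g ω * h ω = (𝔼 ω, g ω) * 𝔼 ω, h ω := by
  classical
  have hσ : Function.Involutive (fun p : (W → X) × (W → X) =>
      ((fun w => if w ∈ B then p.2 w else p.1 w), fun w => if w ∈ B then p.1 w else p.2 w)) := by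
    rintro ⟨ω, ν⟩
    refine Prod.ext ?_ ?_ <;> funext w <;> by_cases h : w ∈ B <;> simp [h]
  have key := expect_comp_involutive hσ fun p => g p.1 * h p.1
  rw [expect_prod_type, expect_prod_type] at key
  simp only [Fintype.expect_const] at key
  rw [← key, Finset.expect_mul_expect]
  refine Finset.expect_congr rfl fun ω _ => Finset.expect_congr rfl fun ν _ => ?_
  congr 1
  · refine hg fun w hw => ?_
    rw [if_neg (Set.disjoint_left.1 hAB hw)]
  · refine hh fun w hw => ?_
    rw [if_pos hw]

section Pr

variable {Ω : Type*} [Fintype Ω]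

open Classical in
/-- The probability of an event on a finite uniform space. -/
noncomputable def pr (A : Ω → Prop) : ℝ := 𝔼 ω, if A ω then (1 : ℝ) else 0

theorem pr_eq_expect (A : Ω → Prop) [DecidablePred A] : pr A = 𝔼 ω, if A ω then (1 : ℝ) else 0 := by
  unfold pr
  exact Finset.expect_congr rfl fun ω _ => by congr

theorem pr_nonneg (A : Ω → Prop) : 0 ≤ pr A :=
  Finset.expect_nonneg fun ω _ => by positivity

theorem pr_mono {A B : Ω → Prop} (h : ∀ ω, A ω → B ω) : pr A ≤ pr B := by
  classical
  refine Finset.expect_le_expect fun ω _ => ?_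
  by_cases hA : A ω
  · simp [hA, h ω hA]
  · simp only [hA, if_false]; positivity

theorem pr_or_le (A B : Ω → Prop) : pr (fun ω => A ω ∨ B ω) ≤ pr A + pr B := by
  classical
  unfold pr
  rw [← Finset.expect_add_distrib]
  refine Finset.expect_le_expect fun ω _ => ?_
  by_cases hA : A ω <;> by_cases hB : B ω <;> simp [hA, hB]

theorem pr_exists_le {α : Type*} (s : Finset α) (A : α → Ω → Prop) :
    pr (fun ω => ∃ a ∈ s, A a ω) ≤ ∑ a ∈ s, pr (A a) := by
  classical
  induction s using Finset.induction_on with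
  | empty => simp [pr]
  | insert a s ha ih =>
    rw [Finset.sum_insert ha]
    refine le_trans (pr_mono fun ω => ?_) ((pr_or_le _ _).trans (add_le_add_right ih _))
    simp

theorem pr_exists_le_card {α : Type*} (s : Finset α) (A : α → Ω → Prop) {η : ℝ}
    (h : ∀ a ∈ s, pr (A a) ≤ η) : pr (fun ω => ∃ a ∈ s, A a ω) ≤ s.card * η := by
  refine (pr_exists_le s A).trans ((Finset.sum_le_sum h).trans ?_)
  simp

theorem pr_le_expect_div {g : Ω → ℝ} (hg : ∀ ω, 0 ≤ g ω) {a : ℝ} (ha : 0 < a)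
    {A : Ω → Prop} (h : ∀ ω, A ω → a ≤ g ω) : pr A ≤ (𝔼 ω, g ω) / a := by
  classical
  rw [Finset.expect_div]
  refine Finset.expect_le_expect fun ω _ => ?_
  by_cases hA : A ω
  · simp only [hA, if_true]
    rw [le_div_iff₀ ha]
    simpa using h ω hA
  · simp only [hA, if_false]
    exact div_nonneg (hg ω) ha.le

theorem pr_eq_card_div (A : Ω → Prop) [DecidablePred A] :
    pr A = (Finset.univ.filter A).card / Fintype.card Ω := by
  rw [pr, Fintype.expect_eq_sum_div_card]
  congr 1
  rw [Finset.card_filter]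
  push_cast
  exact Finset.sum_congr rfl fun ω _ => by congr

end Pr

end FinProb

/-! ### Random sparse covers from shifted distances -/

namespace CovInst

open FinProb

variable {W : Type} [Fintype W]

/-- The highest level at which some variable, shifted by `T`, reaches `x`. -/
noncomputable def peak (J : CovInst W) (R : ℕ) (T : W → ℕ) (x : W) : ℕ :=
  open scoped Classical in Nat.findGreatest (fun s => ∃ u, s ≤ T u ∧ J.Near (T u - s) u x) R

/-- The variables that `u` reaches at a level within two of the highest one. -/
noncomputable def cluster (J : CovInst W) (R : ℕ) (T : W → ℕ) (u : W) : Finset W :=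
  open scoped Classical in Finset.univ.filter fun x =>
    J.peak R T x ≤ T u + 2 ∧ J.Near (T u + 2 - J.peak R T x) u x

/-- The number of clusters that contain `x`. -/
noncomputable def mult (J : CovInst W) (R : ℕ) (T : W → ℕ) (x : W) : ℕ :=
  open scoped Classical in (Finset.univ.filter fun u => x ∈ J.cluster R T u).card

variable {J : CovInst W} {R : ℕ} {T : W → ℕ}

theorem mem_cluster {u x : W} : x ∈ J.cluster R T u ↔
    J.peak R T x ≤ T u + 2 ∧ J.Near (T u + 2 - J.peak R T x) u x := by
  simp [cluster]

theorem exists_peak (x : W) : ∃ u, J.peak R T x ≤ T u ∧ J.Near (T u - J.peak R T x) u x := by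
  classical
  exact Nat.findGreatest_spec (P := fun s => ∃ u, s ≤ T u ∧ J.Near (T u - s) u x)
    (Nat.zero_le R) ⟨x, Nat.zero_le _, .refl _ _⟩

theorem peak_le (x : W) : J.peak R T x ≤ R := by
  classical
  exact Nat.findGreatest_le _

theorem le_peak (hT : ∀ u, T u ≤ R) {x u : W} {s : ℕ} (h : s ≤ T u)
    (hn : J.Near (T u - s) u x) : s ≤ J.peak R T x := by
  classical
  exact Nat.le_findGreatest (h.trans (hT u)) ⟨u, h, hn⟩

theorem near_of_mem_cluster (hT : ∀ u, T u ≤ R) {u x : W} (h : x ∈ J.cluster R T u) :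
    J.Near (R + 2) u x := by
  rw [mem_cluster] at h
  exact h.2.mono (by have := hT u; omega)

theorem exists_mem_cluster (x : W) : ∃ u, x ∈ J.cluster R T u := by
  obtain ⟨u, h1, h2⟩ := exists_peak (J := J) (R := R) (T := T) x
  exact ⟨u, mem_cluster.2 ⟨by omega, h2.mono (by omega)⟩⟩

theorem one_le_mult (x : W) : 1 ≤ J.mult R T x := by
  classical
  obtain ⟨u, hu⟩ := exists_mem_cluster (J := J) (R := R) (T := T) x
  exact Finset.card_pos.2 ⟨u, by simpa using hu⟩

/-- Every constraint is contained in some cluster. -/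
theorem exists_cluster_of_cons (hT : ∀ u, T u ≤ R) {c : (W → ℝ) × ℝ} (hc : c ∈ J.cons) {x : W}
    (hx : c.1 x ≠ 0) : ∃ u, ∀ y, c.1 y ≠ 0 → y ∈ J.cluster R T u := by
  obtain ⟨u, h1, h2⟩ := exists_peak (J := J) (R := R) (T := T) x
  refine ⟨u, fun y hy => ?_⟩
  obtain ⟨v, h3, h4⟩ := exists_peak (J := J) (R := R) (T := T) y
  -- Peaks change by at most one per step. This unit and the unit for the extra step from `x` to `y`
  -- make up the slack two in `cluster`.
  have h5 : J.peak R T y ≤ J.peak R T x + 1 := by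
    by_cases h0 : J.peak R T y = 0
    · omega
    · have : J.peak R T y - 1 ≤ J.peak R T x := by
        refine le_peak hT (u := v) (by omega) ?_
        exact (h4.step ⟨c, hc, hy, hx⟩).mono (by omega)
      omega
  rw [mem_cluster]
  refine ⟨by omega, ?_⟩
  exact (h2.step ⟨c, hc, hx, hy⟩).mono (by omega)

theorem peak_congr {T' : W → ℕ} {x : W} (hT : ∀ u, T u ≤ R) (hT' : ∀ u, T' u ≤ R)
    (h : ∀ u ∈ J.ball R x, T u = T' u) : J.peak R T x = J.peak R T' x := by
  refine le_antisymm ?_ ?_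
  · obtain ⟨u, h1, h2⟩ := exists_peak (J := J) (R := R) (T := T) x
    have := h u (mem_ball.2 ((near_symm h2).mono (by have := hT u; omega)))
    exact le_peak hT' (u := u) (by omega) (by rwa [← this])
  · obtain ⟨u, h1, h2⟩ := exists_peak (J := J) (R := R) (T := T') x
    have := h u (mem_ball.2 ((near_symm h2).mono (by have := hT' u; omega)))
    exact le_peak hT (u := u) (by omega) (by rwa [this])

theorem mem_cluster_congr {T' : W → ℕ} {x u : W} (hT : ∀ u, T u ≤ R) (hT' : ∀ u, T' u ≤ R)
    (h : ∀ u ∈ J.ball (R + 2) x, T u = T' u) :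
    x ∈ J.cluster R T u ↔ x ∈ J.cluster R T' u := by
  have hp : J.peak R T x = J.peak R T' x :=
    peak_congr hT hT' fun u hu => h u (ball_mono (by omega) x hu)
  by_cases hu : u ∈ J.ball (R + 2) x
  · rw [mem_cluster, mem_cluster, hp, h u hu]
  · constructor <;> intro hx <;> exfalso <;> apply hu
    · exact mem_ball.2 (near_symm (near_of_mem_cluster hT hx))
    · exact mem_ball.2 (near_symm (near_of_mem_cluster hT' hx))

/-- This is what makes the multiplicities of variables further apart than `2 * (R + 2)` independent
in `pr_sum_mult_le`. -/
theorem mult_congr {T' : W → ℕ} {x : W} (hT : ∀ u, T u ≤ R) (hT' : ∀ u, T' u ≤ R)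
    (h : ∀ u ∈ J.ball (R + 2) x, T u = T' u) : J.mult R T x = J.mult R T' x := by
  unfold mult
  congr 1
  ext u
  simp [mem_cluster_congr hT hT' h]

/-- `u` reaches `x` at a strictly higher level than every other variable does. -/
def IsTop (J : CovInst W) (T : W → ℕ) (x u : W) : Prop :=
  ∃ k, J.Near k u x ∧ k ≤ T u ∧ ∀ w ≠ u, ∀ j, J.Near j w x → j ≤ T w → T w - j < T u - k

omit [Fintype W] in
theorem IsTop.unique {x u v : W} (hu : J.IsTop T x u) (hv : J.IsTop T x v) : u = v := by
  by_contra huv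
  obtain ⟨k, h1, h2, h3⟩ := hu
  obtain ⟨j, h4, h5, h6⟩ := hv
  have a := h3 v (Ne.symm huv) j h4 h5
  have b := h6 u huv k h1 h2
  omega

/-- The tail of the shift distribution decays slowly: three further levels cost only a fraction
`κ`, up to an error `e`. -/
def SlowTail {X : Type*} [Fintype X] (sh : X → ℕ) (κ e : ℝ) : Prop :=
  ∀ s, pr (fun x => s ≤ sh x) - pr (fun x => s + 3 ≤ sh x) ≤ κ * pr (fun x => s ≤ sh x) + e

/-! ### Multiplicities for independent random shifts -/

section Random

variable [DecidableEq W] {X : Type*} [Fintype X] [Nonempty X] {sh : X → ℕ} {κ e : ℝ}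

-- All shifts but that of `u` are frozen. Joining the cluster forces the shift of `u` up to some
-- threshold, and three levels more make `u` the unique top, so `SlowTail` compares the two
-- probabilities. Unlike membership, being the top happens to at most one `u`, which is what
-- `expect_mult_le` sums.
omit [Nonempty X] in
theorem pr_mem_cluster_update_le (hsh : ∀ x, sh x ≤ R) (ht : SlowTail sh κ e) (hκ : κ ≤ 1)
    {x u : W} (hux : J.Near (R + 2) u x) (ω : W → X) :
    (1 - κ) * pr (fun τ => x ∈ J.cluster R (fun v => sh (Function.update ω u τ v)) u) ≤
      pr (fun τ => J.IsTop (fun v => sh (Function.update ω u τ v)) x u) + e := by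
  classical
  set T := fun v => sh (ω v) with hTdef
  have hex : ∃ k, J.Near k u x := ⟨_, hux⟩
  set d := Nat.find hex with hd
  have hdn : J.Near d u x := Nat.find_spec hex
  -- One more than the highest level at which another variable reaches `x`, or zero if none does. Up
  -- to truncation, membership needs level `A - 3` from `u`, and level `A` makes it the top.
  set A := Nat.findGreatest
    (fun s => ∃ w ≠ u, ∃ j, J.Near j w x ∧ j ≤ T w ∧ s = T w - j + 1) (R + 1) with hA
  have hA1 : ∀ w ≠ u, ∀ j, J.Near j w x → j ≤ T w → T w - j + 1 ≤ A := fun w hw j hj hjT =>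
    Nat.le_findGreatest (by have := hsh (ω w); simp only [hTdef]; omega) ⟨w, hw, j, hj, hjT, rfl⟩
  have e1 : pr (fun τ => x ∈ J.cluster R (fun v => sh (Function.update ω u τ v)) u) ≤
      pr (fun τ => A + d - 3 ≤ sh τ) := by
    refine pr_mono fun τ hτ => ?_
    rw [mem_cluster] at hτ
    simp only [Function.update_self] at hτ
    have h1 : d ≤ sh τ + 2 - J.peak R (fun v => sh (Function.update ω u τ v)) x :=
      Nat.find_min' hex hτ.2
    have h2 : A ≤ J.peak R (fun v => sh (Function.update ω u τ v)) x + 1 := by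
      by_cases h0 : A = 0
      · omega
      · obtain ⟨w, hw, j, hj, hjT, hs⟩ := Nat.findGreatest_of_ne_zero hA.symm h0
        have : T w - j ≤ J.peak R (fun v => sh (Function.update ω u τ v)) x := by
          refine le_peak (fun v => hsh _) (u := w) ?_ ?_
          · simp only [Function.update_of_ne hw]; exact Nat.sub_le _ _
          · simp only [Function.update_of_ne hw]
            exact hj.mono (by simp only [hTdef] at hjT ⊢; omega)
        omega
    omega
  have e2 : pr (fun τ => A + d - 3 + 3 ≤ sh τ) ≤
      pr (fun τ => J.IsTop (fun v => sh (Function.update ω u τ v)) x u) := by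
    refine pr_mono fun τ hτ => ⟨d, hdn, ?_, fun w hw j hj hjT => ?_⟩
    · simp only [Function.update_self]; omega
    · simp only [Function.update_self, Function.update_of_ne hw] at hjT ⊢
      have := hA1 w hw j hj hjT
      simp only [hTdef] at this
      omega
  have h3 := ht (A + d - 3)
  have h4 : (1 - κ) * pr (fun τ => x ∈ J.cluster R (fun v => sh (Function.update ω u τ v)) u) ≤
      (1 - κ) * pr (fun τ => A + d - 3 ≤ sh τ) := mul_le_mul_of_nonneg_left e1 (by linarith)
  linarith

/-- In expectation a variable lies in little more than one cluster. -/
theorem expect_mult_le (hsh : ∀ x, sh x ≤ R) (ht : SlowTail sh κ e) (hκ : κ ≤ 1) (he : 0 ≤ e)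
    {x : W} {n : ℕ} (hn : (J.ball (R + 2) x).card ≤ n) :
    (1 - κ) * 𝔼 ω : W → X, (J.mult R (fun v => sh (ω v)) x : ℝ) ≤ 1 + n * e := by
  classical
  have h1 : ∀ ω : W → X, (J.mult R (fun v => sh (ω v)) x : ℝ) =
      ∑ u ∈ J.ball (R + 2) x, if x ∈ J.cluster R (fun v => sh (ω v)) u then (1 : ℝ) else 0 := by
    intro ω
    rw [mult, Finset.card_filter]
    push_cast
    symm
    refine Finset.sum_subset (Finset.subset_univ _) fun u _ hu => ?_
    rw [if_neg]
    intro h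
    exact hu (mem_ball.2 (near_symm (near_of_mem_cluster (fun _ => hsh _) h)))
  have h2 : ∀ u ∈ J.ball (R + 2) x,
      (1 - κ) * pr (fun ω : W → X => x ∈ J.cluster R (fun v => sh (ω v)) u) ≤
        pr (fun ω : W → X => J.IsTop (fun v => sh (ω v)) x u) + e := by
    intro u hu
    rw [pr_eq_expect, pr_eq_expect, expect_update u,
      expect_update u (g := fun ω => if J.IsTop _ x u then _ else _), Finset.mul_expect]
    have : e = 𝔼 ω : W → X, e := by simp
    rw [this, ← Finset.expect_add_distrib]
    refine Finset.expect_le_expect fun ω _ => ?_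
    rw [← pr_eq_expect, ← pr_eq_expect]
    exact pr_mem_cluster_update_le hsh ht hκ (near_symm (mem_ball.1 hu)) ω
  have h3 : ∑ u ∈ J.ball (R + 2) x, pr (fun ω : W → X => J.IsTop (fun v => sh (ω v)) x u) ≤ 1 := by
    simp only [pr_eq_expect]
    rw [← Finset.expect_sum_comm]
    have : (1 : ℝ) = 𝔼 ω : W → X, (1 : ℝ) := by simp
    refine le_of_le_of_eq (Finset.expect_le_expect fun ω _ => ?_) this.symm
    rw [← Finset.sum_filter, Finset.sum_const, nsmul_one]
    norm_cast
    rw [Finset.card_le_one]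
    intro u hu v hv
    exact (Finset.mem_filter.1 hu).2.unique (Finset.mem_filter.1 hv).2
  calc (1 - κ) * 𝔼 ω : W → X, (J.mult R (fun v => sh (ω v)) x : ℝ)
      = ∑ u ∈ J.ball (R + 2) x,
          (1 - κ) * pr (fun ω : W → X => x ∈ J.cluster R (fun v => sh (ω v)) u) := by
        rw [← Finset.mul_sum]
        simp only [pr_eq_expect]
        rw [← Finset.expect_sum_comm]
        congr 1
        exact Finset.expect_congr rfl fun ω _ => h1 ω
    _ ≤ ∑ u ∈ J.ball (R + 2) x,
          (pr (fun ω : W → X => J.IsTop (fun v => sh (ω v)) x u) + e) := Finset.sum_le_sum h2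
    _ ≤ 1 + n * e := by
        rw [Finset.sum_add_distrib, Finset.sum_const, nsmul_eq_mul]
        have : ((J.ball (R + 2) x).card : ℝ) * e ≤ n * e :=
          mul_le_mul_of_nonneg_right (by exact_mod_cast hn) he
        linarith

/-- It is unlikely that a variable lies in many clusters. -/
theorem pr_le_mult_le (hsh : ∀ x, sh x ≤ R) (ht : SlowTail sh κ e) (hκ : κ ≤ 1 / 4) (he : 0 ≤ e)
    {x : W} {n : ℕ} (hn : (J.ball (R + 2) x).card ≤ n) (B : ℕ) :
    pr (fun ω : W → X => B ≤ J.mult R (fun v => sh (ω v)) x) ≤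
      (R + 1) * ((1 + 4 * e) ^ n / 4 ^ B) := by
  classical
  -- With `s` the peak of `x`, `P` says that the shift `τ` of `u` puts `x` into the cluster of `u`,
  -- and `Q` that it would lift the peak above `s`. For fixed `s` both concern a single shift, so
  -- the count is controlled by a product of independent factors; the price is a union bound over
  -- the `R + 1` values of `s`.
  let P : ℕ → W → ℕ → Prop := fun s u τ => s ≤ τ + 2 ∧ J.Near (τ + 2 - s) u x
  let Q : ℕ → W → ℕ → Prop := fun s u τ => s + 1 ≤ τ ∧ J.Near (τ - (s + 1)) u x
  let φ : ℕ → W → X → ℝ := fun s u τ =>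
    if P s u (sh τ) then (if Q s u (sh τ) then 0 else 4) else 1
  have hφ0 : ∀ s u τ, 0 ≤ φ s u τ := by
    intro s u τ
    simp only [φ]
    split_ifs <;> norm_num
  have hfar : ∀ s u, u ∉ J.ball (R + 2) x → ∀ τ, φ s u τ = 1 := by
    intro s u hu τ
    simp only [φ]
    rw [if_neg]
    rintro ⟨_, h⟩
    exact hu (mem_ball.2 (near_symm (h.mono (by have := hsh τ; omega))))
  -- The value `4` for joining is offset by the value `0` for overshooting: if `p` is the chance of
  -- reaching the threshold, the mean is at most `1 - p + 4 * (κ * p + e)`, and `κ ≤ 1 / 4` leaves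
  -- `1 + 4 * e`.
  have hE : ∀ s u, 𝔼 τ, φ s u τ ≤ 1 + 4 * e := by
    intro s u
    by_cases hex : ∃ k, J.Near k u x
    swap
    · have : ∀ τ, φ s u τ = 1 := by
        intro τ
        simp only [φ]
        rw [if_neg]
        rintro ⟨_, h⟩
        exact hex ⟨_, h⟩
      simp only [this, Fintype.expect_const]
      linarith
    set d := Nat.find hex
    have hdn : J.Near d u x := Nat.find_spec hex
    have hb : ∀ τ, φ s u τ ≤ 1 - (if s + d - 2 ≤ sh τ then 1 else 0) +
        4 * ((if s + d - 2 ≤ sh τ then 1 else 0) -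
          (if s + d - 2 + 3 ≤ sh τ then (1 : ℝ) else 0)) := by
      intro τ
      by_cases h1 : s + d - 2 ≤ sh τ
      · by_cases h2 : s + d - 2 + 3 ≤ sh τ
        · have hP : P s u (sh τ) := ⟨by omega, hdn.mono (by omega)⟩
          have hQ : Q s u (sh τ) := ⟨by omega, hdn.mono (by omega)⟩
          simp [φ, h1, h2, hP, hQ]
        · simp only [φ, h1, h2, if_true, if_false]
          split_ifs <;> norm_num
      · have hP : ¬ P s u (sh τ) := by
          rintro ⟨h3, h4⟩
          have : d ≤ _ := Nat.find_min' hex h4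
          omega
        have h2 : ¬ s + d - 2 + 3 ≤ sh τ := by omega
        simp [φ, h1, h2, hP]
    refine (Finset.expect_le_expect fun τ _ => hb τ).trans ?_
    rw [Finset.expect_add_distrib, Finset.expect_sub_distrib, ← Finset.mul_expect,
      Finset.expect_sub_distrib]
    have h3 := ht (s + d - 2)
    have h4 := pr_nonneg (fun τ => s + d - 2 ≤ sh τ)
    simp only [Fintype.expect_const]
    rw [pr_eq_expect] at h4
    rw [pr_eq_expect, pr_eq_expect] at h3
    nlinarith
  have key : ∀ s, pr (fun ω : W → X => B ≤ J.mult R (fun v => sh (ω v)) x ∧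
      J.peak R (fun v => sh (ω v)) x = s) ≤ (1 + 4 * e) ^ n / 4 ^ B := by
    intro s
    refine (pr_le_expect_div (g := fun ω => ∏ u, φ s u (ω u))
      (fun ω => Finset.prod_nonneg fun u _ => hφ0 _ _ _) (a := 4 ^ B) (by positivity) ?_).trans ?_
    · rintro ω ⟨hB, hs⟩
      have hQ : ∀ u, ¬ Q s u (sh (ω u)) := by
        rintro u ⟨h1, h2⟩
        have := le_peak (J := J) (T := fun v => sh (ω v)) (fun _ => hsh _) (u := u) h1 h2
        omega
      have : ∀ u, φ s u (ω u) = if x ∈ J.cluster R (fun v => sh (ω v)) u then 4 else 1 := by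
        intro u
        have : P s u (sh (ω u)) ↔ x ∈ J.cluster R (fun v => sh (ω v)) u := by
          rw [mem_cluster, hs]
        simp only [φ, hQ u, if_false, this]
      simp only [this]
      rw [Finset.prod_ite, Finset.prod_const, Finset.prod_const_one, mul_one]
      refine pow_le_pow_right₀ (by norm_num) (hB.trans (le_of_eq ?_))
      unfold mult
      congr
    · rw [expect_prod_apply]
      refine div_le_div_of_nonneg_right ?_ (by positivity)
      have : ∏ u, 𝔼 τ, φ s u τ = ∏ u ∈ J.ball (R + 2) x, 𝔼 τ, φ s u τ := by
        symm
        refine Finset.prod_subset (Finset.subset_univ _) fun u _ hu => ?_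
        simp [hfar s u hu]
      rw [this]
      refine (Finset.prod_le_prod (fun u _ => Finset.expect_nonneg fun τ _ => hφ0 _ _ _)
        fun u _ => hE s u).trans ?_
      rw [Finset.prod_const]
      exact pow_le_pow_right₀ (by linarith) hn
  have := pr_exists_le_card (Finset.range (R + 1)) (fun s (ω : W → X) =>
    B ≤ J.mult R (fun v => sh (ω v)) x ∧ J.peak R (fun v => sh (ω v)) x = s) (fun s _ => key s)
  refine (pr_mono fun ω hω => ?_).trans (this.trans (le_of_eq (by simp)))
  exact ⟨_, Finset.mem_range.2 (Nat.lt_succ_of_le (peak_le x)), hω, rfl⟩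

end Random

end CovInst

/-! ### A moment bound for weighted sums of locally dependent variables -/

namespace FinProb

variable {W X : Type*} [Fintype W] [DecidableEq W] [Fintype X] [Nonempty X]

-- The power is peeled off one factor at a time, and `h` holds the variables already peeled, indexed
-- by `s`. A new `Z x` whose dependence set misses all earlier ones contributes `α` by independence.
-- Otherwise it is bounded by `B`, and the `x` that meet a given earlier set have total weight at
-- most `Δ`; there are at most `m` such sets.
open Classical in
theorem expect_mul_sum_pow_le {Z : W → (W → X) → ℝ} {A : W → Set W} {w : W → ℝ} {B α Δ : ℝ}
    (hB : 0 ≤ B) (hα : 0 ≤ α) (hΔ : 0 ≤ Δ)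
    (hZ0 : ∀ x ω, 0 ≤ Z x ω) (hZB : ∀ x ω, Z x ω ≤ B) (hdep : ∀ x, DependsOn (Z x) (A x))
    (hZα : ∀ x, w x ≠ 0 → 𝔼 ω, Z x ω ≤ α) (hw : ∀ x, 0 ≤ w x)
    (hwΔ : ∀ x, w x ≠ 0 → ∑ y with ¬ Disjoint (A x) (A y), w y ≤ Δ) (m p : ℕ) (s : Finset W)
    (hs : s.card + p ≤ m) (hsw : ∀ x ∈ s, w x ≠ 0) (h : (W → X) → ℝ) (hh0 : ∀ ω, 0 ≤ h ω)
    (hh : DependsOn h (⋃ x ∈ s, A x)) :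
    𝔼 ω, h ω * (∑ x, w x * Z x ω) ^ p ≤ (α * ∑ x, w x + m * B * Δ) ^ p * 𝔼 ω, h ω := by
  set C := α * ∑ x, w x + m * B * Δ with hC
  have hW : 0 ≤ ∑ x, w x := Finset.sum_nonneg fun x _ => hw x
  have hC0 : 0 ≤ C := by positivity
  induction p generalizing s h with
  | zero => simp
  | succ p ih =>
    have hEh : 0 ≤ 𝔼 ω, h ω := Finset.expect_nonneg fun ω _ => hh0 ω
    have h1 : 𝔼 ω, h ω * (∑ x, w x * Z x ω) ^ (p + 1) =
        ∑ x, w x * 𝔼 ω, (h ω * Z x ω) * (∑ x, w x * Z x ω) ^ p := by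
      simp only [Finset.mul_expect]
      rw [← Finset.expect_sum_comm]
      refine Finset.expect_congr rfl fun ω _ => ?_
      rw [pow_succ, ← mul_assoc, Finset.mul_sum]
      refine Finset.sum_congr rfl fun x _ => ?_
      ring
    have h2 : ∀ x, w x * 𝔼 ω, (h ω * Z x ω) * (∑ x, w x * Z x ω) ^ p ≤
        C ^ p * (w x * 𝔼 ω, h ω * Z x ω) := by
      intro x
      by_cases hx : w x = 0
      · simp [hx]
      have h3 : DependsOn (fun ω => h ω * Z x ω) (⋃ y ∈ insert x s, A y) := by
        intro ω ω' hω
        have e1 := hh (x := ω) (y := ω') fun i hi => hω i (by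
          simp only [Set.mem_iUnion] at hi ⊢
          obtain ⟨y, hy, hyi⟩ := hi
          exact ⟨y, Finset.mem_insert_of_mem hy, hyi⟩)
        have hd := hdep x
        have e2 := hd (x := ω) (y := ω') fun i hi => hω i (by
          simp only [Set.mem_iUnion]
          exact ⟨x, Finset.mem_insert_self _ _, hi⟩)
        simp only [e1, e2]
      have h4 := ih (insert x s) (by have := Finset.card_insert_le x s; omega)
        (by intro y hy
            rcases Finset.mem_insert.1 hy with rfl | hy
            · exact hx
            · exact hsw y hy) (fun ω => h ω * Z x ω)
        (fun ω => mul_nonneg (hh0 ω) (hZ0 x ω)) h3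
      calc _ ≤ w x * (C ^ p * 𝔼 ω, h ω * Z x ω) := mul_le_mul_of_nonneg_left h4 (hw x)
        _ = _ := by ring
    have h5 : ∀ x, w x * 𝔼 ω, h ω * Z x ω ≤
        (α * w x + ∑ y ∈ s, if ¬ Disjoint (A y) (A x) then B * w x else 0) * 𝔼 ω, h ω := by
      intro x
      by_cases hx : w x = 0
      · simp [hx]
      have hnn : ∀ y ∈ s, 0 ≤ if ¬ Disjoint (A y) (A x) then B * w x else 0 := by
        intro y _
        have := hw x
        positivity
      by_cases hd : ∀ y ∈ s, Disjoint (A y) (A x)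
      · have h6 : 𝔼 ω, h ω * Z x ω = (𝔼 ω, h ω) * 𝔼 ω, Z x ω := by
          refine expect_mul_of_dependsOn ?_ hh (hdep x)
          simpa using hd
        rw [h6]
        have h7 := hZα x hx
        have h8 := Finset.sum_nonneg hnn
        calc w x * ((𝔼 ω, h ω) * 𝔼 ω, Z x ω) ≤ w x * ((𝔼 ω, h ω) * α) := by
              gcongr
              exact hw x
          _ = (α * w x + 0) * 𝔼 ω, h ω := by ring
          _ ≤ _ := by gcongr
      · push Not at hd
        obtain ⟨y, hy, hyd⟩ := hd
        have h6 : 𝔼 ω, h ω * Z x ω ≤ B * 𝔼 ω, h ω := by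
          rw [Finset.mul_expect]
          refine Finset.expect_le_expect fun ω _ => ?_
          rw [mul_comm]
          exact mul_le_mul_of_nonneg_right (hZB x ω) (hh0 ω)
        have h7 : B * w x ≤ ∑ y ∈ s, if ¬ Disjoint (A y) (A x) then B * w x else 0 := by
          refine le_trans (le_of_eq ?_) (Finset.single_le_sum hnn hy)
          rw [if_pos hyd]
        calc w x * 𝔼 ω, h ω * Z x ω ≤ w x * (B * 𝔼 ω, h ω) := by
              gcongr
              exact hw x
          _ = (0 + B * w x) * 𝔼 ω, h ω := by ring
          _ ≤ _ := by
              gcongr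
              have := hw x
              positivity
    have h8 : ∑ x, (α * w x + ∑ y ∈ s, if ¬ Disjoint (A y) (A x) then B * w x else 0) ≤ C := by
      rw [Finset.sum_add_distrib, ← Finset.mul_sum, Finset.sum_comm, hC]
      gcongr
      calc ∑ y ∈ s, ∑ x, (if ¬ Disjoint (A y) (A x) then B * w x else 0) ≤ ∑ y ∈ s, B * Δ := by
            refine Finset.sum_le_sum fun y hy => ?_
            rw [← Finset.sum_filter, ← Finset.mul_sum]
            exact mul_le_mul_of_nonneg_left (hwΔ y (hsw y hy)) hB
        _ = s.card * (B * Δ) := by simp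
        _ ≤ m * (B * Δ) := by
            gcongr
            omega
        _ = m * B * Δ := by ring
    calc 𝔼 ω, h ω * (∑ x, w x * Z x ω) ^ (p + 1) ≤ ∑ x, C ^ p * (w x * 𝔼 ω, h ω * Z x ω) := by
          rw [h1]
          exact Finset.sum_le_sum fun x _ => h2 x
      _ ≤ C ^ p * ∑ x, (α * w x + ∑ y ∈ s, if ¬ Disjoint (A y) (A x) then B * w x else 0) *
            𝔼 ω, h ω := by
          rw [← Finset.mul_sum]
          exact mul_le_mul_of_nonneg_left (Finset.sum_le_sum fun x _ => h5 x) (by positivity)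
      _ ≤ C ^ p * (C * 𝔼 ω, h ω) := by
          rw [← Finset.sum_mul]
          gcongr
      _ = C ^ (p + 1) * 𝔼 ω, h ω := by ring

end FinProb

/-! ### Concentration of the weight of a random sparse cover -/

namespace CovInst

open FinProb

variable {W : Type} [Fintype W] [DecidableEq W] {J : CovInst W} {R : ℕ}
  {X : Type*} [Fintype X] [Nonempty X] {sh : X → ℕ} {κ e : ℝ}

/-- If no ball carries much weight, the total weight of a random sparse cover is concentrated. -/
theorem pr_sum_mult_le (hsh : ∀ x, sh x ≤ R) (ht : SlowTail sh κ e) (hκ : κ ≤ 1 / 4)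
    (he : 0 ≤ e) {w : W → ℝ} (hw : ∀ x, 0 ≤ w x) {n B p : ℕ} {α Δ c : ℝ} (hα : 0 ≤ α)
    (hΔ : 0 ≤ Δ) (hsupp : (Finset.univ.filter fun x => w x ≠ 0).card ≤ n)
    (hn : ∀ x, w x ≠ 0 → (J.ball (R + 2) x).card ≤ n)
    (hαe : 1 + n * e ≤ (1 - κ) * (1 + α))
    (hwΔ : ∀ x, w x ≠ 0 → ∑ y ∈ J.ball (2 * (R + 2)) x, w y ≤ Δ) (hc : 0 < c)
    (hcC : α * ∑ x, w x + p * B * Δ ≤ c) :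
    pr (fun ω : W → X => 4 * c < ∑ x, w x * ((J.mult R (fun v => sh (ω v)) x : ℝ) - 1)) ≤
      1 / 4 ^ p + n * ((R + 1) * ((1 + 4 * e) ^ n / 4 ^ B)) := by
  classical
  -- The moment bound needs bounded variables, so the excess multiplicity is truncated at `B`;
  -- `pr_le_mult_le` bounds the chance that the truncation ever matters.
  set Z : W → (W → X) → ℝ := fun x ω => min ((J.mult R (fun v => sh (ω v)) x : ℝ) - 1) B with hZ
  have hZ0 : ∀ x ω, 0 ≤ Z x ω := by
    intro x ω
    have : (1 : ℝ) ≤ J.mult R (fun v => sh (ω v)) x := by exact_mod_cast one_le_mult x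
    exact le_min (by linarith) (Nat.cast_nonneg _)
  have hdep : ∀ x, DependsOn (Z x) (J.ball (R + 2) x : Set W) := by
    intro x ω ω' h
    have := mult_congr (J := J) (x := x) (T := fun v => sh (ω v)) (T' := fun v => sh (ω' v))
      (fun _ => hsh _) (fun _ => hsh _) fun u hu => by rw [h u hu]
    simp only [hZ, this]
  have hdisj : ∀ x y, ¬ Disjoint (J.ball (R + 2) x : Set W) (J.ball (R + 2) y : Set W) →
      y ∈ J.ball (2 * (R + 2)) x := by
    intro x y h
    rw [Set.not_disjoint_iff] at h
    obtain ⟨z, hzx, hzy⟩ := h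
    simp only [Finset.mem_coe, mem_ball] at hzx hzy ⊢
    exact (hzx.trans (near_symm hzy)).mono (by omega)
  have hZα : ∀ x, w x ≠ 0 → 𝔼 ω, Z x ω ≤ α := by
    intro x hx
    have h1 := expect_mult_le (J := J) hsh ht (by linarith) he (hn x hx)
    have h2 : 𝔼 ω, Z x ω ≤ (𝔼 ω : W → X, (J.mult R (fun v => sh (ω v)) x : ℝ)) - 1 := by
      have : (1 : ℝ) = 𝔼 ω : W → X, (1 : ℝ) := by simp
      rw [this, ← Finset.expect_sub_distrib]
      exact Finset.expect_le_expect fun ω _ => min_le_left _ _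
    have h3 : (1 - κ) * (𝔼 ω : W → X, (J.mult R (fun v => sh (ω v)) x : ℝ)) ≤
        (1 - κ) * (1 + α) := h1.trans hαe
    have h4 := le_of_mul_le_mul_left h3 (by linarith)
    linarith
  have hmom := expect_mul_sum_pow_le (Z := Z) (A := fun x => (J.ball (R + 2) x : Set W)) (w := w)
    (B := B) (Nat.cast_nonneg B) hα hΔ hZ0 (fun x ω => min_le_right _ _) hdep hZα hw
    (fun x hx => (Finset.sum_le_sum_of_subset_of_nonneg (fun y hy => hdisj x y (by simpa using hy))
      fun y _ _ => hw y).trans (hwΔ x hx)) p p ∅ (by simp) (by simp) (fun _ => 1)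
    (fun _ => zero_le_one) (fun _ _ _ => rfl)
  simp only [one_mul, Fintype.expect_const, mul_one] at hmom
  have hF0 : ∀ ω, 0 ≤ ∑ x, w x * Z x ω := fun ω =>
    Finset.sum_nonneg fun x _ => mul_nonneg (hw x) (hZ0 x ω)
  -- Markov's inequality for the `p`th moment, which is at most `c ^ p`, against the threshold `(4 *
  -- c) ^ p`.
  have h1 : pr (fun ω : W → X => 4 * c < ∑ x, w x * Z x ω) ≤ 1 / 4 ^ p := by
    refine (pr_le_expect_div (g := fun ω => (∑ x, w x * Z x ω) ^ p)
      (fun ω => pow_nonneg (hF0 ω) p) (a := (4 * c) ^ p) (by positivity) fun ω hω => ?_).trans ?_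
    · exact pow_le_pow_left₀ (by positivity) hω.le p
    · rw [div_le_div_iff₀ (by positivity) (by positivity), mul_pow, one_mul, mul_comm]
      refine mul_le_mul_of_nonneg_left (hmom.trans ?_) (by positivity)
      have : 0 ≤ ∑ x, w x := Finset.sum_nonneg fun x _ => hw x
      exact pow_le_pow_left₀ (by positivity) hcC p
  have h2 : pr (fun ω : W → X => ∃ x ∈ Finset.univ.filter (fun x => w x ≠ 0),
      B ≤ J.mult R (fun v => sh (ω v)) x) ≤ n * ((R + 1) * ((1 + 4 * e) ^ n / 4 ^ B)) := by
    refine (pr_exists_le_card _ _ fun x hx =>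
      pr_le_mult_le hsh ht hκ he (hn x (Finset.mem_filter.1 hx).2) B).trans ?_
    gcongr
  refine le_trans (pr_mono fun ω hω => ?_) ((pr_or_le _ _).trans (add_le_add h1 h2))
  by_contra hcon
  push Not at hcon
  obtain ⟨h3, h4⟩ := hcon
  refine absurd hω (not_lt.2 (le_trans (Finset.sum_le_sum fun x _ => ?_) h3))
  by_cases hx : w x = 0
  · simp [hx]
  · refine mul_le_mul_of_nonneg_left (le_min le_rfl ?_) (hw x)
    have : (J.mult R (fun v => sh (ω v)) x : ℝ) ≤ B := by
      exact_mod_cast (h4 x (by simp [hx])).le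
    linarith

end CovInst

/-! ### A locally computable estimate of the weight of an optimal solution -/

namespace CovInst

open FinProb

section Density

variable {W : Type} [Fintype W] [DecidableEq W] {J : CovInst W} {R : ℕ}
  {X : Type*} [Fintype X] {sh : X → ℕ}

/-- The expected weight that `x` contributes to optimal solutions of the clusters of a random
sparse cover, restricted to `S`. -/
noncomputable def density (J : CovInst W) (R : ℕ) (sh : X → ℕ) (S : Finset W) (x : W) : ℝ :=
  𝔼 ω : W → X, ∑ u, if x ∈ J.sol (J.cluster R (fun v => sh (ω v)) u ∩ S) then (J.wt x : ℝ) else 0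

theorem density_nonneg (S : Finset W) (x : W) : 0 ≤ J.density R sh S x :=
  Finset.expect_nonneg fun ω _ => Finset.sum_nonneg fun u _ => by positivity

theorem sum_ball_density (S : Finset W) (k : ℕ) (x : W) :
    ∑ y ∈ J.ball k x, J.density R sh S y = 𝔼 ω : W → X,
      ∑ u, (J.cost (J.sol (J.cluster R (fun v => sh (ω v)) u ∩ S) ∩ J.ball k x) : ℝ) := by
  unfold density
  rw [← Finset.expect_sum_comm]
  refine Finset.expect_congr rfl fun ω _ => ?_
  rw [Finset.sum_comm]
  refine Finset.sum_congr rfl fun u _ => ?_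
  rw [Finset.inter_comm _ (J.ball k x), cost, Finset.sum_ite_mem]
  push_cast
  rfl

theorem cluster_subset_ball {T : W → ℕ} (hT : ∀ u, T u ≤ R) {u x y : W} {k : ℕ}
    (h : y ∈ J.cluster R T u) (hy : y ∈ J.ball k x) :
    J.cluster R T u ⊆ J.ball (k + 2 * (R + 2)) x := fun z hz => by
  have h1 := near_of_mem_cluster hT h
  have h2 := near_of_mem_cluster hT hz
  rw [mem_ball] at hy ⊢
  exact ((hy.trans (near_symm h1)).trans h2).mono (by omega)

variable (hJ : J.WellFormed)
include hJ

/-- For every outcome, the solutions of the clusters meeting the ball cover the constraints inside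
it, and these clusters stay within `2 * (R + 2)` of the ball. Together with `sum_density_le`,
density sums over balls reproduce local optima up to a factor two and this change of radius, so
every variable knows its own share. -/
theorem opt_ball_le_sum_density [Nonempty X] (hsh : ∀ x, sh x ≤ R) (S : Finset W) (k : ℕ) (x : W) :
    (J.opt (J.ball k x ∩ S) : ℝ) ≤ ∑ y ∈ J.ball (k + 2 * (R + 2)) x, J.density R sh S y := by
  classical
  rw [sum_ball_density]
  have : (J.opt (J.ball k x ∩ S) : ℝ) = 𝔼 ω : W → X, (J.opt (J.ball k x ∩ S) : ℝ) := by simp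
  rw [this]
  refine Finset.expect_le_expect fun ω _ => ?_
  set T := fun v => sh (ω v)
  have hT : ∀ u, T u ≤ R := fun _ => hsh _
  set A := Finset.univ.filter fun u => (J.cluster R T u ∩ J.ball k x).Nonempty with hA
  have hcov : J.Covers (J.ball k x ∩ S) (A.biUnion fun u => J.sol (J.cluster R T u ∩ S)) := by
    intro c hc h1 h2
    obtain ⟨y, hy⟩ := h1
    obtain ⟨u, hu⟩ := exists_cluster_of_cons hT hc hy
    have huA : u ∈ A := by
      simp only [hA, Finset.mem_filter, Finset.mem_univ, true_and]
      exact ⟨y, Finset.mem_inter.2 ⟨hu y hy, (Finset.mem_inter.1 (h2 y hy)).1⟩⟩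
    refine Covers.mono hJ (sol_covers hJ (J.cluster R T u ∩ S))
      (Finset.subset_biUnion_of_mem (fun u => J.sol (J.cluster R T u ∩ S)) huA) c hc ⟨y, hy⟩ ?_
    exact fun z hz => Finset.mem_inter.2 ⟨hu z hz, (Finset.mem_inter.1 (h2 z hz)).2⟩
  have h3 := (opt_le_cost hJ hcov).trans (J.cost_biUnion_le A _)
  have h4 : ∑ u ∈ A, J.cost (J.sol (J.cluster R T u ∩ S)) ≤
      ∑ u, J.cost (J.sol (J.cluster R T u ∩ S) ∩ J.ball (k + 2 * (R + 2)) x) := by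
    refine (Finset.sum_le_sum fun u hu => J.cost_mono ?_).trans
      (Finset.sum_le_sum_of_subset (Finset.subset_univ A))
    obtain ⟨y, hy⟩ := (Finset.mem_filter.1 hu).2
    obtain ⟨hy1, hy2⟩ := Finset.mem_inter.1 hy
    refine Finset.subset_inter subset_rfl ?_
    exact (sol_subset hJ _).trans
      (Finset.inter_subset_left.trans (cluster_subset_ball hT hy1 hy2))
  exact_mod_cast h3.trans h4

/-- The clusters meeting the ball lie in the larger ball. An optimal solution there, cut down to the
clusters, is counted with multiplicities, whose means are at most two. -/
theorem sum_density_le (hsh : ∀ x, sh x ≤ R) (S : Finset W) (k : ℕ) (x : W)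
    (hm : ∀ y, J.wt y ≠ 0 → 𝔼 ω : W → X, (J.mult R (fun v => sh (ω v)) y : ℝ) ≤ 2) :
    ∑ y ∈ J.ball k x, J.density R sh S y ≤ 2 * J.opt (J.ball (k + 2 * (R + 2)) x ∩ S) := by
  classical
  rw [sum_ball_density]
  set S' := J.ball (k + 2 * (R + 2)) x ∩ S
  have h1 : ∀ ω : W → X,
      ∑ u, (J.cost (J.sol (J.cluster R (fun v => sh (ω v)) u ∩ S) ∩ J.ball k x) : ℝ) ≤
      ∑ z ∈ J.sol S', (J.wt z : ℝ) * J.mult R (fun v => sh (ω v)) z := by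
    intro ω
    set T := fun v => sh (ω v)
    have hT : ∀ u, T u ≤ R := fun _ => hsh _
    set A := Finset.univ.filter fun u => (J.cluster R T u ∩ J.ball k x).Nonempty with hA
    have h2 : ∑ u, J.cost (J.sol (J.cluster R T u ∩ S) ∩ J.ball k x) ≤
        ∑ u ∈ A, J.opt (J.cluster R T u ∩ S) := by
      rw [← Finset.sum_subset (Finset.subset_univ A)]
      · exact Finset.sum_le_sum fun u _ => J.cost_mono Finset.inter_subset_left
      · intro u _ hu
        refine Finset.sum_eq_zero fun y hy => ?_
        exfalso
        apply hu
        simp only [hA, Finset.mem_filter, Finset.mem_univ, true_and]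
        obtain ⟨h3, h4⟩ := Finset.mem_inter.1 hy
        exact ⟨y, Finset.mem_inter.2 ⟨(Finset.mem_inter.1 (sol_subset hJ _ h3)).1, h4⟩⟩
    have h5 := sum_opt_le hJ A S' (fun u => J.cluster R T u ∩ S) fun u hu => by
      obtain ⟨y, hy⟩ := (Finset.mem_filter.1 hu).2
      obtain ⟨hy1, hy2⟩ := Finset.mem_inter.1 hy
      exact Finset.inter_subset_inter_right (cluster_subset_ball hT hy1 hy2)
    have h6 : ∀ z, (A.filter fun u => z ∈ J.cluster R T u ∩ S).card ≤ J.mult R T z := by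
      intro z
      unfold mult
      refine Finset.card_le_card fun u hu => ?_
      simp only [Finset.mem_filter, Finset.mem_inter, Finset.mem_univ, true_and] at hu ⊢
      exact hu.2.1
    have h7 := h2.trans (h5.trans (Finset.sum_le_sum fun z _ => Nat.mul_le_mul_left _ (h6 z)))
    exact_mod_cast h7
  refine (Finset.expect_le_expect fun ω _ => h1 ω).trans ?_
  rw [Finset.expect_sum_comm, opt, cost]
  push_cast
  rw [Finset.mul_sum]
  refine Finset.sum_le_sum fun z _ => ?_
  rw [← Finset.mul_expect, mul_comm]
  by_cases hz : J.wt z = 0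
  · simp [hz]
  · exact mul_le_mul_of_nonneg_right (hm z hz) (Nat.cast_nonneg _)

end Density

/-! ### Carving balls around a set of centers -/

/-- The radii used when balls are carved: the smallest radius of a ball and the number of layers
among which the boundary of the ball is chosen. -/
structure Carving where
  inner : ℕ
  layers : ℕ

/-- All carved balls together with their boundaries lie within this radius. -/
def Carving.reach (σ : Carving) : ℕ := σ.inner + 2 * σ.layers

section Carve

variable {W : Type} [Fintype W] [DecidableEq W] (J : CovInst W) (σ : Carving) (S : Finset W)
  (C : Finset W)

/-- The variables of `S` at distance `j` or `j + 1` from `u`. -/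
noncomputable def annulus (j : ℕ) (u : W) : Finset W :=
  open scoped Classical in S.filter fun y => J.Near (j + 1) u y ∧ ¬ J.Near (j - 1) u y

/-- A layer around `u` of minimal optimum. -/
noncomputable def layer (u : W) : ℕ :=
  Classical.epsilon fun a => a < σ.layers ∧ ∀ b < σ.layers,
    J.opt (J.annulus S (σ.inner + 2 * a) u) ≤ J.opt (J.annulus S (σ.inner + 2 * b) u)

/-- The radius of the ball carved around `u`. -/
noncomputable def radius (u : W) : ℕ := σ.inner + 2 * J.layer σ S u

/-- The centers whose balls contain `x`. -/
noncomputable def key (x : W) : Finset W :=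
  open scoped Classical in C.filter fun u => J.Near (J.radius σ S u) u x

/-- The variables of `S` that are in no ball. -/
noncomputable def survivors : Finset W := S.filter fun x => J.key σ S C x = ∅

/-- The variables of `S` that lie exactly in the balls around the centers in `K`. -/
noncomputable def cell (K : Finset W) : Finset W := S.filter fun x => J.key σ S C x = K

/-- Optimal solutions of all boundaries, and of all cells inside the balls. -/
noncomputable def carveOut : Finset W :=
  open scoped Classical in Finset.univ.filter fun x =>
    (∃ u ∈ C, x ∈ J.sol (J.annulus S (J.radius σ S u) u)) ∨
      (J.key σ S C x ≠ ∅ ∧ x ∈ J.sol (J.cell σ S C (J.key σ S C x)))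

variable {J σ S C}

theorem mem_annulus {j : ℕ} {u y : W} :
    y ∈ J.annulus S j u ↔ y ∈ S ∧ J.Near (j + 1) u y ∧ ¬ J.Near (j - 1) u y := by
  simp [annulus]

theorem mem_key {u x : W} : u ∈ J.key σ S C x ↔ u ∈ C ∧ J.Near (J.radius σ S u) u x := by
  simp [key]

theorem mem_survivors {x : W} : x ∈ J.survivors σ S C ↔ x ∈ S ∧ J.key σ S C x = ∅ := by
  simp [survivors]

theorem mem_cell {K : Finset W} {x : W} : x ∈ J.cell σ S C K ↔ x ∈ S ∧ J.key σ S C x = K := by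
  simp [cell]

theorem mem_carveOut {x : W} : x ∈ J.carveOut σ S C ↔
    (∃ u ∈ C, x ∈ J.sol (J.annulus S (J.radius σ S u) u)) ∨
      (J.key σ S C x ≠ ∅ ∧ x ∈ J.sol (J.cell σ S C (J.key σ S C x))) := by
  simp [carveOut]

theorem layer_spec (hL : 0 < σ.layers) (u : W) : J.layer σ S u < σ.layers ∧ ∀ b < σ.layers,
    J.opt (J.annulus S (J.radius σ S u) u) ≤ J.opt (J.annulus S (σ.inner + 2 * b) u) := by
  refine Classical.epsilon_spec (p := fun a => a < σ.layers ∧ ∀ b < σ.layers,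
    J.opt (J.annulus S (σ.inner + 2 * a) u) ≤ J.opt (J.annulus S (σ.inner + 2 * b) u)) ?_
  obtain ⟨a, ha, hmin⟩ := Finset.exists_min_image (Finset.range σ.layers)
    (fun a => J.opt (J.annulus S (σ.inner + 2 * a) u)) ⟨0, Finset.mem_range.2 hL⟩
  simp only [Finset.mem_range] at ha hmin
  exact ⟨a, ha, hmin⟩

theorem inner_le_radius (u : W) : σ.inner ≤ J.radius σ S u := Nat.le_add_right _ _

theorem radius_lt_reach (hL : 0 < σ.layers) (u : W) : J.radius σ S u + 2 ≤ σ.reach := by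
  have := (layer_spec (J := J) (S := S) hL u).1
  unfold radius Carving.reach
  omega

variable (hJ : J.WellFormed)
include hJ

/-- A constraint inside `S` is satisfied after the carving or survives it. -/
theorem carve_covers (hs : 0 < σ.inner) {c : (W → ℝ) × ℝ} (hc : c ∈ J.cons)
    (h1 : ∃ x, c.1 x ≠ 0) (h2 : ∀ x, c.1 x ≠ 0 → x ∈ S) :
    c.2 ≤ ∑ x ∈ J.carveOut σ S C, c.1 x ∨ ∀ x, c.1 x ≠ 0 → x ∈ J.survivors σ S C := by
  classical
  -- A constraint split by the sphere of some ball lies in the annulus around that sphere. One that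
  -- no ball splits has a single key and lies in one cell.
  by_cases hcut : ∃ u ∈ C, ∃ y z, c.1 y ≠ 0 ∧ c.1 z ≠ 0 ∧ J.Near (J.radius σ S u) u y ∧
      ¬ J.Near (J.radius σ S u) u z
  · obtain ⟨u, hu, y, z, hy, hz, hny, hnz⟩ := hcut
    left
    -- A positive radius makes `radius - 1 + 1 = radius` despite truncated subtraction, so a member
    -- within `radius - 1` would pull `z` into the ball.
    have hrad : 0 < J.radius σ S u := lt_of_lt_of_le hs (inner_le_radius u)
    refine Covers.mono hJ (sol_covers hJ (J.annulus S (J.radius σ S u) u))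
      (fun x hx => mem_carveOut.2 (Or.inl ⟨u, hu, hx⟩)) c hc h1 fun x hx => ?_
    refine mem_annulus.2 ⟨h2 x hx, hny.step ⟨c, hc, hy, hx⟩, fun h => hnz ?_⟩
    exact (h.step ⟨c, hc, hx, hz⟩).mono (by omega)
  · push Not at hcut
    obtain ⟨x, hx⟩ := h1
    have hkey : ∀ y, c.1 y ≠ 0 → J.key σ S C y = J.key σ S C x := by
      intro y hy
      ext u
      rw [mem_key, mem_key]
      exact ⟨fun h => ⟨h.1, hcut u h.1 y x hy hx h.2⟩, fun h => ⟨h.1, hcut u h.1 x y hx hy h.2⟩⟩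
    by_cases hx0 : J.key σ S C x = ∅
    · right
      exact fun y hy => mem_survivors.2 ⟨h2 y hy, (hkey y hy).trans hx0⟩
    · left
      refine Covers.mono hJ (sol_covers hJ (J.cell σ S C (J.key σ S C x))) (fun z hz => ?_) c hc
        ⟨x, hx⟩ fun y hy => mem_cell.2 ⟨h2 y hy, hkey y hy⟩
      have := (mem_cell.1 (sol_subset hJ _ hz)).2
      refine mem_carveOut.2 (Or.inr ?_)
      rw [this]
      exact ⟨hx0, hz⟩

/-- The cells partition `S`, the cell of the empty key being the survivors, so their optima add up
to at most `J.opt S`. Only the boundaries are paid on top. -/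
theorem carve_cost :
    J.cost (J.carveOut σ S C) + J.opt (J.survivors σ S C) ≤
      J.opt S + ∑ u ∈ C, J.opt (J.annulus S (J.radius σ S u) u) := by
  classical
  set A : Finset (Finset W) := Finset.univ.filter fun K => K ≠ ∅ with hA
  have h1 : J.carveOut σ S C ⊆ (C.biUnion fun u => J.sol (J.annulus S (J.radius σ S u) u)) ∪
      A.biUnion fun K => J.sol (J.cell σ S C K) := by
    intro x hx
    rcases mem_carveOut.1 hx with ⟨u, hu, h⟩ | ⟨h, h'⟩
    · exact Finset.mem_union_left _ (Finset.mem_biUnion.2 ⟨u, hu, h⟩)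
    · exact Finset.mem_union_right _ (Finset.mem_biUnion.2 ⟨_, by simpa [hA] using h, h'⟩)
  have h2 := (J.cost_mono h1).trans (J.cost_union_le _ _)
  have h3 := J.cost_biUnion_le C fun u => J.sol (J.annulus S (J.radius σ S u) u)
  have h4 := J.cost_biUnion_le A fun K => J.sol (J.cell σ S C K)
  have h5 := sum_opt_le_opt hJ Finset.univ S (fun K => J.cell σ S C K)
    (fun K _ => Finset.filter_subset _ _)
    (fun K _ K' _ x hx hx' => (mem_cell.1 hx).2.symm.trans (mem_cell.1 hx').2)
  have h6 : ∑ K, J.opt (J.cell σ S C K) =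
      J.opt (J.survivors σ S C) + ∑ K ∈ A, J.opt (J.cell σ S C K) := by
    rw [← Finset.add_sum_erase _ _ (Finset.mem_univ ∅)]
    congr 1
    refine Finset.sum_congr ?_ fun _ _ => rfl
    ext K
    simp [hA]
  change _ ≤ ∑ u ∈ C, J.opt (J.annulus S (J.radius σ S u) u) at h3
  change _ ≤ ∑ K ∈ A, J.opt (J.cell σ S C K) at h4
  omega

/-- Candidate radii differ by at least two, so the annuli are disjoint and their optima add up to at
most that of the surrounding ball. The cheapest one is at most the average. -/
theorem layers_mul_opt_annulus_le (hL : 0 < σ.layers) (hs : 0 < σ.inner) (u : W) :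
    σ.layers * J.opt (J.annulus S (J.radius σ S u) u) ≤ J.opt (J.ball σ.reach u ∩ S) := by
  classical
  have h1 := sum_opt_le_opt hJ (Finset.range σ.layers) (J.ball σ.reach u ∩ S)
    (fun b => J.annulus S (σ.inner + 2 * b) u) ?_ ?_
  · refine le_trans ?_ h1
    rw [← Finset.card_range σ.layers, ← smul_eq_mul, ← Finset.sum_const, Finset.card_range]
    exact Finset.sum_le_sum fun b hb => (layer_spec hL u).2 b (Finset.mem_range.1 hb)
  · intro b hb x hx
    rw [mem_annulus] at hx
    have := Finset.mem_range.1 hb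
    exact Finset.mem_inter.2 ⟨mem_ball.2 (hx.2.1.mono (by unfold Carving.reach; omega)), hx.1⟩
  · intro a _ b _ x ha hb
    rw [mem_annulus] at ha hb
    by_contra hab
    rcases lt_or_gt_of_ne hab with h | h
    · exact hb.2.2 (ha.2.1.mono (by omega))
    · exact ha.2.2 (hb.2.1.mono (by omega))

/-- If the balls overlap little, the boundaries are cheap. -/
theorem layers_mul_sum_opt_annulus_le (hL : 0 < σ.layers) (hs : 0 < σ.inner) {B : ℕ}
    (hB : ∀ x ∈ S, J.wt x ≠ 0 → (C.filter fun u => u ∈ J.ball σ.reach x).card ≤ B) :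
    σ.layers * ∑ u ∈ C, J.opt (J.annulus S (J.radius σ S u) u) ≤ B * J.opt S := by
  classical
  rw [Finset.mul_sum]
  refine (Finset.sum_le_sum fun u _ => layers_mul_opt_annulus_le hJ hL hs u).trans ?_
  refine (sum_opt_le hJ C S (fun u => J.ball σ.reach u ∩ S)
    fun _ _ => Finset.inter_subset_right).trans ?_
  rw [opt, cost, Finset.mul_sum]
  refine Finset.sum_le_sum fun x hx => ?_
  rw [mul_comm B]
  by_cases hx0 : J.wt x = 0
  · simp [hx0]
  · refine Nat.mul_le_mul_left _ (le_trans (Finset.card_le_card fun u hu => ?_)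
      (hB x (sol_subset hJ _ hx) hx0))
    simp only [Finset.mem_filter, Finset.mem_inter, mem_ball] at hu ⊢
    exact ⟨hu.1, near_symm hu.2.1⟩

end Carve

end CovInst

/-! ### Random centers -/

namespace FinProb

section Coins

variable {W X : Type*} [Fintype W] [DecidableEq W] [Fintype X] [Nonempty X]

theorem pr_le_one {Ω : Type*} [Fintype Ω] [Nonempty Ω] (A : Ω → Prop) : pr A ≤ 1 := by
  classical
  have : (1 : ℝ) = 𝔼 ω : Ω, (1 : ℝ) := by simp
  rw [this]
  exact Finset.expect_le_expect fun ω _ => by split_ifs <;> norm_num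

theorem pr_forall_not_eq (U : Finset W) (A : W → X → Prop) :
    pr (fun ω : W → X => ∀ u ∈ U, ¬ A u (ω u)) = ∏ u ∈ U, (1 - pr (A u)) := by
  classical
  have h1 : ∀ u, 𝔼 x : X, (if u ∈ U then 1 - (if A u x then (1 : ℝ) else 0) else 1) =
      if u ∈ U then 1 - pr (A u) else 1 := by
    intro u
    by_cases hu : u ∈ U
    · simp only [hu, if_true, Finset.expect_sub_distrib, Fintype.expect_const, pr_eq_expect]
    · simp [hu]
  have h2 := expect_prod_apply (W := W)
    (fun u (x : X) => if u ∈ U then 1 - (if A u x then (1 : ℝ) else 0) else 1)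
  simp only [h1] at h2
  rw [Finset.prod_ite_mem, Finset.univ_inter] at h2
  rw [← h2, pr_eq_expect]
  refine Finset.expect_congr rfl fun ω _ => ?_
  rw [Finset.prod_ite_mem, Finset.univ_inter]
  by_cases h : ∀ u ∈ U, ¬ A u (ω u)
  · rw [if_pos h]
    exact (Finset.prod_eq_one fun u hu => by simp [h u hu]).symm
  · rw [if_neg h]
    push Not at h
    obtain ⟨u, hu, hA⟩ := h
    exact (Finset.prod_eq_zero hu (by simp [hA])).symm

/-- Markov's inequality for `2` to the number of successes, whose expectation factors over the
coordinates. -/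
theorem pr_le_card_filter_le (U : Finset W) (A : W → X → Prop) (B : ℕ) :
    open scoped Classical in
    pr (fun ω : W → X => B ≤ (U.filter fun u => A u (ω u)).card) ≤
      (∏ u ∈ U, (1 + pr (A u))) / 2 ^ B := by
  classical
  have h1 : ∀ u, 𝔼 x : X, (if u ∈ U then 1 + (if A u x then (1 : ℝ) else 0) else 1) =
      if u ∈ U then 1 + pr (A u) else 1 := by
    intro u
    by_cases hu : u ∈ U
    · simp only [hu, if_true, Finset.expect_add_distrib, Fintype.expect_const, pr_eq_expect]
    · simp [hu]
  have h2 := expect_prod_apply (W := W)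
    (fun u (x : X) => if u ∈ U then 1 + (if A u x then (1 : ℝ) else 0) else 1)
  simp only [h1] at h2
  rw [Finset.prod_ite_mem, Finset.univ_inter] at h2
  rw [← h2]
  refine pr_le_expect_div (fun ω => Finset.prod_nonneg fun u _ => ?_) (by positivity) fun ω hω => ?_
  · positivity
  · rw [Finset.prod_ite_mem, Finset.univ_inter]
    have : ∏ u ∈ U, (1 + if A u (ω u) then (1 : ℝ) else 0) =
        2 ^ (U.filter fun u => A u (ω u)).card := by
      rw [← Finset.prod_const, Finset.prod_filter]
      refine Finset.prod_congr rfl fun u _ => ?_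
      split_ifs <;> norm_num
    rw [this]
    refine pow_le_pow_right₀ (by norm_num) (hω.trans (le_of_eq ?_))
    congr

end Coins

/-! ### Coins as thresholds of a uniform integer -/

section Threshold

variable {M : ℕ}

theorem pr_lt_mul_eq (y : ℝ) :
    pr (fun τ : Fin M => (τ : ℝ) < M * y) = (min M ⌈M * y⌉₊ : ℕ) / M := by
  classical
  rw [pr_eq_card_div, Fintype.card_fin]
  congr 2
  have : (Finset.univ.filter fun τ : Fin M => (τ : ℝ) < M * y) =
      Finset.univ.filter fun τ : Fin M => (τ : ℕ) < ⌈M * y⌉₊ := by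
    ext τ
    simp [Nat.lt_ceil]
  rw [this, Fin.card_filter_val_lt]

theorem pr_lt_mul_le (hM : 0 < M) {y : ℝ} (hy : 0 ≤ y) :
    pr (fun τ : Fin M => (τ : ℝ) < M * y) ≤ y + 1 / M := by
  have hM' : (0 : ℝ) < M := by exact_mod_cast hM
  rw [pr_lt_mul_eq, div_le_iff₀ hM']
  have h1 : ((min M ⌈M * y⌉₊ : ℕ) : ℝ) ≤ ⌈M * y⌉₊ := by exact_mod_cast min_le_right _ _
  have h2 := Nat.ceil_lt_add_one (a := M * y) (by positivity)
  have : (y + 1 / M) * M = M * y + 1 := by field_simp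
  linarith

/-- Rounding the threshold up only helps success, and `1 - y ≤ exp (-y)`; once the rounded threshold
reaches `M`, success is certain. -/
theorem one_sub_pr_lt_mul_le (hM : 0 < M) (y : ℝ) :
    1 - pr (fun τ : Fin M => (τ : ℝ) < M * y) ≤ Real.exp (-y) := by
  have hM' : (0 : ℝ) < M := by exact_mod_cast hM
  rw [pr_lt_mul_eq]
  rcases le_total M ⌈M * y⌉₊ with h | h
  · rw [min_eq_left h, div_self hM'.ne']
    simp [Real.exp_nonneg]
  · rw [min_eq_right h]
    have h1 : y ≤ (⌈M * y⌉₊ : ℝ) / M := by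
      rw [le_div_iff₀ hM', mul_comm]
      exact Nat.le_ceil _
    have h2 := Real.add_one_le_exp (-y)
    linarith

variable {W : Type*} [Fintype W] [DecidableEq W]

theorem pr_no_center_le (hM : 0 < M) (U : Finset W) (y : W → ℝ) :
    pr (fun ω : W → Fin M => ∀ u ∈ U, ¬ (ω u : ℝ) < M * y u) ≤ Real.exp (-∑ u ∈ U, y u) := by
  have : Nonempty (Fin M) := ⟨⟨0, hM⟩⟩
  rw [pr_forall_not_eq U fun u (τ : Fin M) => (τ : ℝ) < M * y u, ← Finset.sum_neg_distrib,
    Real.exp_sum]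
  exact Finset.prod_le_prod (fun u _ => sub_nonneg.2 (pr_le_one _))
    fun u _ => one_sub_pr_lt_mul_le hM (y u)

theorem pr_many_centers_le (hM : 0 < M) (U : Finset W) {y : W → ℝ} (hy : ∀ u, 0 ≤ y u) (B : ℕ) :
    open scoped Classical in
    pr (fun ω : W → Fin M => B ≤ (U.filter fun u => (ω u : ℝ) < M * y u).card) ≤
      Real.exp (∑ u ∈ U, y u + U.card / M) / 2 ^ B := by
  have : Nonempty (Fin M) := ⟨⟨0, hM⟩⟩
  refine (pr_le_card_filter_le U (fun u (τ : Fin M) => (τ : ℝ) < M * y u) B).trans ?_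
  refine div_le_div_of_nonneg_right ?_ (by positivity)
  have : ∑ u ∈ U, y u + U.card / M = ∑ u ∈ U, (y u + 1 / M) := by
    rw [Finset.sum_add_distrib, Finset.sum_const, nsmul_eq_mul, mul_one_div]
  rw [this, Real.exp_sum]
  refine Finset.prod_le_prod (fun u _ => by have := pr_nonneg (fun τ : Fin M => (τ : ℝ) < M * y u); linarith)
    fun u _ => ?_
  have h1 := pr_lt_mul_le hM (hy u)
  have h2 := Real.add_one_le_exp (y u + 1 / M)
  linarith

end Threshold

end FinProb

/-! ### One carving stage with sampled centers -/

namespace CovInst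

open FinProb

/-- The parameters of one stage of the algorithm: how balls are carved, the radius that is used to
normalise the sampling rate, and the factor of the sampling rate. -/
structure Stage extends Carving where
  view : ℕ
  rate : ℝ

variable {W : Type} [Fintype W] [DecidableEq W] {M : ℕ}

/-- The sampling rate of `u`. -/
noncomputable def rateAt (J : CovInst W) (R : ℕ) (sh : Fin M → ℕ) (σ : Stage) (S : Finset W)
    (u : W) : ℝ := σ.rate * J.density R sh S u / J.opt (J.ball σ.view u)

/-- The centers that are sampled by means of the random numbers `ω`. -/
noncomputable def centers (J : CovInst W) (R : ℕ) (sh : Fin M → ℕ) (σ : Stage) (S : Finset W)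
    (ω : W → Fin M) : Finset W :=
  open scoped Classical in Finset.univ.filter fun u => (ω u : ℝ) < M * J.rateAt R sh σ S u

/-- Within `S`, balls of radius `r` carry at most a fraction `1 / c` of what balls of radius `P`
carry in the whole instance. -/
def Light (J : CovInst W) (V S : Finset W) (r P c : ℕ) : Prop :=
  ∀ x ∈ S, x ∈ V → c * J.opt (J.ball r x ∩ S) ≤ J.opt (J.ball P x)

variable {J : CovInst W} {R : ℕ} {sh : Fin M → ℕ} {σ : Stage} {S : Finset W}

theorem mem_centers {ω : W → Fin M} {u : W} :
    u ∈ J.centers R sh σ S ω ↔ (ω u : ℝ) < M * J.rateAt R sh σ S u := by simp [centers]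

theorem rateAt_nonneg (hr : 0 ≤ σ.rate) (u : W) : 0 ≤ J.rateAt R sh σ S u :=
  div_nonneg (mul_nonneg hr (density_nonneg S u)) (Nat.cast_nonneg _)

variable (hJ : J.WellFormed) (hM : 0 < M) (hsh : ∀ x, sh x ≤ R)
  (hm : ∀ y, J.wt y ≠ 0 → 𝔼 ω : W → Fin M, (J.mult R (fun v => sh (ω v)) y : ℝ) ≤ 2)
include hJ hM hsh hm

-- Lightness caps the number of centers near `x`. The normalising ball of each nearby `u` contains
-- `J.ball P x`, whose optimum is at least `c` times that of the surviving part near `x`, and twice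
-- the latter bounds the densities. The factor `c` cancels the one in the rate.
omit hM in
theorem sum_rateAt_le {V : Finset W} {r P c : ℕ} {K : ℝ} (hK : 0 ≤ K) (hc : 0 < c)
    (hL : J.Light V S r P c) (hrate : σ.rate = c * K) (hview : P + σ.reach ≤ σ.view)
    (hr : σ.reach + 2 * (R + 2) ≤ r) {x : W} (hx : x ∈ S) (hxV : x ∈ V) :
    ∑ u ∈ J.ball σ.reach x, J.rateAt R sh σ S u ≤ 2 * K := by
  have h1 := sum_density_le hJ hsh S σ.reach x hm
  have h2 := opt_mono hJ (Finset.inter_subset_inter_right (u := S) (J.ball_mono hr x))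
  have h3 : c * J.opt (J.ball (σ.reach + 2 * (R + 2)) x ∩ S) ≤ J.opt (J.ball P x) :=
    (Nat.mul_le_mul_left _ h2).trans (hL x hx hxV)
  have h3' : (c : ℝ) * J.opt (J.ball (σ.reach + 2 * (R + 2)) x ∩ S) ≤ J.opt (J.ball P x) := by
    exact_mod_cast h3
  have hc' : (0 : ℝ) < c := by exact_mod_cast hc
  -- If the large ball has optimum zero, all nearby densities vanish, and with them the rates.
  rcases Nat.eq_zero_or_pos (J.opt (J.ball P x)) with h0 | h0
  · rw [h0, Nat.cast_zero] at h3'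
    have h4 : ∑ u ∈ J.ball σ.reach x, J.density R sh S u ≤ 0 := by nlinarith
    have h5 := (Finset.sum_eq_zero_iff_of_nonneg fun u _ => density_nonneg (J := J) (R := R)
      (sh := sh) S u).1 (le_antisymm h4 (Finset.sum_nonneg fun u _ => density_nonneg S u))
    rw [Finset.sum_eq_zero fun u hu => by rw [rateAt, h5 u hu, mul_zero, zero_div]]
    positivity
  · have h0' : (0 : ℝ) < J.opt (J.ball P x) := by exact_mod_cast h0
    have h4 : ∀ u ∈ J.ball σ.reach x, J.rateAt R sh σ S u ≤
        c * K / J.opt (J.ball P x) * J.density R sh S u := by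
      intro u hu
      have h5 : J.opt (J.ball P x) ≤ J.opt (J.ball σ.view u) :=
        opt_mono hJ (ball_subset σ.reach (near_symm (mem_ball.1 hu)) (by omega))
      have h6 : (J.opt (J.ball P x) : ℝ) ≤ J.opt (J.ball σ.view u) := by exact_mod_cast h5
      rw [rateAt, hrate, div_mul_eq_mul_div]
      have := density_nonneg (J := J) (R := R) (sh := sh) S u
      gcongr
    refine (Finset.sum_le_sum h4).trans ?_
    rw [← Finset.mul_sum, div_mul_eq_mul_div, div_le_iff₀ h0']
    calc (c : ℝ) * K * ∑ u ∈ J.ball σ.reach x, J.density R sh S u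
        ≤ c * K * (2 * J.opt (J.ball (σ.reach + 2 * (R + 2)) x ∩ S)) := by gcongr
      _ = 2 * K * (c * J.opt (J.ball (σ.reach + 2 * (R + 2)) x ∩ S)) := by ring
      _ ≤ 2 * K * J.opt (J.ball P x) := by gcongr

/-- Conversely, heaviness forces centers near `x`: the normalising balls lie in `J.ball P x`, whose
optimum is below `2 * c` times that of the surviving part near `x`, and the densities add up to at
least the latter. -/
theorem le_sum_rateAt {r P c : ℕ} {K : ℝ} (hK : 0 ≤ K) (hc : 0 < c) (hrate : σ.rate = c * K)
    (hr : r + 2 * (R + 2) ≤ σ.inner) (hD : 2 * (R + 2) ≤ σ.view) (hP : σ.view + σ.inner ≤ P)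
    {x : W} (hheavy : J.opt (J.ball P x) < 2 * c * J.opt (J.ball r x ∩ S)) :
    K / 2 ≤ ∑ u ∈ J.ball σ.inner x, J.rateAt R sh σ S u := by
  have : Nonempty (Fin M) := ⟨⟨0, hM⟩⟩
  have hc' : (0 : ℝ) < c := by exact_mod_cast hc
  have h1 : J.opt (J.ball r x ∩ S) ≤ J.opt (J.ball P x) :=
    opt_mono hJ (Finset.inter_subset_left.trans (J.ball_mono (by omega) x))
  have h0 : 0 < J.opt (J.ball P x) := by
    rcases Nat.eq_zero_or_pos (J.opt (J.ball P x)) with h | h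
    · have : J.opt (J.ball r x ∩ S) = 0 := by omega
      simp [this] at hheavy
    · exact h
  have h0' : (0 : ℝ) < J.opt (J.ball P x) := by exact_mod_cast h0
  have h4 : ∀ u ∈ J.ball σ.inner x,
      c * K / J.opt (J.ball P x) * J.density R sh S u ≤ J.rateAt R sh σ S u := by
    intro u hu
    have hd := density_nonneg (J := J) (R := R) (sh := sh) S u
    have h5 : J.opt (J.ball σ.view u) ≤ J.opt (J.ball P x) :=
      opt_mono hJ (ball_subset σ.inner (mem_ball.1 hu) (by omega))
    have h6 : (J.opt (J.ball σ.view u) : ℝ) ≤ J.opt (J.ball P x) := by exact_mod_cast h5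
    rw [rateAt, hrate, div_mul_eq_mul_div]
    -- Division by zero would make the rate zero, so the density of `u` has to vanish as well. It
    -- does, because `sum_density_le` at radius zero bounds it by an optimum inside the normalising
    -- ball.
    rcases Nat.eq_zero_or_pos (J.opt (J.ball σ.view u)) with h7 | h7
    · have h8 := sum_density_le hJ hsh S 0 u hm
      have h9 : J.opt (J.ball (0 + 2 * (R + 2)) u ∩ S) = 0 := by
        have : J.opt (J.ball (0 + 2 * (R + 2)) u ∩ S) ≤ J.opt (J.ball σ.view u) :=
          opt_mono hJ (Finset.inter_subset_left.trans (J.ball_mono (by omega) u))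
        omega
      rw [h9, Nat.cast_zero, mul_zero] at h8
      have h10 : J.density R sh S u ≤ 0 :=
        (Finset.single_le_sum (f := J.density R sh S) (fun y _ => density_nonneg S y)
          (mem_ball.2 (.refl 0 u))).trans h8
      have h11 : J.density R sh S u = 0 := le_antisymm h10 hd
      simp [h11]
    · have h7' : (0 : ℝ) < J.opt (J.ball σ.view u) := by exact_mod_cast h7
      gcongr
  refine le_trans ?_ (Finset.sum_le_sum h4)
  rw [← Finset.mul_sum, div_mul_eq_mul_div, le_div_iff₀ h0']
  have h5 := opt_ball_le_sum_density hJ hsh S r x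
  have h6 : ∑ y ∈ J.ball (r + 2 * (R + 2)) x, J.density R sh S y ≤
      ∑ y ∈ J.ball σ.inner x, J.density R sh S y :=
    Finset.sum_le_sum_of_subset_of_nonneg (J.ball_mono hr x) fun y _ _ => density_nonneg S y
  have h7 : (J.opt (J.ball P x) : ℝ) ≤ 2 * c * J.opt (J.ball r x ∩ S) := by
    exact_mod_cast hheavy.le
  calc K / 2 * J.opt (J.ball P x) ≤ K / 2 * (2 * c * J.opt (J.ball r x ∩ S)) := by gcongr
    _ = c * K * J.opt (J.ball r x ∩ S) := by ring
    _ ≤ _ := by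
        gcongr
        exact h5.trans h6

/-- After one stage the surviving part is lighter by a factor of two, and the carved balls overlap
little, with high probability. -/
theorem pr_stage_le {V : Finset W} {r P c r' P' B n : ℕ} {K : ℝ} (hK : 0 ≤ K) (hc : 0 < c)
    (hV : V.card ≤ n) (hVw : ∀ x, J.wt x ≠ 0 → x ∈ V)
    (hball : ∀ x ∈ V, (J.ball σ.reach x).card ≤ n)
    (hL : J.Light V S r P c) (hrate : σ.rate = c * K) (hview : P + σ.reach ≤ σ.view)
    (hr : σ.reach + 2 * (R + 2) ≤ r) (hr' : r' + 2 * (R + 2) ≤ σ.inner)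
    (hP' : σ.view + σ.inner ≤ P') :
    pr (fun ω : W → Fin M =>
      ¬ (J.Light V (J.survivors σ.toCarving S (J.centers R sh σ S ω)) r' P' (2 * c) ∧
        ∀ x ∈ S, J.wt x ≠ 0 →
          ((J.centers R sh σ S ω).filter fun u => u ∈ J.ball σ.reach x).card ≤ B)) ≤
      n * Real.exp (-(K / 2)) + n * (Real.exp (2 * K + n / M) / 2 ^ B) := by
  classical
  have hrate0 : 0 ≤ σ.rate := by rw [hrate]; positivity
  have hreach : σ.inner ≤ σ.reach := Nat.le_add_right _ _
  -- `A₁` is the failure to place a center near a variable that is too heavy for the next stage,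
  -- `A₂` an excess of centers. Heaviness is measured in the old set `S`, hence does not depend on
  -- the sample.
  set A₁ : W → (W → Fin M) → Prop := fun x ω =>
    J.opt (J.ball P' x) < 2 * c * J.opt (J.ball r' x ∩ S) ∧
      ∀ u ∈ J.ball σ.inner x, ¬ (ω u : ℝ) < M * J.rateAt R sh σ S u
  set A₂ : W → (W → Fin M) → Prop := fun x ω => x ∈ S ∧
    B ≤ ((J.ball σ.reach x).filter fun u => (ω u : ℝ) < M * J.rateAt R sh σ S u).card
  have h1 : pr (fun ω => ∃ x ∈ V, A₁ x ω) ≤ n * Real.exp (-(K / 2)) := by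
    refine (pr_exists_le_card V A₁ (η := Real.exp (-(K / 2))) fun x _ => ?_).trans (by gcongr)
    by_cases hh : J.opt (J.ball P' x) < 2 * c * J.opt (J.ball r' x ∩ S)
    · refine (pr_mono fun ω hω => hω.2).trans ((pr_no_center_le hM _ _).trans (Real.exp_le_exp.2 (neg_le_neg ?_)))
      exact le_sum_rateAt hJ hM hsh hm hK hc hrate hr' (by omega) hP' hh
    · have : pr (A₁ x) ≤ pr (fun _ : W → Fin M => False) := pr_mono fun ω hω => hh hω.1
      refine this.trans ?_
      simp [pr, Real.exp_nonneg]
  have h2 : pr (fun ω => ∃ x ∈ V, A₂ x ω) ≤ n * (Real.exp (2 * K + n / M) / 2 ^ B) := by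
    refine (pr_exists_le_card V A₂ (η := Real.exp (2 * K + n / M) / 2 ^ B) fun x hxV => ?_).trans
      (by gcongr)
    by_cases hxS : x ∈ S
    · refine (pr_mono fun ω hω => hω.2).trans ?_
      have := pr_many_centers_le hM (J.ball σ.reach x)
        (fun u => rateAt_nonneg (J := J) (R := R) (sh := sh) (S := S) hrate0 u) B
      refine le_trans (le_of_eq ?_) (this.trans ?_)
      · congr!
      · refine div_le_div_of_nonneg_right (Real.exp_le_exp.2 (add_le_add ?_ ?_)) (by positivity)
        · exact sum_rateAt_le hJ hsh hm hK hc hL hrate hview hr hxS hxV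
        · have := hball x hxV
          gcongr
    · have : pr (A₂ x) ≤ pr (fun _ : W → Fin M => False) := pr_mono fun ω hω => hxS hω.1
      refine this.trans ?_
      simp only [pr, if_false, Fintype.expect_eq_sum_div_card, Finset.sum_const_zero, zero_div]
      positivity
  refine le_trans (pr_mono fun ω hω => ?_) ((pr_or_le _ _).trans (add_le_add h1 h2))
  by_contra hcon
  push Not at hcon
  obtain ⟨h3, h4⟩ := hcon
  refine hω ⟨fun x hx hxV => ?_, fun x hxS hx => ?_⟩
  · rw [mem_survivors] at hx
    by_contra hlt
    refine h3 x hxV ⟨?_, fun u hu hcen => ?_⟩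
    · refine (not_le.1 hlt).trans_le (Nat.mul_le_mul_left _ (opt_mono hJ ?_))
      exact Finset.inter_subset_inter_left (Finset.filter_subset _ _)
    · have : u ∈ J.key σ.toCarving S (J.centers R sh σ S ω) x := by
        refine mem_key.2 ⟨mem_centers.2 hcen, ?_⟩
        exact (near_symm (mem_ball.1 hu)).mono (inner_le_radius u)
      rw [hx.2] at this
      simp at this
  · by_contra hlt
    refine h4 x (hVw x hx) ⟨hxS, (not_le.1 hlt).le.trans (Finset.card_le_card fun u hu => ?_)⟩
    simp only [Finset.mem_filter] at hu ⊢
    exact ⟨hu.2, mem_centers.1 hu.1⟩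

end CovInst

/-! ### The algorithm on an instance -/

namespace FinProb

/-- Conditioning on all coordinates but `u`. With `u` the index of a stage, this fixes the outcome
of the earlier stages. -/
theorem pr_le_of_update {W X : Type*} [Fintype W] [DecidableEq W] [Fintype X] [Nonempty X] (u : W)
    {A : (W → X) → Prop} {η : ℝ} (h : ∀ ω, pr (fun x => A (Function.update ω u x)) ≤ η) :
    pr A ≤ η := by
  classical
  rw [pr_eq_expect, expect_update u]
  have : η = 𝔼 ω : W → X, η := by simp
  rw [this]
  refine Finset.expect_le_expect fun ω _ => ?_
  rw [← pr_eq_expect]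
  exact h ω

end FinProb

namespace CovInst

open FinProb

variable {W : Type} [Fintype W] [DecidableEq W] {M : ℕ}

/-- The variables that survive the first `i` stages. -/
noncomputable def remaining (J : CovInst W) (R : ℕ) (sh : Fin M → ℕ) (σ : ℕ → Stage)
    (ω : ℕ → W → Fin M) : ℕ → Finset W
  | 0 => Finset.univ
  | i + 1 => J.survivors (σ i).toCarving (remaining J R sh σ ω i)
      (J.centers R sh (σ i) (remaining J R sh σ ω i) (ω i))

/-- The centers of stage `i`. -/
noncomputable def stageCenters (J : CovInst W) (R : ℕ) (sh : Fin M → ℕ) (σ : ℕ → Stage)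
    (ω : ℕ → W → Fin M) (i : ℕ) : Finset W :=
  J.centers R sh (σ i) (J.remaining R sh σ ω i) (ω i)

/-- The variables that are set to one in stage `i`. -/
noncomputable def stageOut (J : CovInst W) (R : ℕ) (sh : Fin M → ℕ) (σ : ℕ → Stage)
    (ω : ℕ → W → Fin M) (i : ℕ) : Finset W :=
  J.carveOut (σ i).toCarving (J.remaining R sh σ ω i) (J.stageCenters R sh σ ω i)

/-- The output of the algorithm: `t` stages of carving, followed by a random sparse cover of the
rest. -/
noncomputable def output (J : CovInst W) (R : ℕ) (sh : Fin M → ℕ) (σ : ℕ → Stage) (t : ℕ)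
    (ω : ℕ → W → Fin M) : Finset W :=
  open scoped Classical in Finset.univ.filter fun x => (∃ i < t, x ∈ J.stageOut R sh σ ω i) ∨
    ∃ u, x ∈ J.sol (J.cluster R (fun v => sh (ω t v)) u ∩ J.remaining R sh σ ω t)

variable {J : CovInst W} {R : ℕ} {sh : Fin M → ℕ} {σ : ℕ → Stage} {t : ℕ} {ω : ℕ → W → Fin M}

theorem mem_output {x : W} : x ∈ J.output R sh σ t ω ↔ (∃ i < t, x ∈ J.stageOut R sh σ ω i) ∨
    ∃ u, x ∈ J.sol (J.cluster R (fun v => sh (ω t v)) u ∩ J.remaining R sh σ ω t) := by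
  simp [output]

/-- Redrawing the random numbers of stage `i` does not change its input, which is what allows
conditioning on the past. -/
theorem remaining_congr {ω' : ℕ → W → Fin M} {i : ℕ} (h : ∀ j < i, ω j = ω' j) :
    J.remaining R sh σ ω i = J.remaining R sh σ ω' i := by
  induction i with
  | zero => rfl
  | succ i ih => rw [remaining, remaining, ih fun j hj => h j (by omega), h i (by omega)]

variable (hJ : J.WellFormed)
include hJ

/-- Feasibility holds for every outcome: a constraint not settled by a stage survives it as a whole,
and one that survives all stages lies in a cluster of the final cover. -/
theorem output_covers (hs : ∀ i < t, 0 < (σ i).inner) (hsh : ∀ x, sh x ≤ R) :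
    J.Covers Finset.univ (J.output R sh σ t ω) := by
  intro c hc h1 _
  by_contra hcon
  have key : ∀ i ≤ t, ∀ x, c.1 x ≠ 0 → x ∈ J.remaining R sh σ ω i := by
    intro i
    induction i with
    | zero => intro _ x _; exact Finset.mem_univ x
    | succ i ih =>
      intro hi
      refine (carve_covers hJ (C := J.stageCenters R sh σ ω i) (hs i (by omega)) hc h1
        (ih (by omega))).resolve_left fun h => hcon (h.trans ?_)
      exact Finset.sum_le_sum_of_subset_of_nonneg
        (fun x hx => mem_output.2 (Or.inl ⟨i, by omega, hx⟩)) fun x _ _ => hJ.nonneg c hc x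
  obtain ⟨x, hx⟩ := h1
  obtain ⟨u, hu⟩ := exists_cluster_of_cons (J := J) (T := fun v => sh (ω t v)) (fun _ => hsh _) hc hx
  refine hcon (Covers.mono hJ (sol_covers hJ
    (J.cluster R (fun v => sh (ω t v)) u ∩ J.remaining R sh σ ω t))
    (fun y hy => mem_output.2 (Or.inr ⟨u, hy⟩)) c hc ⟨x, hx⟩ fun y hy => ?_)
  exact Finset.mem_inter.2 ⟨hu y hy, key t le_rfl y hy⟩

/-- Telescoping of `carve_cost`: each stage loses at most a fraction `B / L` of the optimum. The
factor `L` is multiplied out to stay in the natural numbers. -/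
theorem cost_output_le {L B : ℕ} (hL : 0 < L) (hs : ∀ i < t, 0 < (σ i).inner)
    (hσ : ∀ i < t, (σ i).layers = L)
    (hB : ∀ i < t, ∀ x ∈ J.remaining R sh σ ω i, J.wt x ≠ 0 →
      ((J.stageCenters R sh σ ω i).filter fun u => u ∈ J.ball (σ i).reach x).card ≤ B) :
    L * J.cost (J.output R sh σ t ω) + L * J.opt (J.remaining R sh σ ω t) ≤
      (L + t * B) * J.opt Finset.univ +
        L * ∑ x ∈ J.sol (J.remaining R sh σ ω t),
          J.wt x * J.mult R (fun v => sh (ω t v)) x := by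
  classical
  have key : ∀ i ≤ t, L * ∑ j ∈ Finset.range i, J.cost (J.stageOut R sh σ ω j) +
      L * J.opt (J.remaining R sh σ ω i) ≤ (L + i * B) * J.opt Finset.univ := by
    intro i
    induction i with
    | zero => intro _; simp [remaining]
    | succ i ih =>
      intro hi
      have h1 := ih (by omega)
      have h2 := carve_cost hJ (σ := (σ i).toCarving) (S := J.remaining R sh σ ω i)
        (C := J.stageCenters R sh σ ω i)
      have h3 := layers_mul_sum_opt_annulus_le hJ (σ := (σ i).toCarving)
        (S := J.remaining R sh σ ω i) (C := J.stageCenters R sh σ ω i)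
        (by rw [hσ i (by omega)]; exact hL) (hs i (by omega)) (hB i (by omega))
      rw [hσ i (by omega)] at h3
      have h4 : J.opt (J.remaining R sh σ ω i) ≤ J.opt Finset.univ :=
        opt_mono hJ (Finset.subset_univ _)
      have h5 := Nat.mul_le_mul_left L h2
      have h6 := Nat.mul_le_mul_left B h4
      rw [Finset.sum_range_succ]
      change L * (J.cost (J.stageOut R sh σ ω i) + J.opt (J.remaining R sh σ ω (i + 1))) ≤ _ at h5
      nlinarith
  have h1 : J.output R sh σ t ω ⊆ ((Finset.range t).biUnion fun i => J.stageOut R sh σ ω i) ∪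
      Finset.univ.biUnion fun u =>
        J.sol (J.cluster R (fun v => sh (ω t v)) u ∩ J.remaining R sh σ ω t) := by
    intro x hx
    rcases mem_output.1 hx with ⟨i, hi, h⟩ | ⟨u, h⟩
    · exact Finset.mem_union_left _ (Finset.mem_biUnion.2 ⟨i, Finset.mem_range.2 hi, h⟩)
    · exact Finset.mem_union_right _ (Finset.mem_biUnion.2 ⟨u, Finset.mem_univ _, h⟩)
  have h2 := (J.cost_mono h1).trans (J.cost_union_le _ _)
  have h3 := J.cost_biUnion_le (Finset.range t) fun i => J.stageOut R sh σ ω i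
  have h4 := J.cost_biUnion_le Finset.univ fun u =>
        J.sol (J.cluster R (fun v => sh (ω t v)) u ∩ J.remaining R sh σ ω t)
  have h5 := sum_opt_le hJ Finset.univ (J.remaining R sh σ ω t)
    (fun u => J.cluster R (fun v => sh (ω t v)) u ∩ J.remaining R sh σ ω t)
    (fun _ _ => Finset.inter_subset_right)
  have h6 : ∀ z, (Finset.univ.filter fun u =>
      z ∈ J.cluster R (fun v => sh (ω t v)) u ∩ J.remaining R sh σ ω t).card ≤
      J.mult R (fun v => sh (ω t v)) z := by
    intro z
    unfold mult
    refine Finset.card_le_card fun u hu => ?_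
    simp only [Finset.mem_filter, Finset.mem_inter, Finset.mem_univ, true_and] at hu ⊢
    exact hu.1
  have h7 := h5.trans (Finset.sum_le_sum fun z _ => Nat.mul_le_mul_left _ (h6 z))
  have h8 := key t le_rfl
  have h9 := Nat.mul_le_mul_left L (h2.trans (add_le_add h3 (h4.trans h7)))
  rw [mul_add] at h9
  linarith

/-- The output of the algorithm is nearly optimal with high probability. -/
theorem pr_output_le (hM : 0 < M) (hsh : ∀ x, sh x ≤ R) {κ e : ℝ} (ht : SlowTail sh κ e)
    (hκ : κ ≤ 1 / 4) (he : 0 ≤ e) {V : Finset W} {n : ℕ} (hV : V.card ≤ n)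
    (hVw : ∀ x, J.wt x ≠ 0 → x ∈ V) (hVb : ∀ x ∈ V, ∀ k, J.ball k x ⊆ V)
    {α : ℝ} (hα : 0 ≤ α) (hα1 : α ≤ 1) (hαe : 1 + n * e ≤ (1 - κ) * (1 + α))
    {r P : ℕ → ℕ} {L B B' p E : ℕ} {K : ℝ} (hK : 0 ≤ K) (hL : 0 < L) (hE : 0 < E)
    (hσL : ∀ i < t, (σ i).layers = L) (hσr : ∀ i < t, (σ i).rate = (2 ^ i : ℕ) * K)
    (hP : ∀ i < t, P i + (σ i).reach ≤ (σ i).view)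
    (hr : ∀ i < t, (σ i).reach + 2 * (R + 2) ≤ r i)
    (hr' : ∀ i < t, r (i + 1) + 2 * (R + 2) ≤ (σ i).inner)
    (hP' : ∀ i < t, (σ i).view + (σ i).inner ≤ P (i + 1))
    (hr0 : r 0 ≤ P 0) (hrt : 2 * (R + 2) + 1 ≤ r t) (hLB : 2 * E * t * B ≤ L)
    (hc : α + p * B' / 2 ^ t ≤ 1 / (8 * E)) :
    pr (fun ω : Fin (t + 1) → W → Fin M =>
        ¬ E * J.cost (J.output R sh σ t fun i => ω (Fin.ofNat (t + 1) i)) ≤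
          (E + 1) * J.opt Finset.univ) ≤
      t * (n * Real.exp (-(K / 2)) + n * (Real.exp (2 * K + n / M) / 2 ^ B)) +
        (1 / 4 ^ p + n * ((R + 1) * ((1 + 4 * e) ^ n / 4 ^ B'))) := by
  classical
  have hne : Nonempty (Fin M) := ⟨⟨0, hM⟩⟩
  have hcard : ∀ x ∈ V, ∀ k, (J.ball k x).card ≤ n := fun x hx k =>
    (Finset.card_le_card (hVb x hx k)).trans hV
  have hm : ∀ y, J.wt y ≠ 0 →
      𝔼 ω : W → Fin M, (J.mult R (fun v => sh (ω v)) y : ℝ) ≤ 2 := by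
    intro y hy
    have h1 := (expect_mult_le (J := J) hsh ht (by linarith) he
      (hcard y (hVw y hy) (R + 2))).trans hαe
    have h2 := le_of_mul_le_mul_left h1 (by linarith)
    linarith
  set ext : (Fin (t + 1) → W → Fin M) → ℕ → W → Fin M := fun ω i => ω (Fin.ofNat (t + 1) i)
    with hext
  have hofNat : ∀ i j, i ≤ t → j ≤ t → i ≠ j → Fin.ofNat (t + 1) j ≠ Fin.ofNat (t + 1) i := by
    intro i j hi hj hij h
    have := congrArg Fin.val h
    simp only [Fin.ofNat, Nat.mod_eq_of_lt (Nat.lt_succ_of_le hi),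
      Nat.mod_eq_of_lt (Nat.lt_succ_of_le hj)] at this
    exact hij this.symm
  have hupd : ∀ i ≤ t, ∀ (ω : Fin (t + 1) → W → Fin M) τ,
      J.remaining R sh σ (ext (Function.update ω (Fin.ofNat (t + 1) i) τ)) i =
        J.remaining R sh σ (ext ω) i := by
    intro i hi ω τ
    refine remaining_congr fun j hj => ?_
    simp only [hext]
    rw [Function.update_of_ne (hofNat i j hi (by omega) (by omega))]
  have hself : ∀ i (ω : Fin (t + 1) → W → Fin M) τ,
      ext (Function.update ω (Fin.ofNat (t + 1) i) τ) i = τ := by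
    intro i ω τ
    simp [hext]
  set lightAt : ℕ → Finset W → Prop := fun i S => J.Light V S (r i) (P i) (2 ^ i) with hlightAt
  set overlapAt : ℕ → Finset W → Finset W → Prop := fun i S C => ∀ x ∈ S, J.wt x ≠ 0 →
    (C.filter fun u => u ∈ J.ball (σ i).reach x).card ≤ B with hoverlapAt
  -- A stage is bad only if its input is still light. So each bad event can be bounded conditionally
  -- on the past, and the absence of all of them propagates lightness by induction.
  set bad : ℕ → (Fin (t + 1) → W → Fin M) → Prop := fun i ω =>
    lightAt i (J.remaining R sh σ (ext ω) i) ∧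
    ¬ (lightAt (i + 1) (J.remaining R sh σ (ext ω) (i + 1)) ∧
      overlapAt i (J.remaining R sh σ (ext ω) i) (J.stageCenters R sh σ (ext ω) i)) with hbad
  set O : ℝ := ((J.opt Finset.univ : ℕ) : ℝ) with hO
  have hO0 : 0 ≤ O := Nat.cast_nonneg _
  set excess : Finset W → (W → Fin M) → ℝ := fun S τ =>
    ∑ x, (if x ∈ J.sol S then (J.wt x : ℝ) else 0) * ((J.mult R (fun v => sh (τ v)) x : ℝ) - 1)
    with hexcess
  set bad' : (Fin (t + 1) → W → Fin M) → Prop := fun ω =>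
    lightAt t (J.remaining R sh σ (ext ω) t) ∧
      4 * (O / (8 * E)) < excess (J.remaining R sh σ (ext ω) t) (ext ω t) with hbad'
  have hfalse : ∀ {Ω : Type} [Fintype Ω] {A : Ω → Prop} {η : ℝ}, 0 ≤ η → (∀ ω, ¬ A ω) →
      pr A ≤ η := by
    intro Ω _ A η hη hA
    refine (pr_mono (B := fun _ => False) fun ω hω => hA ω hω).trans ?_
    simpa [pr] using hη
  have hbound : ∀ i < t, pr (bad i) ≤
      n * Real.exp (-(K / 2)) + n * (Real.exp (2 * K + n / M) / 2 ^ B) := by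
    intro i hi
    refine pr_le_of_update (Fin.ofNat (t + 1) i) fun ω => ?_
    by_cases hl : lightAt i (J.remaining R sh σ (ext ω) i)
    · refine le_trans (pr_mono fun τ hτ => ?_) (pr_stage_le (V := V) (B := B) hJ hM hsh hm hK
        (pow_pos (by norm_num) i) hV hVw (fun x hx => hcard x hx _) hl (hσr i hi) (hP i hi)
        (hr i hi) (hr' i hi) (hP' i hi))
      simp only [hbad, hlightAt, hoverlapAt, stageCenters, remaining, hupd i hi.le, hself] at hτ
      rw [pow_succ, mul_comm] at hτ
      exact hτ.2
    · refine hfalse (by positivity) fun τ hτ => hl ?_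
      have := hτ.1
      rwa [hupd i hi.le] at this
  have hbound' : pr bad' ≤ 1 / 4 ^ p + n * ((R + 1) * ((1 + 4 * e) ^ n / 4 ^ B')) := by
    refine pr_le_of_update (Fin.ofNat (t + 1) t) fun ω => ?_
    set S := J.remaining R sh σ (ext ω) t with hS
    by_cases hl : lightAt t S
    swap
    · refine hfalse (by positivity) fun τ hτ => hl ?_
      have := hτ.1
      rwa [hupd t le_rfl] at this
    set w : W → ℝ := fun x => if x ∈ J.sol S then (J.wt x : ℝ) else 0 with hw
    have hw0 : ∀ x, 0 ≤ w x := fun x => by simp only [hw]; positivity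
    have hwV : ∀ x, w x ≠ 0 → x ∈ V ∧ x ∈ S := by
      intro x hx
      simp only [hw, ne_eq, ite_eq_right_iff, Nat.cast_eq_zero, Classical.not_imp] at hx
      exact ⟨hVw x hx.2, sol_subset hJ S hx.1⟩
    have hwsum : ∑ x, w x ≤ O := by
      have h1 : ∑ x, w x = (J.opt S : ℝ) := by
        simp only [hw]
        rw [Finset.sum_ite_mem, Finset.univ_inter, opt, cost]
        push_cast
        rfl
      rw [h1, hO]
      exact_mod_cast opt_mono hJ (Finset.subset_univ S)
    -- The concentration bound needs a positive scale; if the optimum is zero, the excess vanishes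
    -- anyway.
    by_cases hO1 : O = 0
    · refine hfalse (by positivity) fun τ hτ => ?_
      have h1 := hτ.2
      rw [hupd t le_rfl, hself, ← hS, hO1] at h1
      have h2 : ∀ x, w x = 0 := by
        intro x
        have := (Finset.sum_eq_zero_iff_of_nonneg fun x _ => hw0 x).1
          (le_antisymm (hwsum.trans hO1.le) (Finset.sum_nonneg fun x _ => hw0 x))
        exact this x (Finset.mem_univ x)
      have h3 : excess S τ = 0 := Finset.sum_eq_zero fun x _ => by
        change w x * _ = 0
        rw [h2 x, zero_mul]
      rw [h3] at h1
      simp at h1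
    have hOpos : 0 < O := lt_of_le_of_ne hO0 (Ne.symm hO1)
    have hE' : (0 : ℝ) < E := by exact_mod_cast hE
    refine le_trans (pr_mono fun τ hτ => ?_) (pr_sum_mult_le (J := J) (w := w) (n := n) (B := B')
      (p := p) (α := α) (Δ := O / 2 ^ t) (c := O / (8 * E)) hsh ht hκ he hw0 hα (by positivity)
      ?_ ?_ hαe ?_ (by positivity) ?_)
    · have h1 := hτ.2
      rwa [hupd t le_rfl, hself, ← hS] at h1
    · refine (Finset.card_le_card fun x hx => ?_).trans hV
      exact (hwV x (Finset.mem_filter.1 hx).2).1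
    · exact fun x hx => hcard x (hwV x hx).1 _
    -- Within a ball, the optimal solution of the remainder costs no more than the optimum of a
    -- slightly larger ball, which the `t` halvings have made light.
    · intro x hx
      have h1 : ∑ y ∈ J.ball (2 * (R + 2)) x, w y =
          (J.cost (J.sol S ∩ J.ball (2 * (R + 2)) x) : ℝ) := by
        simp only [hw]
        rw [Finset.sum_ite_mem, Finset.inter_comm, cost]
        push_cast
        rfl
      rw [h1, le_div_iff₀ (by positivity), mul_comm, hO]
      have h2 := cost_sol_inter_ball_le hJ S (2 * (R + 2)) x
      have h3 : J.opt (J.ball (2 * (R + 2) + 1) x ∩ S) ≤ J.opt (J.ball (r t) x ∩ S) :=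
        opt_mono hJ (Finset.inter_subset_inter_right (J.ball_mono hrt x))
      have h4 : 2 ^ t * J.opt (J.ball (r t) x ∩ S) ≤ J.opt (J.ball (P t) x) :=
        hl x (hwV x hx).2 (hwV x hx).1
      have h5 : J.opt (J.ball (P t) x) ≤ J.opt Finset.univ := opt_mono hJ (Finset.subset_univ _)
      exact_mod_cast (Nat.mul_le_mul_left _ (h2.trans h3)).trans (h4.trans h5)
    · calc α * ∑ x, w x + p * B' * (O / 2 ^ t) ≤ α * O + p * B' * (O / 2 ^ t) := by gcongr
        _ = (α + p * B' / 2 ^ t) * O := by ring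
        _ ≤ 1 / (8 * E) * O := by gcongr
        _ = O / (8 * E) := by ring
  refine le_trans (pr_mono (B := fun ω => (∃ i ∈ Finset.range t, bad i ω) ∨ bad' ω) fun ω hω => ?_)
    ((pr_or_le _ _).trans (add_le_add ?_ hbound'))
  swap
  · refine (pr_exists_le_card (Finset.range t) bad
      fun i hi => hbound i (Finset.mem_range.1 hi)).trans (le_of_eq ?_)
    rw [Finset.card_range]
  by_contra hcon
  push Not at hcon
  obtain ⟨h1, h2⟩ := hcon
  have hlight : ∀ i ≤ t, lightAt i (J.remaining R sh σ (ext ω) i) := by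
    intro i
    induction i with
    | zero =>
      intro _ x _ _
      rw [pow_zero, one_mul]
      exact opt_mono hJ (Finset.inter_subset_left.trans (J.ball_mono hr0 x))
    | succ i ih =>
      intro hi
      by_contra h
      exact h1 i (Finset.mem_range.2 (by omega)) ⟨ih (by omega), fun h' => h h'.1⟩
  have hover : ∀ i < t, overlapAt i (J.remaining R sh σ (ext ω) i)
      (J.stageCenters R sh σ (ext ω) i) := by
    intro i hi
    by_contra h
    exact h1 i (Finset.mem_range.2 hi) ⟨hlight i hi.le, fun h' => h h'.2⟩
  have hex : excess (J.remaining R sh σ (ext ω) t) (ext ω t) ≤ 4 * (O / (8 * E)) := by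
    by_contra h
    exact h2 ⟨hlight t le_rfl, not_le.1 h⟩
  have hinner : ∀ i < t, 0 < (σ i).inner := fun i hi => by have := hr' i hi; omega
  have hcost := cost_output_le hJ (ω := ext ω) hL hinner hσL hover
  set S := J.remaining R sh σ (ext ω) t
  have hsum : (∑ x ∈ J.sol S, (J.wt x : ℝ) * J.mult R (fun v => sh (ext ω t v)) x) =
      J.opt S + excess S (ext ω t) := by
    simp only [hexcess, ite_mul, zero_mul]
    rw [Finset.sum_ite_mem, Finset.univ_inter, opt, cost]
    push_cast
    rw [← Finset.sum_add_distrib]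
    refine Finset.sum_congr rfl fun x _ => ?_
    ring
  have hcost' : (L : ℝ) * J.cost (J.output R sh σ t (ext ω)) + L * J.opt S ≤
      (L + t * B) * O + L * (J.opt S + excess S (ext ω t)) := by
    rw [← hsum, hO]
    exact_mod_cast hcost
  refine hω ?_
  have hE' : (0 : ℝ) < E := by exact_mod_cast hE
  have hL' : (0 : ℝ) < L := by exact_mod_cast hL
  have hLB' : 2 * (E : ℝ) * t * B ≤ L := by exact_mod_cast hLB
  have hex' : 2 * E * excess S (ext ω t) ≤ O := by
    have : 4 * (O / (8 * E)) = O / (2 * E) := by field_simp; ring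
    rw [this, le_div_iff₀ (by positivity)] at hex
    linarith
  -- Half of the allowed excess `O / E` pays for the stages, by `2 * E * t * B ≤ L`, and half for
  -- the final cover.
  have hgoal : (E : ℝ) * J.cost (J.output R sh σ t (ext ω)) ≤ (E + 1) * O := by
    refine le_of_mul_le_mul_left ?_ hL'
    have h3 := mul_le_mul_of_nonneg_right hLB' hO0
    have h4 := mul_le_mul_of_nonneg_left hcost' hE'.le
    have h5 := mul_le_mul_of_nonneg_left hex' hL'.le
    nlinarith
  rw [hO] at hgoal
  exact_mod_cast hgoal

end CovInst

/-! ### Locality of the algorithm -/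

namespace CovInst

open FinProb

variable {W : Type} {M : ℕ}

/-- The two instances and the two families of random numbers coincide at the variable `z`. -/
structure AgreeAt (J J' : CovInst W) (ω ω' : ℕ → W → Fin M) (z : W) : Prop where
  wt : J.wt z = J'.wt z
  cons : ∀ c : (W → ℝ) × ℝ, c.1 z ≠ 0 → (c ∈ J.cons ↔ c ∈ J'.cons)
  rand : ∀ i, ω i z = ω' i z

/-- The two instances and the two families of random numbers coincide within distance `k`
of `y`. -/
def LocEq (J J' : CovInst W) (ω ω' : ℕ → W → Fin M) (k : ℕ) (y : W) : Prop :=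
  ∀ z, J.Near k y z → AgreeAt J J' ω ω' z

variable {J J' : CovInst W} {ω ω' : ℕ → W → Fin M}

theorem LocEq.mono {a b : ℕ} {y : W} (h : LocEq J J' ω ω' b y) (hab : a ≤ b) :
    LocEq J J' ω ω' a y := fun z hz => h z (hz.mono hab)

theorem LocEq.shift {a b k : ℕ} {y z : W} (h : LocEq J J' ω ω' k y) (hz : J.Near a y z)
    (hk : a + b ≤ k) : LocEq J J' ω ω' b z := fun w hw => h w ((hz.trans hw).mono hk)

theorem LocEq.self {k : ℕ} {y : W} (h : LocEq J J' ω ω' k y) : AgreeAt J J' ω ω' y :=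
  h y (.refl k y)

theorem AgreeAt.adj_iff {y z : W} (h : AgreeAt J J' ω ω' y) : J.Adj y z ↔ J'.Adj y z := by
  constructor
  · rintro ⟨c, hc, hy, hz⟩
    exact ⟨c, (h.cons c hy).1 hc, hy, hz⟩
  · rintro ⟨c, hc, hy, hz⟩
    exact ⟨c, (h.cons c hy).2 hc, hy, hz⟩

/-- Each step of a path uses a constraint through its starting point, where the instances agree. -/
theorem LocEq.near_iff {k : ℕ} {y z : W} (h : LocEq J J' ω ω' k y) :
    J.Near k y z ↔ J'.Near k y z := by
  induction k generalizing z with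
  | zero => exact Iff.rfl
  | succ k ih =>
    have h' := h.mono (Nat.le_succ k)
    refine or_congr (ih h') ⟨?_, ?_⟩
    · rintro ⟨w, hw, hwz⟩
      exact ⟨w, (ih h').1 hw, (h' w hw).adj_iff.1 hwz⟩
    · rintro ⟨w, hw, hwz⟩
      have hw' := (ih h').2 hw
      exact ⟨w, hw', (h' w hw').adj_iff.2 hwz⟩

theorem LocEq.near_iff_right {k : ℕ} {y z : W} (h : LocEq J J' ω ω' k y) :
    J.Near k z y ↔ J'.Near k z y := by
  rw [near_comm, h.near_iff, near_comm]

theorem covers_congr {S X : Finset W} (h : ∀ y ∈ S, AgreeAt J J' ω ω' y) :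
    J.Covers S X ↔ J'.Covers S X := by
  constructor
  · intro hX c hc h1 h2
    obtain ⟨x, hx⟩ := h1
    exact hX c (((h x (h2 x hx)).cons c hx).2 hc) ⟨x, hx⟩ h2
  · intro hX c hc h1 h2
    obtain ⟨x, hx⟩ := h1
    exact hX c (((h x (h2 x hx)).cons c hx).1 hc) ⟨x, hx⟩ h2

theorem cost_congr {S X : Finset W} (hX : X ⊆ S) (h : ∀ y ∈ S, AgreeAt J J' ω ω' y) :
    J.cost X = J'.cost X := Finset.sum_congr rfl fun x hx => (h x (hX hx)).wt

/-- The chosen optimum depends only on the predicate `IsOpt S`, and equal predicates give equal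
choices. Thus vertices with different partial views agree on one solution of a common cluster,
annulus or cell. -/
theorem sol_congr {S : Finset W} (h : ∀ y ∈ S, AgreeAt J J' ω ω' y) : J.sol S = J'.sol S := by
  unfold sol
  congr 1
  funext X
  refine propext (and_congr_right fun hX => and_congr (covers_congr h) ?_)
  refine forall_congr' fun Y => forall_congr' fun hY => ?_
  rw [covers_congr h, cost_congr hX h, cost_congr hY h]

variable [Fintype W]

theorem opt_congr (hJ : J.WellFormed) {S : Finset W} (h : ∀ y ∈ S, AgreeAt J J' ω ω' y) :
    J.opt S = J'.opt S := by
  rw [opt, opt, ← sol_congr h, cost_congr (sol_subset hJ S) h]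

theorem LocEq.ball_eq {k : ℕ} {y : W} (h : LocEq J J' ω ω' k y) : J.ball k y = J'.ball k y := by
  ext z
  rw [mem_ball, mem_ball, h.near_iff]

theorem LocEq.opt_ball_eq (hJ : J.WellFormed) {k : ℕ} {y : W} (h : LocEq J J' ω ω' k y) :
    J.opt (J.ball k y) = J'.opt (J'.ball k y) := by
  rw [← h.ball_eq]
  exact opt_congr hJ fun z hz => h z (mem_ball.1 hz)

/-! ### Locality of clusters and densities -/

section Cluster

variable {R : ℕ} {T : W → ℕ}

theorem LocEq.peak_eq (hT : ∀ u, T u ≤ R) {y : W} (h : LocEq J J' ω ω' R y) :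
    J.peak R T y = J'.peak R T y := by
  refine le_antisymm ?_ ?_
  · obtain ⟨u, h1, h2⟩ := exists_peak (J := J) (R := R) (T := T) y
    refine le_peak hT (u := u) h1 ?_
    rwa [← (h.mono (by have := hT u; omega)).near_iff_right]
  · obtain ⟨u, h1, h2⟩ := exists_peak (J := J') (R := R) (T := T) y
    refine le_peak hT (u := u) h1 ?_
    rwa [(h.mono (by have := hT u; omega)).near_iff_right]

theorem LocEq.mem_cluster_iff (hT : ∀ u, T u ≤ R) {y u : W} (h : LocEq J J' ω ω' (R + 2) y) :
    y ∈ J.cluster R T u ↔ y ∈ J'.cluster R T u := by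
  rw [mem_cluster, mem_cluster, (h.mono (by omega)).peak_eq hT,
    (h.mono (by have := hT u; omega)).near_iff_right]

variable [DecidableEq W]

/-- A cluster containing `x` lies within `2 * (R + 2)` of `x`, and membership of each of its points
is decided within a further `R + 2`. -/
theorem LocEq.cluster_inter_eq (hT : ∀ u, T u ≤ R) {T' : W → ℕ} (hT' : ∀ u, T' u ≤ R)
    {S S' : Finset W} {x u : W} {k : ℕ} (hk : 4 * (R + 2) ≤ k)
    (h : LocEq J J' ω ω' k x) (hTT : ∀ y, J.Near k x y → T y = T' y)
    (hS : ∀ y, J.Near (2 * (R + 2)) x y → (y ∈ S ↔ y ∈ S')) (hx : x ∈ J.cluster R T u) :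
    J.cluster R T u ∩ S = J'.cluster R T' u ∩ S' := by
  have hmem : ∀ y, J.Near (2 * (R + 2)) x y →
      (y ∈ J.cluster R T u ↔ y ∈ J'.cluster R T' u) := by
    intro y hy
    have hl : LocEq J J' ω ω' (R + 2) y := h.shift hy (by omega)
    rw [hl.mem_cluster_iff hT]
    refine mem_cluster_congr hT hT' fun z hz => hTT z ?_
    rw [mem_ball, ← hl.near_iff] at hz
    exact (hy.trans hz).mono (by omega)
  have hx' : x ∈ J'.cluster R T' u := (hmem x (.refl _ x)).1 hx
  have hd : ∀ y, y ∈ J.cluster R T u → J.Near (2 * (R + 2)) x y := fun y hy => by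
    have := cluster_subset_ball hT hx (mem_ball.2 (.refl 0 x)) hy
    rw [mem_ball] at this
    exact this.mono (by omega)
  have hd' : ∀ y, y ∈ J'.cluster R T' u → J.Near (2 * (R + 2)) x y := fun y hy => by
    have := cluster_subset_ball hT' hx' (mem_ball.2 (.refl 0 x)) hy
    rw [mem_ball] at this
    rw [(h.mono (by omega)).near_iff]
    exact this.mono (by omega)
  ext y
  simp only [Finset.mem_inter]
  constructor
  · rintro ⟨h1, h2⟩
    exact ⟨(hmem y (hd y h1)).1 h1, (hS y (hd y h1)).1 h2⟩
  · rintro ⟨h1, h2⟩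
    exact ⟨(hmem y (hd' y h1)).2 h1, (hS y (hd' y h1)).2 h2⟩

theorem LocEq.mem_sol_cluster_iff (hJ : J.WellFormed) (hJ' : J'.WellFormed) (hT : ∀ u, T u ≤ R)
    {T' : W → ℕ} (hT' : ∀ u, T' u ≤ R) {S S' : Finset W} {x u : W} {k : ℕ}
    (hk : 4 * (R + 2) ≤ k) (h : LocEq J J' ω ω' k x)
    (hTT : ∀ y, J.Near k x y → T y = T' y)
    (hS : ∀ y, J.Near (2 * (R + 2)) x y → (y ∈ S ↔ y ∈ S')) :
    x ∈ J.sol (J.cluster R T u ∩ S) ↔ x ∈ J'.sol (J'.cluster R T' u ∩ S') := by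
  have hx : x ∈ J.cluster R T u ↔ x ∈ J'.cluster R T' u := by
    have hl : LocEq J J' ω ω' (R + 2) x := h.mono (by omega)
    rw [hl.mem_cluster_iff hT]
    refine mem_cluster_congr hT hT' fun z hz => hTT z ?_
    rw [mem_ball, ← hl.near_iff] at hz
    exact hz.mono (by omega)
  by_cases hxu : x ∈ J.cluster R T u
  · rw [← h.cluster_inter_eq hT hT' hk hTT hS hxu, sol_congr (ω := ω) (ω' := ω')]
    intro y hy
    have := cluster_subset_ball hT hxu (mem_ball.2 (.refl 0 x)) (Finset.mem_inter.1 hy).1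
    rw [mem_ball] at this
    exact h y (this.mono (by omega))
  · refine iff_of_false (fun hc => hxu ?_) (fun hc => hxu ?_)
    · exact (Finset.mem_inter.1 (sol_subset hJ _ hc)).1
    · exact hx.2 (Finset.mem_inter.1 (sol_subset hJ' _ hc)).1

/-- The density averages over all possible shifts instead of using drawn ones, so only the instance
and `S` near `x` enter. -/
theorem LocEq.density_eq (hJ : J.WellFormed) (hJ' : J'.WellFormed) {sh : Fin M → ℕ}
    (hsh : ∀ x, sh x ≤ R) {S S' : Finset W} {x : W} {k : ℕ} (hk : 4 * (R + 2) ≤ k)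
    (h : LocEq J J' ω ω' k x) (hS : ∀ y, J.Near (2 * (R + 2)) x y → (y ∈ S ↔ y ∈ S')) :
    J.density R sh S x = J'.density R sh S' x := by
  unfold density
  refine Finset.expect_congr rfl fun τ _ => Finset.sum_congr rfl fun u _ => ?_
  rw [h.self.wt]
  have := h.mem_sol_cluster_iff hJ hJ' (T := fun v => sh (τ v)) (T' := fun v => sh (τ v))
    (u := u) (fun _ => hsh _) (fun _ => hsh _) hk (fun _ _ => rfl) hS
  simp only [this]

end Cluster

/-! ### Locality of the carving stages -/

section Stages

variable [DecidableEq W] {R : ℕ} {sh : Fin M → ℕ} {S S' : Finset W}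

theorem LocEq.annulus_eq {k j : ℕ} {u : W} (h : LocEq J J' ω ω' k u) (hj : j + 1 ≤ k)
    (hS : ∀ y, J.Near k u y → (y ∈ S ↔ y ∈ S')) : J.annulus S j u = J'.annulus S' j u := by
  ext y
  rw [mem_annulus, mem_annulus, ← (h.mono hj).near_iff, ← (h.mono (by omega)).near_iff]
  exact ⟨fun hy => ⟨(hS y (hy.2.1.mono hj)).1 hy.1, hy.2⟩,
    fun hy => ⟨(hS y (hy.2.1.mono hj)).2 hy.1, hy.2⟩⟩

theorem LocEq.opt_annulus_eq (hJ : J.WellFormed) {k j : ℕ} {u : W}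
    (h : LocEq J J' ω ω' k u) (hj : j + 1 ≤ k) (hS : ∀ y, J.Near k u y → (y ∈ S ↔ y ∈ S')) :
    J.opt (J.annulus S j u) = J'.opt (J'.annulus S' j u) := by
  rw [← h.annulus_eq hj hS]
  exact opt_congr hJ fun z hz => h z ((mem_annulus.1 hz).2.1.mono hj)

theorem LocEq.radius_eq (hJ : J.WellFormed) {σ : Carving} {u : W}
    (h : LocEq J J' ω ω' σ.reach u) (hS : ∀ y, J.Near σ.reach u y → (y ∈ S ↔ y ∈ S')) :
    J.radius σ S u = J'.radius σ S' u := by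
  have h1 : ∀ b < σ.layers, J.opt (J.annulus S (σ.inner + 2 * b) u) =
      J'.opt (J'.annulus S' (σ.inner + 2 * b) u) := fun b hb =>
    h.opt_annulus_eq hJ (by unfold Carving.reach; omega) hS
  unfold radius layer
  congr 3
  funext a
  refine propext (and_congr_right fun ha => forall_congr' fun b => forall_congr' fun hb => ?_)
  rw [h1 a ha, h1 b hb]

variable {σ : Stage} {k r : ℕ}

theorem LocEq.mem_centers_iff (hJ : J.WellFormed) (hJ' : J'.WellFormed) (hsh : ∀ x, sh x ≤ R)
    (hr : 2 * (R + 2) ≤ r) (hk : 2 * r ≤ k) (hview : σ.view ≤ k)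
    (hS : ∀ y, LocEq J J' ω ω' k y → (y ∈ S ↔ y ∈ S')) {u : W}
    (h : LocEq J J' ω ω' (k + r) u) (i : ℕ) :
    u ∈ J.centers R sh σ S (ω i) ↔ u ∈ J'.centers R sh σ S' (ω' i) := by
  rw [CovInst.mem_centers, CovInst.mem_centers, rateAt, rateAt, h.self.rand i,
    (h.mono (show σ.view ≤ k + r by omega)).opt_ball_eq hJ,
    h.density_eq hJ hJ' hsh (by omega) fun y hy => hS y (h.shift hy (by omega))]

/-- Only centers within `r` of `y` matter, and each of them is decided within `k + r` of itself. -/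
theorem LocEq.key_eq (hJ : J.WellFormed) (hJ' : J'.WellFormed) (hsh : ∀ x, sh x ≤ R)
    (hL : 0 < σ.layers) (hr : 2 * (R + 2) ≤ r) (hk : 2 * r ≤ k) (hview : σ.view ≤ k)
    (hreach : σ.reach ≤ r)
    (hS : ∀ y, LocEq J J' ω ω' k y → (y ∈ S ↔ y ∈ S')) {y : W}
    (h : LocEq J J' ω ω' (k + 2 * r) y) (i : ℕ) :
    J.key σ.toCarving S (J.centers R sh σ S (ω i)) y =
      J'.key σ.toCarving S' (J'.centers R sh σ S' (ω' i)) y := by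
  ext u
  rw [mem_key, mem_key]
  by_cases hu : J.Near r u y
  · have hl : LocEq J J' ω ω' (k + r) u := h.shift (near_symm hu) (by omega)
    have hrad := (hl.mono (show σ.toCarving.reach ≤ k + r by omega)).radius_eq hJ (S := S) (S' := S')
      fun z hz => hS z (hl.shift hz (by omega))
    have hlt := radius_lt_reach (J := J) (σ := σ.toCarving) (S := S) hL u
    rw [hl.mem_centers_iff hJ hJ' hsh hr hk hview hS i, ← hrad,
      (h.mono (by omega)).near_iff_right]
  · refine iff_of_false (fun hc => hu ?_) (fun hc => hu ?_)
    · have hlt := radius_lt_reach (J := J) (σ := σ.toCarving) (S := S) hL u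
      exact hc.2.mono (by omega)
    · have hlt := radius_lt_reach (J := J') (σ := σ.toCarving) (S := S') hL u
      rw [(h.mono (by omega)).near_iff_right]
      exact hc.2.mono (by omega)

theorem LocEq.mem_survivors_iff (hJ : J.WellFormed) (hJ' : J'.WellFormed) (hsh : ∀ x, sh x ≤ R)
    (hL : 0 < σ.layers) (hr : 2 * (R + 2) ≤ r) (hk : 2 * r ≤ k) (hview : σ.view ≤ k)
    (hreach : σ.reach ≤ r)
    (hS : ∀ y, LocEq J J' ω ω' k y → (y ∈ S ↔ y ∈ S')) {y : W}
    (h : LocEq J J' ω ω' (k + 2 * r) y) (i : ℕ) :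
    y ∈ J.survivors σ.toCarving S (J.centers R sh σ S (ω i)) ↔
      y ∈ J'.survivors σ.toCarving S' (J'.centers R sh σ S' (ω' i)) := by
  rw [mem_survivors, mem_survivors, h.key_eq hJ hJ' hsh hL hr hk hview hreach hS i,
    hS y (h.mono (by omega))]

/-- Points of one cell with nonempty key share a center, hence are at distance at most `2 * r`, and
each of their keys is decided within `k + 2 * r`. -/
theorem LocEq.mem_carveOut_iff (hJ : J.WellFormed) (hJ' : J'.WellFormed) (hsh : ∀ x, sh x ≤ R)
    (hL : 0 < σ.layers) (hr : 2 * (R + 2) ≤ r) (hk : 2 * r ≤ k) (hview : σ.view ≤ k)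
    (hreach : σ.reach ≤ r)
    (hS : ∀ y, LocEq J J' ω ω' k y → (y ∈ S ↔ y ∈ S')) {x : W}
    (h : LocEq J J' ω ω' (k + 4 * r) x) (i : ℕ) :
    x ∈ J.carveOut σ.toCarving S (J.centers R sh σ S (ω i)) ↔
      x ∈ J'.carveOut σ.toCarving S' (J'.centers R sh σ S' (ω' i)) := by
  rw [mem_carveOut, mem_carveOut]
  refine or_congr (exists_congr fun u => ?_) ?_
  · by_cases hu : J.Near r u x
    · have hl : LocEq J J' ω ω' (k + r) u := h.shift (near_symm hu) (by omega)
      have hlr : LocEq J J' ω ω' σ.reach u := hl.mono (by omega)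
      have hSr : ∀ z, J.Near σ.reach u z → (z ∈ S ↔ z ∈ S') :=
        fun z hz => hS z (hl.shift hz (by omega))
      have hlt := radius_lt_reach (J := J) (σ := σ.toCarving) (S := S) hL u
      rw [hl.mem_centers_iff hJ hJ' hsh hr hk hview hS i, ← hlr.radius_eq hJ hSr,
        ← hlr.annulus_eq (by omega) hSr, sol_congr (ω := ω) (ω' := ω') (J := J)]
      exact fun z hz => hl z ((mem_annulus.1 hz).2.1.mono (by omega))
    · refine iff_of_false (fun hc => hu ?_) (fun hc => hu ?_)
      · have hlt := radius_lt_reach (J := J) (σ := σ.toCarving) (S := S) hL u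
        exact (mem_annulus.1 (sol_subset hJ _ hc.2)).2.1.mono (by omega)
      · have hlt := radius_lt_reach (J := J') (σ := σ.toCarving) (S := S') hL u
        rw [(h.mono (by omega)).near_iff_right]
        exact (mem_annulus.1 (sol_subset hJ' _ hc.2)).2.1.mono (by omega)
  · have hkey := (h.mono (show k + 2 * r ≤ k + 4 * r by omega)).key_eq hJ hJ' hsh hL hr hk hview
      hreach hS i
    rw [← hkey]
    refine and_congr_right fun hne => ?_
    obtain ⟨u, hu⟩ := Finset.nonempty_iff_ne_empty.2 hne
    have hux : J.Near r u x := by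
      have hlt := radius_lt_reach (J := J) (σ := σ.toCarving) (S := S) hL u
      exact (mem_key.1 hu).2.mono (by omega)
    have hnear : ∀ z, J.key σ.toCarving S (J.centers R sh σ S (ω i)) z =
        J.key σ.toCarving S (J.centers R sh σ S (ω i)) x → J.Near (2 * r) x z := by
      intro z hz
      have hlt := radius_lt_reach (J := J) (σ := σ.toCarving) (S := S) hL u
      rw [← hz] at hu
      exact ((near_symm hux).trans (mem_key.1 hu).2).mono (by omega)
    have hnear' : ∀ z, J'.key σ.toCarving S' (J'.centers R sh σ S' (ω' i)) z =
        J.key σ.toCarving S (J.centers R sh σ S (ω i)) x → J.Near (2 * r) x z := by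
      intro z hz
      have hlt := radius_lt_reach (J := J') (σ := σ.toCarving) (S := S') hL u
      rw [← hz] at hu
      have h1 : J'.Near r x u := by
        rw [← (h.mono (by omega)).near_iff]
        exact near_symm hux
      rw [(h.mono (by omega)).near_iff]
      exact (h1.trans (mem_key.1 hu).2).mono (by omega)
    have hcell : J.cell σ.toCarving S (J.centers R sh σ S (ω i))
          (J.key σ.toCarving S (J.centers R sh σ S (ω i)) x) =
        J'.cell σ.toCarving S' (J'.centers R sh σ S' (ω' i))
          (J.key σ.toCarving S (J.centers R sh σ S (ω i)) x) := by
      ext z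
      rw [mem_cell, mem_cell]
      constructor
      · rintro ⟨h1, h2⟩
        have hl : LocEq J J' ω ω' (k + 2 * r) z := h.shift (hnear z h2) (by omega)
        rw [← hl.key_eq hJ hJ' hsh hL hr hk hview hreach hS i]
        exact ⟨(hS z (hl.mono (by omega))).1 h1, h2⟩
      · rintro ⟨h1, h2⟩
        have hl : LocEq J J' ω ω' (k + 2 * r) z := h.shift (hnear' z h2) (by omega)
        rw [hl.key_eq hJ hJ' hsh hL hr hk hview hreach hS i]
        exact ⟨(hS z (hl.mono (by omega))).2 h1, h2⟩
    rw [← hcell, sol_congr (ω := ω) (ω' := ω') (J := J)]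
    exact fun z hz => h z ((hnear z (mem_cell.1 hz).2).mono (by omega))

/-- Whether the algorithm selects `x` is determined by the instance near `x`. -/
theorem LocEq.mem_output_iff (hJ : J.WellFormed) (hJ' : J'.WellFormed) (hsh : ∀ x, sh x ≤ R)
    {σ : ℕ → Stage} {t : ℕ} (hL : ∀ i < t, 0 < (σ i).layers) (hr : 2 * (R + 2) ≤ r)
    (hreach : ∀ i < t, (σ i).reach ≤ r) (hview : ∀ i < t, (σ i).view ≤ (2 * i + 2) * r) {x : W}
    (h : LocEq J J' ω ω' ((2 * t + 4) * r) x) :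
    x ∈ J.output R sh σ t ω ↔ x ∈ J'.output R sh σ t ω' := by
  -- Each stage extends the radius of dependence by `2 * r`, in step with the bound on `view`.
  have hrem : ∀ i ≤ t, ∀ y, LocEq J J' ω ω' ((2 * i + 2) * r) y →
      (y ∈ J.remaining R sh σ ω i ↔ y ∈ J'.remaining R sh σ ω' i) := by
    intro i
    induction i with
    | zero => intro _ y _; simp [remaining]
    | succ i ih =>
      intro hi y hy
      have e : (2 * (i + 1) + 2) * r = (2 * i + 2) * r + 2 * r := by ring
      rw [e] at hy
      have hk : 2 * r ≤ (2 * i + 2) * r := Nat.mul_le_mul_right r (by omega)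
      exact hy.mem_survivors_iff hJ hJ' hsh (hL i (by omega)) hr hk (hview i (by omega))
        (hreach i (by omega)) (ih (by omega)) i
  have e1 : (2 * t + 4) * r = (2 * t + 2) * r + 2 * r := by ring
  rw [mem_output, mem_output]
  refine or_congr (exists_congr fun i => and_congr_right fun hi => ?_) (exists_congr fun u => ?_)
  · have hk : 2 * r ≤ (2 * i + 2) * r := Nat.mul_le_mul_right r (by omega)
    have e2 : (2 * i + 2) * r + 4 * r ≤ (2 * t + 4) * r := by
      have : (2 * i + 2) * r + 4 * r = (2 * i + 6) * r := by ring
      rw [this]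
      exact Nat.mul_le_mul_right r (by omega)
    exact (h.mono e2).mem_carveOut_iff hJ hJ' hsh (hL i hi) hr hk (hview i hi) (hreach i hi)
      (hrem i hi.le) i
  · have hk : 2 * r ≤ (2 * t + 2) * r := Nat.mul_le_mul_right r (by omega)
    refine h.mem_sol_cluster_iff hJ hJ' (fun _ => hsh _) (fun _ => hsh _) (by omega)
      (fun y hy => ?_) fun y hy => hrem t le_rfl y (h.shift hy (by omega))
    rw [(h y hy).rand t]

end Stages

end CovInst

/-! ### Gathering the neighbourhood in the LOCAL model -/

namespace Flood

/-- What a vertex tells about itself: its identifier, its weight, the constraints in which it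
occurs, and its random numbers. -/
structure VertexRecord (W : Type) (M : ℕ) where
  id : W
  wt : ℕ
  cons : Set ((W → ℝ) × ℝ)
  rand : ℕ → Fin M

/-- The state of a vertex: its own input and the set of all records that it has received. -/
structure State (W : Type) (M : ℕ) where
  own : W × (ℕ → Fin M)
  wt : ℕ
  raw : Set (ℝ × (ℕ → ℝ) × ℝ)
  known : Set (VertexRecord W M)

variable {W : Type} {M : ℕ}

/-- A constraint in terms of identifiers instead of links. -/
noncomputable def globalCons (x : W) {d : ℕ} (nbr : Fin d → W) (κ : ℝ × (ℕ → ℝ) × ℝ) :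
    (W → ℝ) × ℝ :=
  open scoped Classical in
  (fun y => (if x = y then κ.1 else 0) + ∑ p, if nbr p = y then κ.2.1 p else 0, κ.2.2)

/-- The record of a vertex that knows the identifiers of its neighbours. -/
noncomputable def State.record (s : State W M) {d : ℕ} (nbr : Fin d → W) : VertexRecord W M where
  id := s.own.1
  wt := s.wt
  cons := globalCons s.own.1 nbr '' s.raw
  rand := s.own.2

/-- The initial state of a vertex with `d` links. -/
def initState (dec : (ℕ → Bool) → W × (ℕ → Fin M)) (d : ℕ) (inp : CoveringInput d)
    (r : ℕ → Bool) : State W M where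
  own := dec r
  wt := inp.weight
  raw := {κ | ∃ c ∈ inp.constraints,
    κ = (c.own, fun p => if h : p < d then c.nbr ⟨p, h⟩ else 0, c.rhs)}
  known := ∅

open scoped Classical in
/-- The instance that is described by a set of records. -/
noncomputable def recon (K : Set (VertexRecord W M)) : CovInst W where
  wt x := if h : ∃ ρ ∈ K, ρ.id = x then h.choose.wt else 0
  cons := {c | ∃ ρ ∈ K, c ∈ ρ.cons}

open scoped Classical in
/-- The random numbers that are described by a set of records. -/
noncomputable def reconRand [NeZero M] (K : Set (VertexRecord W M)) (i : ℕ) (x : W) : Fin M :=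
  if h : ∃ ρ ∈ K, ρ.id = x then h.choose.rand i else 0

open scoped Classical in
/-- The algorithm that floods all records for `k + 1` rounds and then applies the rule `sel` to the
instance that it has seen. -/
noncomputable def floodAlg [NeZero M] (dec : (ℕ → Bool) → W × (ℕ → Fin M))
    (sel : CovInst W → (ℕ → W → Fin M) → W → Prop) (k : ℕ) : LocalAlgorithm CoveringInput where
  State := State W M
  Message := W × Set (VertexRecord W M)
  init := initState dec
  send _ s _ := (s.own.1, s.known)
  update _ s msg := { s with
    known := insert (s.record fun p => (msg p).1) (s.known ∪ ⋃ p, (msg p).2) }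
  output s := decide (sel (recon s.known) (reconRand s.known) s.own.1)
  rounds := k + 1

variable {m n : ℕ} (I : CoveringILP m n)

/-- The constraint `j` in terms of the identifiers `ι`. -/
noncomputable def idCons (ι : Fin n → W) (j : Fin m) : (W → ℝ) × ℝ :=
  open scoped Classical in (fun x => ∑ u, if ι u = x then I.A j u else 0, I.b j)

/-- The covering ILP in terms of the identifiers `ι`. -/
noncomputable def idInst (ι : Fin n → W) : CovInst W where
  wt x := open scoped Classical in ∑ u, if ι u = x then I.w u else 0
  cons := {c | ∃ j, (∃ v, I.A j v ≠ 0) ∧ c = idCons I ι j}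

/-- The record of the vertex `v`. -/
noncomputable def vertexRecord (ι : Fin n → W) (rand : Fin n → ℕ → Fin M) (v : Fin n) :
    VertexRecord W M where
  id := ι v
  wt := I.w v
  cons := {c | ∃ j, I.A j v ≠ 0 ∧ c = idCons I ι j}
  rand := rand v

variable {I}

theorem commGraph_adj {u v : Fin n} : I.hypergraph.commGraph.Adj u v ↔
    u ≠ v ∧ ∃ j, I.A j u ≠ 0 ∧ I.A j v ≠ 0 := by
  change u ≠ v ∧ I.hypergraph.Adj u v ↔ _
  refine and_congr_right fun _ => ?_
  simp [Hypergraph.Adj, CoveringILP.hypergraph]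

section Gather

variable [NeZero M] (dec : (ℕ → Bool) → W × (ℕ → Fin M))
  (sel : CovInst W → (ℕ → W → Fin M) → W → Prop) (k : ℕ)
  (P : PortNumbering I.hypergraph.commGraph) (r : Fin n → ℕ → Bool)

/-- A constraint through `v` involves only `v` and its neighbours, so the coefficients that `v` sees
are all the nonzero ones. -/
theorem globalCons_eq (ι : Fin n → W) (v : Fin n) (j : Fin m) (hj : I.A j v ≠ 0) :
    globalCons (ι v) (fun p => ι (P.port v p).1)
      (I.A j v, fun p => if h : p < P.deg v then I.A j (P.port v ⟨p, h⟩).1 else 0, I.b j) =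
      idCons I ι j := by
  classical
  refine Prod.ext (funext fun x => ?_) rfl
  simp only [globalCons, idCons, Fin.is_lt, dif_pos, Fin.eta]
  have h1 : ∑ p : Fin (P.deg v), (if ι (P.port v p).1 = x then I.A j (P.port v p).1 else 0) =
      ∑ u ∈ Finset.univ.filter (fun u => I.hypergraph.commGraph.Adj v u),
        if ι u = x then I.A j u else 0 := by
    rw [(P.port v).sum_comp fun u => if ι u.1 = x then I.A j u.1 else 0]
    exact (Finset.sum_subtype _ (by simp) fun u => if ι u = x then I.A j u else 0).symm
  rw [h1, ← Finset.add_sum_erase _ _ (Finset.mem_univ v)]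
  congr 1
  refine Finset.sum_subset (fun u hu => ?_) fun u hu hu' => ?_
  · have := (commGraph_adj.1 (Finset.mem_filter.1 hu).2).1
    exact Finset.mem_erase.2 ⟨Ne.symm this, Finset.mem_univ u⟩
  · have : I.A j u = 0 := by
      by_contra h
      refine hu' (Finset.mem_filter.2 ⟨Finset.mem_univ u, commGraph_adj.2 ⟨?_, j, hj, h⟩⟩)
      exact Ne.symm (Finset.mem_erase.1 hu).1
    simp [this]

/-- A vertex can write its own record only after learning the identifiers behind its links, which
takes one round. So `s` rounds give the records at distance less than `s`, and radius `k` takes `k +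
1` rounds. -/
theorem stateAfter_eq (s : ℕ) (v : Fin n) :
    (floodAlg dec sel k).stateAfter P (I.localInput P) r s v =
      { initState dec (P.deg v) (I.localInput P v) (r v) with
        known := {ρ | ∃ u, ∃ a < s, Near I.hypergraph.commGraph.Adj a v u ∧
          ρ = vertexRecord I (fun u => (dec (r u)).1) (fun u => (dec (r u)).2) u} } := by
  -- The state is replaced by an arbitrary solution `A` of the recursion, so that the induction only
  -- uses its two equations.
  suffices main : ∀ A : ℕ → Fin n → State W M,
      (∀ v, A 0 v = initState dec (P.deg v) (I.localInput P v) (r v)) →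
      (∀ s v, A (s + 1) v = { A s v with
        known := insert ((A s v).record fun p => (A s (P.port v p).1).own.1)
          ((A s v).known ∪ ⋃ p, (A s (P.port v p).1).known) }) →
      ∀ s v, A s v = { initState dec (P.deg v) (I.localInput P v) (r v) with
        known := {ρ | ∃ u, ∃ a < s, Near I.hypergraph.commGraph.Adj a v u ∧
          ρ = vertexRecord I (fun u => (dec (r u)).1) (fun u => (dec (r u)).2) u} } from
    main _ (fun _ => rfl) (fun _ _ => rfl) s v
  clear s v
  intro A hA0 hA1 s v
  induction s generalizing v with
  | zero => simp [hA0, initState]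
  | succ s ih =>
    rw [hA1]
    simp only [ih]
    congr 1
    have hrec : State.record (M := M)
        { initState dec (P.deg v) (I.localInput P v) (r v) with
          known := {ρ | ∃ u, ∃ a < s, Near I.hypergraph.commGraph.Adj a v u ∧
            ρ = vertexRecord I (fun u => (dec (r u)).1) (fun u => (dec (r u)).2) u} }
        (fun p => (initState dec _ (I.localInput P (P.port v p).1) (r (P.port v p).1)).own.1) =
        vertexRecord I (fun u => (dec (r u)).1) (fun u => (dec (r u)).2) v := by
      unfold State.record vertexRecord
      congr 1
      ext c
      constructor
      · rintro ⟨κ, ⟨κ', ⟨j, hj, rfl⟩, rfl⟩, rfl⟩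
        exact ⟨j, hj, globalCons_eq P (fun u => (dec (r u)).1) v j hj⟩
      · rintro ⟨j, hj, rfl⟩
        exact ⟨_, ⟨_, ⟨j, hj, rfl⟩, rfl⟩, globalCons_eq P (fun u => (dec (r u)).1) v j hj⟩
    rw [hrec]
    ext ρ
    simp only [Set.mem_insert_iff, Set.mem_union, Set.mem_iUnion, Set.mem_ofPred_eq]
    constructor
    · rintro (h | ⟨u, a, ha, hu, h⟩ | ⟨p, u, a, ha, hu, h⟩)
      · exact ⟨v, 0, by omega, rfl, h⟩
      · exact ⟨u, a, by omega, hu, h⟩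
      · refine ⟨u, 1 + a, by omega, (Near.of_adj (P.port v p).2).trans hu, h⟩
    · rintro ⟨u, a, ha, hu, h⟩
      rcases a with _ | a
      · cases hu
        exact Or.inl h
      · by_cases hs : a + 1 < s
        · exact Or.inr (Or.inl ⟨u, a + 1, hs, hu, h⟩)
        · have hu' := Near.symm (fun _ _ h => SimpleGraph.Adj.symm h) hu
          rcases hu' with h' | ⟨w, hw, hwv⟩
          · refine Or.inr (Or.inl ⟨u, a, by omega, ?_, h⟩)
            exact Near.symm (fun _ _ h => SimpleGraph.Adj.symm h) h'
          · refine Or.inr (Or.inr ⟨(P.port v).symm ⟨w, SimpleGraph.Adj.symm hwv⟩, u, a,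
              by omega, ?_, h⟩)
            rw [Equiv.apply_symm_apply]
            exact Near.symm (fun _ _ h => SimpleGraph.Adj.symm h) hw

end Gather

/-! ### Instances named by identifiers -/

section Ids

variable {ι : Fin n → W} (hι : Function.Injective ι)
include hι

theorem idCons_apply (j : Fin m) (v : Fin n) : (idCons I ι j).1 (ι v) = I.A j v := by
  classical
  simp [idCons, hι.eq_iff]

theorem idInst_wt_apply (v : Fin n) : (idInst I ι).wt (ι v) = I.w v := by
  classical
  simp [idInst, hι.eq_iff]

omit hι in
theorem exists_of_idCons_ne_zero {j : Fin m} {x : W} (h : (idCons I ι j).1 x ≠ 0) :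
    ∃ v, ι v = x := by
  classical
  by_contra hcon
  push Not at hcon
  refine h ?_
  simp [idCons, hcon]

omit hι in
theorem exists_of_idInst_wt_ne_zero {x : W} (h : (idInst I ι).wt x ≠ 0) : ∃ v, ι v = x := by
  classical
  by_contra hcon
  push Not at hcon
  refine h ?_
  simp [idInst, hcon]

theorem exists_near_of_idInst_near {a : ℕ} {v : Fin n} {y : W}
    (h : (idInst I ι).Near a (ι v) y) :
    ∃ u, ι u = y ∧ Near I.hypergraph.commGraph.Adj a v u := by
  induction a generalizing y with
  | zero => cases h; exact ⟨v, rfl, rfl⟩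
  | succ a ih =>
    rcases h with h | ⟨z, hz, c, ⟨j, _, rfl⟩, h1, h2⟩
    · obtain ⟨u, hu, hn⟩ := ih h
      exact ⟨u, hu, Or.inl hn⟩
    · obtain ⟨u, rfl, hn⟩ := ih hz
      obtain ⟨w, rfl⟩ := exists_of_idCons_ne_zero h2
      rw [idCons_apply hι] at h1 h2
      refine ⟨w, rfl, ?_⟩
      by_cases huw : u = w
      · rw [← huw]; exact Or.inl hn
      · exact hn.step (commGraph_adj.2 ⟨huw, j, h1, h2⟩)

theorem sum_idCons [Fintype W] (j : Fin m) : ∑ x, (idCons I ι j).1 x = ∑ v, I.A j v := by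
  classical
  simp only [idCons]
  rw [Finset.sum_comm]
  simp

omit hι in
theorem idCons_nonneg (j : Fin m) (x : W) : 0 ≤ (idCons I ι j).1 x := by
  classical
  simp only [idCons]
  refine Finset.sum_nonneg fun u _ => ?_
  have := I.A_nonneg j u
  positivity

theorem idInst_wellFormed [Fintype W] {Q : Fin n → Bool} (hQ : I.Feasible Q) :
    (idInst I ι).WellFormed := by
  refine ⟨?_, ?_⟩
  · rintro c ⟨j, _, rfl⟩ x
    exact idCons_nonneg j x
  · rintro c ⟨j, _, rfl⟩
    rw [sum_idCons hι]
    refine (hQ j).trans ?_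
    rw [Matrix.mulVec, dotProduct]
    refine Finset.sum_le_sum fun v _ => ?_
    have := I.A_nonneg j v
    split_ifs <;> simp [this]

variable [NeZero M]

/-- The records of the vertices near `v` describe the instance near `v`. -/
theorem locEq_recon (rand : Fin n → ℕ → Fin M) (rd : ℕ → W → Fin M)
    (hrd : ∀ i v, rd i (ι v) = rand v i) (k : ℕ) (v : Fin n) {K : Set (VertexRecord W M)}
    (hK : K = {ρ | ∃ u, ∃ a < k + 1, Near I.hypergraph.commGraph.Adj a v u ∧
      ρ = vertexRecord I ι rand u}) :
    CovInst.LocEq (idInst I ι) (recon K) rd (reconRand K) k (ι v) := by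
  intro z hz
  obtain ⟨u, rfl, hu⟩ := exists_near_of_idInst_near hι hz
  have hmem : vertexRecord I ι rand u ∈ K := by
    rw [hK]
    exact ⟨u, k, by omega, hu, rfl⟩
  have hex : ∃ ρ ∈ K, ρ.id = ι u := ⟨_, hmem, rfl⟩
  -- Distinct identifiers leave only one record to choose from.
  have hch : hex.choose = vertexRecord I ι rand u := by
    obtain ⟨h1, h2⟩ := hex.choose_spec
    generalize hex.choose = ρ at h1 h2
    rw [hK] at h1
    obtain ⟨w, a, _, _, rfl⟩ := h1
    rw [hι h2]
  refine ⟨?_, ?_, ?_⟩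
  · rw [idInst_wt_apply hι]
    simp only [recon, hex, dif_pos, hch]
    rfl
  · intro c hc
    constructor
    · rintro ⟨j, _, rfl⟩
      rw [idCons_apply hι] at hc
      exact ⟨_, hmem, j, hc, rfl⟩
    · rintro ⟨ρ, hρ, hcρ⟩
      rw [hK] at hρ
      obtain ⟨w, a, _, _, rfl⟩ := hρ
      obtain ⟨j, hj, rfl⟩ := hcρ
      exact ⟨j, ⟨w, hj⟩, rfl⟩
  · intro i
    rw [hrd]
    simp only [reconRand, hex, dif_pos, hch]
    rfl

-- Even a partial view lists every constraint it knows with all its coefficients, so its constraints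
-- belong to the whole instance and inherit both properties.
omit hι in
theorem recon_wellFormed [Fintype W] (hJ : (idInst I ι).WellFormed) (rand : Fin n → ℕ → Fin M)
    (k : ℕ) (v : Fin n) {K : Set (VertexRecord W M)}
    (hK : K = {ρ | ∃ u, ∃ a < k + 1, Near I.hypergraph.commGraph.Adj a v u ∧
      ρ = vertexRecord I ι rand u}) : (recon K).WellFormed := by
  have hsub : ∀ c ∈ (recon K).cons, c ∈ (idInst I ι).cons := by
    rintro c ⟨ρ, hρ, hcρ⟩
    rw [hK] at hρ
    obtain ⟨w, a, _, _, rfl⟩ := hρ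
    obtain ⟨j, hj, rfl⟩ := hcρ
    exact ⟨j, ⟨w, hj⟩, rfl⟩
  exact ⟨fun c hc => hJ.nonneg c (hsub c hc), fun c hc => hJ.feasible c (hsub c hc)⟩

end Ids

/-- If the rule `sel` is local and the identifiers are distinct, flooding computes `sel` on the
whole instance. -/
theorem run_floodAlg_iff [Fintype W] [NeZero M] {dec : (ℕ → Bool) → W × (ℕ → Fin M)}
    {sel : CovInst W → (ℕ → W → Fin M) → W → Prop} {k : ℕ}
    (hsel : ∀ J J' : CovInst W, J.WellFormed → J'.WellFormed → ∀ ω ω' x,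
      CovInst.LocEq J J' ω ω' k x → (sel J ω x ↔ sel J' ω' x))
    (P : PortNumbering I.hypergraph.commGraph) {r : Fin n → ℕ → Bool}
    (hι : Function.Injective fun u => (dec (r u)).1) {Q : Fin n → Bool} (hQ : I.Feasible Q)
    {rd : ℕ → W → Fin M} (hrd : ∀ i u, rd i (dec (r u)).1 = (dec (r u)).2 i) (v : Fin n) :
    (floodAlg dec sel k).run P (I.localInput P) r v = true ↔
      sel (idInst I fun u => (dec (r u)).1) rd (dec (r v)).1 := by
  have hJ := idInst_wellFormed (I := I) hι hQ
  have hK := stateAfter_eq dec sel k P r (k + 1) v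
  unfold LocalAlgorithm.run
  have hr : (floodAlg dec sel k).rounds = k + 1 := rfl
  rw [hr, hK]
  simp only [floodAlg, decide_eq_true_eq]
  exact (hsel _ _ hJ (recon_wellFormed hJ (fun u => (dec (r u)).2) k v rfl) _ _ _
    (locEq_recon hι (fun u => (dec (r u)).2) rd hrd k v rfl)).symm

end Flood

/-! ### Random bits as uniform finite randomness -/

namespace FinProb

open scoped Classical in
theorem pr_equiv {Ω Ω' : Type*} [Fintype Ω] [Fintype Ω'] (e : Ω ≃ Ω') (A : Ω' → Prop) :
    pr (fun ω => A (e ω)) = pr A :=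
  Fintype.expect_equiv e _ _ fun _ => rfl

/-- Independent uniform identifiers collide only rarely. -/
theorem pr_not_injective_le {V W : Type*} [Fintype V] [DecidableEq V] [Fintype W] [Nonempty W] :
    pr (fun ι : V → W => ¬ Function.Injective ι) ≤ (Fintype.card V : ℝ) ^ 2 / Fintype.card W := by
  classical
  have hpair : ∀ u v : V, u ≠ v → pr (fun ι : V → W => ι u = ι v) = 1 / Fintype.card W := by
    intro u v huv
    rw [pr_eq_expect, expect_update u]
    have : ∀ (ι : V → W), 𝔼 x : W, (if Function.update ι u x u = Function.update ι u x v
        then (1 : ℝ) else 0) = 1 / Fintype.card W := by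
      intro ι
      simp only [Function.update_self, Function.update_of_ne huv.symm]
      rw [Fintype.expect_eq_sum_div_card]
      simp
    simp only [this, Fintype.expect_const]
  have h := pr_exists_le_card (Finset.univ.filter fun p : V × V => p.1 ≠ p.2)
    (fun p (ι : V → W) => ι p.1 = ι p.2) (η := 1 / Fintype.card W)
    fun p hp => (hpair _ _ (Finset.mem_filter.1 hp).2).le
  refine (pr_mono fun ι hι => ?_).trans (h.trans ?_)
  · simp only [Function.Injective, not_forall] at hι
    obtain ⟨u, v, h1, h2⟩ := hι
    exact ⟨(u, v), by simpa using h2, h1⟩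
  · rw [mul_one_div]
    refine div_le_div_of_nonneg_right ?_ (Nat.cast_nonneg _)
    have : (Finset.univ.filter fun p : V × V => p.1 ≠ p.2).card ≤ Fintype.card V ^ 2 := by
      refine (Finset.card_le_univ _).trans (le_of_eq ?_)
      rw [Fintype.card_prod, sq]
    exact_mod_cast this

/-- The random bits restricted to finite prefixes are uniformly distributed. -/
theorem randomBits_prefix_le {V : Type} [Fintype V] [DecidableEq V] (b : ℕ) (A : (V → Fin b → Bool) → Prop) :
    randomBits V {r | A fun v i => r v i} ≤ ENNReal.ofReal (pr A) := by
  classical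
  set β : Measure Bool := (PMF.uniformOfFintype Bool).toMeasure with hβ
  have hβ1 : ∀ y : Bool, β {y} = 2⁻¹ := by
    intro y
    rw [hβ, PMF.toMeasure_apply_singleton _ _ (measurableSet_singleton y)]
    simp
  have hcyl : ∀ x : V → Fin b → Bool,
      randomBits V {r | ∀ v, ∀ i : Fin b, r v i = x v i} = (2⁻¹ ^ b) ^ Fintype.card V := by
    intro x
    have h1 : {r : V → ℕ → Bool | ∀ v, ∀ i : Fin b, r v i = x v i} =
        Set.pi Set.univ fun v => Set.pi (Finset.range b : Set ℕ)
          fun i => if h : i < b then {x v ⟨i, h⟩} else Set.univ := by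
      ext r
      simp only [Set.mem_ofPred_eq, Set.mem_pi, Set.mem_univ, true_implies, Finset.coe_range,
        Set.mem_Iio]
      constructor
      · intro h v i hi
        rw [dif_pos hi]
        exact h v ⟨i, hi⟩
      · intro h v i
        have := h v i i.2
        rwa [dif_pos i.2] at this
    rw [h1, randomBits, Measure.pi_pi]
    have h2 : ∀ v, (Measure.infinitePi fun _ : ℕ => β) (Set.pi (Finset.range b : Set ℕ)
        fun i => if h : i < b then {x v ⟨i, h⟩} else Set.univ) = 2⁻¹ ^ b := by
      intro v
      rw [Measure.infinitePi_pi]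
      · have : ∀ i ∈ Finset.range b,
            β (if h : i < b then {x v ⟨i, h⟩} else Set.univ) = 2⁻¹ := by
          intro i hi
          rw [dif_pos (Finset.mem_range.1 hi)]
          exact hβ1 _
        rw [Finset.prod_congr rfl this, Finset.prod_const, Finset.card_range]
      · intro i _
        exact MeasurableSet.of_discrete
    exact (Finset.prod_congr rfl fun v _ => h2 v).trans
      (by rw [Finset.prod_const, Finset.card_univ])
  -- The event is covered by finitely many cylinders, so subadditivity of the outer measure suffices
  -- and measurability need not be checked.
  have hsub : {r : V → ℕ → Bool | A fun v i => r v i} ⊆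
      ⋃ x ∈ Finset.univ.filter A, {r | ∀ v, ∀ i : Fin b, r v i = x v i} := by
    intro r hr
    simp only [Set.mem_iUnion]
    exact ⟨fun v i => r v i, by simpa using hr, fun v i => rfl⟩
  refine (measure_mono hsub).trans ((measure_biUnion_finset_le _ _).trans ?_)
  simp only [hcyl, Finset.sum_const, nsmul_eq_mul]
  rw [pr_eq_card_div]
  refine le_of_eq ?_
  rw [ENNReal.ofReal_div_of_pos (by positivity), ENNReal.ofReal_natCast, ENNReal.ofReal_natCast,
    ENNReal.div_eq_inv_mul, mul_comm]
  congr 1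
  simp only [Fintype.card_pi, Fintype.card_bool, Finset.prod_const, Finset.card_univ,
    Fintype.card_fin]
  push_cast
  rw [ENNReal.inv_pow, ENNReal.inv_pow]

end FinProb

/-! ### From the abstract instance back to the covering ILP -/

namespace Flood

open FinProb

variable {W : Type} [Fintype W] [DecidableEq W] {m n : ℕ} {I : CoveringILP m n}
  {ι : Fin n → W} (hι : Function.Injective ι)
include hι

theorem sum_mem_idCons (Y : Finset W) (j : Fin m) :
    ∑ x ∈ Y, (idCons I ι j).1 x = ∑ v, if ι v ∈ Y then I.A j v else 0 := by
  classical
  unfold idCons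
  rw [Finset.sum_comm]
  refine Finset.sum_congr rfl fun v _ => ?_
  convert Finset.sum_ite_eq Y (ι v) fun _ => I.A j v

theorem cost_idInst (Y : Finset W) :
    (idInst I ι).cost Y = ∑ v, if ι v ∈ Y then I.w v else 0 := by
  classical
  unfold CovInst.cost idInst
  rw [Finset.sum_comm]
  refine Finset.sum_congr rfl fun v _ => ?_
  convert Finset.sum_ite_eq Y (ι v) fun _ => I.w v

omit [Fintype W] [DecidableEq W] hι in
theorem mulVec_apply (j : Fin m) (y : Fin n → Bool) :
    I.A.mulVec (fun i => if y i then (1 : ℝ) else 0) j = ∑ v, if y v then I.A j v else 0 := by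
  rw [Matrix.mulVec, dotProduct]
  exact Finset.sum_congr rfl fun v _ => by split_ifs <;> simp

theorem feasible_of_covers {Q : Fin n → Bool} (hQ : I.Feasible Q) {Y : Finset W}
    (hY : (idInst I ι).Covers Finset.univ Y) {x : Fin n → Bool}
    (hx : ∀ v, x v = true ↔ ι v ∈ Y) : I.Feasible x := by
  classical
  intro j
  by_cases hj : ∃ v, I.A j v ≠ 0
  · obtain ⟨v, hv⟩ := hj
    have h1 := hY (idCons I ι j) ⟨j, ⟨v, hv⟩, rfl⟩ ⟨ι v, by rwa [idCons_apply hι]⟩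
      fun _ _ => Finset.mem_univ _
    rw [sum_mem_idCons hι] at h1
    rw [mulVec_apply]
    refine h1.trans (le_of_eq (Finset.sum_congr rfl fun v _ => ?_))
    simp only [hx]
  -- A constraint without variables is seen by no vertex and is absent from `idInst`. It holds for
  -- `x` because it holds for `Q`.
  · push Not at hj
    refine (hQ j).trans (le_of_eq ?_)
    rw [mulVec_apply, mulVec_apply]
    simp [hj]

theorem opt_idInst_le {Q y : Fin n → Bool} (hQ : I.Feasible Q) (hy : I.Feasible y) :
    (idInst I ι).opt Finset.univ ≤ I.weight y := by
  classical
  set Y : Finset W := (Finset.univ.filter fun v => y v = true).image ι with hYdef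
  have hmem : ∀ v, ι v ∈ Y ↔ y v = true := by
    intro v
    simp [hYdef, hι.eq_iff]
  have hcov : (idInst I ι).Covers Finset.univ Y := by
    rintro c ⟨j, _, rfl⟩ _ _
    rw [sum_mem_idCons hι]
    have := hy j
    rw [mulVec_apply] at this
    simp only [hmem]
    exact this
  refine (CovInst.opt_le_cost (idInst_wellFormed hι hQ) hcov).trans (le_of_eq ?_)
  rw [cost_idInst hι, CoveringILP.weight]
  simp only [hmem]

/-- An output of cost at most `1 + 1 / E` times the optimum is a `1 + ε`-approximate solution if
`1 / E ≤ ε`, or if `E` exceeds the optimum. -/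
theorem isApprox_of_cost {Q : Fin n → Bool} (hQ : I.IsOptimal Q) {Y : Finset W}
    (hY : (idInst I ι).Covers Finset.univ Y) {x : Fin n → Bool}
    (hx : ∀ v, x v = true ↔ ι v ∈ Y) {E : ℕ} (hE : 0 < E) {ε : ℝ} (hε : 0 ≤ ε)
    (hEε : 1 ≤ E * ε ∨ I.weight Q < E)
    (hc : E * (idInst I ι).cost Y ≤ (E + 1) * (idInst I ι).opt Finset.univ) :
    I.IsApprox (1 + ε) x := by
  have hw : I.weight x = (idInst I ι).cost Y := by
    rw [cost_idInst hι, CoveringILP.weight]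
    simp only [hx]
  refine ⟨feasible_of_covers hι hQ.1 hY hx, fun y hy => ?_⟩
  have h1 := Nat.mul_le_mul_left (E + 1) (opt_idInst_le hι hQ.1 hQ.1)
  have h2 : E * I.weight x ≤ (E + 1) * I.weight Q := by rw [hw]; exact hc.trans h1
  have h3 := hQ.2 y hy
  have hE' : (0 : ℝ) < E := by exact_mod_cast hE
  have h3' : (I.weight Q : ℝ) ≤ I.weight y := by exact_mod_cast h3
  have hy0 : (0 : ℝ) ≤ I.weight y := Nat.cast_nonneg _
  rcases hEε with h | h
  · have h2' : (E : ℝ) * I.weight x ≤ (E + 1) * I.weight Q := by exact_mod_cast h2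
    refine le_of_mul_le_mul_left ?_ hE'
    have h4 := mul_le_mul_of_nonneg_right h hy0
    have h5 : ((E : ℝ) + 1) * I.weight Q ≤ (E + 1) * I.weight y := by gcongr
    nlinarith
  -- Integrality: the allowed excess `I.weight Q / E` is less than one unit of weight.
  · have h4 : I.weight x ≤ I.weight Q := by
      by_contra hlt
      have : I.weight Q + 1 ≤ I.weight x := by omega
      have := Nat.mul_le_mul_left E this
      nlinarith
    have h5 : (I.weight x : ℝ) ≤ I.weight y := by exact_mod_cast h4.trans h3
    nlinarith

omit hι in
/-- The failure probability of the distributed algorithm is bounded in terms of the failure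
probability of the abstract algorithm with distinct identifiers. -/
theorem randomBits_floodAlg_le [Nonempty W] {M : ℕ} [NeZero M] {b R t E k : ℕ}
    (e : (Fin b → Bool) ≃ W × (Fin (t + 1) → Fin M)) {sh : Fin M → ℕ} (hsh : ∀ x, sh x ≤ R)
    {σ : ℕ → CovInst.Stage} (hs : ∀ i < t, 0 < (σ i).inner)
    (hsel : ∀ J J' : CovInst W, J.WellFormed → J'.WellFormed → ∀ ω ω' x,
      CovInst.LocEq J J' ω ω' k x →
        (x ∈ J.output R sh σ t ω ↔ x ∈ J'.output R sh σ t ω'))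
    (P : PortNumbering I.hypergraph.commGraph) {Q : Fin n → Bool} (hQ : I.IsOptimal Q)
    (hE : 0 < E) {ε : ℝ} (hε : 0 ≤ ε) (hEε : 1 ≤ E * ε ∨ I.weight Q < E) {η : ℝ}
    (hη : ∀ ι : Fin n → W, Function.Injective ι →
      pr (fun ω : Fin (t + 1) → W → Fin M =>
        ¬ E * (idInst I ι).cost ((idInst I ι).output R sh σ t
          fun i => ω (Fin.ofNat (t + 1) i)) ≤ (E + 1) * (idInst I ι).opt Finset.univ) ≤ η)
    (hη0 : 0 ≤ η) :
    randomBits (Fin n) {r | ¬ I.IsApprox (1 + ε)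
      ((floodAlg (fun r => ((e fun i => r i).1, fun i => (e fun i => r i).2 (Fin.ofNat (t + 1) i)))
        (fun J ω x => x ∈ J.output R sh σ t ω) k).run P (I.localInput P) r)} ≤
      ENNReal.ofReal ((n : ℝ) ^ 2 / Fintype.card W + η) := by
  classical
  let bad : (Fin n → W) → (Fin (t + 1) → W → Fin M) → Prop := fun ι ω =>
    ¬ E * (idInst I ι).cost ((idInst I ι).output R sh σ t fun i => ω (Fin.ofNat (t + 1) i)) ≤
      (E + 1) * (idInst I ι).opt Finset.univ
  -- The abstract algorithm has random numbers at all possible identifiers, the execution only at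
  -- those in use. The two agree for every extension `ω`, so failure makes all extensions bad, which
  -- is no more likely than that a uniform `ω` is bad.
  let A : (Fin n → W × (Fin (t + 1) → Fin M)) → Prop := fun z =>
    ¬ Function.Injective (fun v => (z v).1) ∨
      (Function.Injective (fun v => (z v).1) ∧
        ∀ ω : Fin (t + 1) → W → Fin M, (∀ i v, ω i (z v).1 = (z v).2 i) → bad (fun v => (z v).1) ω)
  have hsub : {r | ¬ I.IsApprox (1 + ε)
      ((floodAlg (fun r => ((e fun i => r i).1, fun i => (e fun i => r i).2 (Fin.ofNat (t + 1) i)))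
        (fun J ω x => x ∈ J.output R sh σ t ω) k).run P (I.localInput P) r)} ⊆
      {r : Fin n → ℕ → Bool | (fun x : Fin n → Fin b → Bool => A fun v => e (x v))
        fun v i => r v i} := by
    intro r hr
    by_cases hinj : Function.Injective fun v => (e fun i => r v i).1
    · refine Or.inr ⟨hinj, fun ω hω hcost => hr ?_⟩
      refine isApprox_of_cost hinj hQ (CovInst.output_covers (idInst_wellFormed hinj hQ.1)
        hs hsh) (fun v => ?_) hE hε hEε hcost
      exact run_floodAlg_iff (sel := fun J ω x => x ∈ J.output R sh σ t ω) hsel P hinj hQ.1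
        (rd := fun i => ω (Fin.ofNat (t + 1) i)) (fun i u => hω _ u) v
    · exact Or.inl hinj
  refine (measure_mono hsub).trans ((randomBits_prefix_le b fun x => A fun v => e (x v)).trans (ENNReal.ofReal_le_ofReal ?_))
  refine le_of_eq_of_le (pr_equiv (Equiv.piCongrRight fun _ : Fin n => e) A) ?_
  refine (pr_or_le _ _).trans (add_le_add ?_ ?_)
  · have h1 := pr_equiv (Equiv.arrowProdEquivProdArrow (Fin n) (fun _ => W)
      (fun _ => Fin (t + 1) → Fin M)) fun p => ¬ Function.Injective p.1
    refine le_of_eq_of_le h1 ?_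
    have h2 : pr (fun p : (Fin n → W) × (Fin n → Fin (t + 1) → Fin M) =>
        ¬ Function.Injective p.1) = pr fun ι : Fin n → W => ¬ Function.Injective ι := by
      rw [pr_eq_expect, pr_eq_expect, expect_prod_type]
      refine Finset.expect_congr rfl fun ι _ => ?_
      have : Nonempty (Fin n → Fin (t + 1) → Fin M) := ⟨fun _ _ => 0⟩
      by_cases h : Function.Injective ι <;> simp [h]
    rw [h2]
    simpa using pr_not_injective_le (V := Fin n) (W := W)
  · have h1 := pr_equiv (Equiv.arrowProdEquivProdArrow (Fin n) (fun _ => W)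
      (fun _ => Fin (t + 1) → Fin M)) fun p => Function.Injective p.1 ∧
        ∀ ω : Fin (t + 1) → W → Fin M, (∀ i v, ω i (p.1 v) = p.2 v i) → bad p.1 ω
    refine le_of_eq_of_le h1 ?_
    rw [pr_eq_expect, expect_prod_type]
    have hconst : η = 𝔼 _ι : Fin n → W, η := by simp
    rw [hconst]
    refine Finset.expect_le_expect fun ι _ => ?_
    by_cases hι : Function.Injective ι
    · simp only [hι, true_and]
      rw [← expect_comp_injective hι (X := Fin (t + 1) → Fin M)
        (g := fun ρ => if ∀ ω : Fin (t + 1) → W → Fin M, (∀ i v, ω i (ι v) = ρ v i) → bad ι ω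
          then (1 : ℝ) else 0)]
      rw [← pr_eq_expect]
      have h2 := pr_equiv (Equiv.piComm fun (_ : W) (_ : Fin (t + 1)) => Fin M) (bad ι)
      refine le_trans (pr_mono fun ω hω => ?_) (h2.le.trans (hη ι hι))
      exact hω _ fun i v => rfl
    · simp only [hι, false_and, if_false, Finset.expect_const_zero]
      exact hη0

end Flood

/-! ### The law of the shifts -/

namespace FinProb

/-- A shift with approximately geometric tail `q ^ s`, cut off at `R`. -/
noncomputable def geomShift (M : ℕ) (q : ℝ) (R : ℕ) (U : Fin M) : ℕ :=
  open scoped Classical in Nat.findGreatest (fun s => (U : ℝ) < M * q ^ s) R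

variable {M R : ℕ} {q : ℝ}

theorem geomShift_le (U : Fin M) : geomShift M q R U ≤ R := by
  classical
  exact Nat.findGreatest_le _

theorem le_geomShift_iff (h0 : 0 ≤ q) (h1 : q ≤ 1) {s : ℕ} (hs : s ≤ R) (U : Fin M) :
    s ≤ geomShift M q R U ↔ (U : ℝ) < M * q ^ s := by
  classical
  refine ⟨fun h => ?_, fun h => Nat.le_findGreatest hs h⟩
  have hspec : (U : ℝ) < M * q ^ geomShift M q R U :=
    Nat.findGreatest_spec (P := fun s => (U : ℝ) < M * q ^ s) (Nat.zero_le R)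
      (by simp)
  refine hspec.trans_le ?_
  have := pow_le_pow_of_le_one h0 h1 h
  gcongr

theorem le_pr_lt_mul (hM : 0 < M) {y : ℝ} (hy : y ≤ 1) :
    y ≤ pr (fun τ : Fin M => (τ : ℝ) < M * y) := by
  have hM' : (0 : ℝ) < M := by exact_mod_cast hM
  rw [pr_lt_mul_eq, le_div_iff₀ hM', mul_comm]
  rcases le_total M ⌈M * y⌉₊ with h | h
  · rw [min_eq_left h]
    nlinarith
  · rw [min_eq_right h]
    exact Nat.le_ceil _

theorem pr_le_geomShift (h0 : 0 ≤ q) (h1 : q ≤ 1) {s : ℕ} (hs : s ≤ R) :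
    pr (fun U : Fin M => s ≤ geomShift M q R U) = pr (fun τ : Fin M => (τ : ℝ) < M * q ^ s) := by
  simp only [le_geomShift_iff h0 h1 hs]

theorem pr_le_geomShift_eq_zero {s : ℕ} (hs : R < s) :
    pr (fun U : Fin M => s ≤ geomShift M q R U) = 0 := by
  refine le_antisymm ?_ (pr_nonneg _)
  refine (pr_mono (B := fun _ => False) fun U hU => ?_).trans (by simp [pr])
  have := geomShift_le (q := q) (R := R) U
  omega

/-- Three levels multiply an exact geometric tail by `q ^ 3`. Rounding costs at most `1 / M`, and
within three levels of the cutoff the whole tail is at most `q ^ (R - 2)` plus the rounding. -/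
theorem slowTail_geomShift (hM : 0 < M) (h0 : 0 ≤ q) (h1 : q ≤ 1) :
    CovInst.SlowTail (geomShift M q R) (1 - q ^ 3) (q ^ (R - 2) + 1 / M) := by
  intro s
  have hM' : (0 : ℝ) < M := by exact_mod_cast hM
  have hq3 : q ^ 3 ≤ 1 := pow_le_one₀ h0 h1
  have hg := pr_nonneg fun U : Fin M => s ≤ geomShift M q R U
  have hg3 := pr_nonneg fun U : Fin M => s + 3 ≤ geomShift M q R U
  have hinv : (0 : ℝ) ≤ 1 / M := by positivity
  have hqR : 0 ≤ q ^ (R - 2) := pow_nonneg h0 _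
  rcases le_or_gt s R with hs | hs
  · have hup := pr_lt_mul_le hM (pow_nonneg h0 s)
    rw [← pr_le_geomShift (R := R) h0 h1 hs] at hup
    rcases le_or_gt (s + 3) R with hs3 | hs3
    · have hlow := le_pr_lt_mul hM (pow_le_one₀ h0 h1 : q ^ (s + 3) ≤ 1)
      rw [← pr_le_geomShift (R := R) h0 h1 hs3, pow_add] at hlow
      have := mul_le_mul_of_nonneg_right hup (pow_nonneg h0 3)
      nlinarith
    · have := pow_le_pow_of_le_one h0 h1 (show R - 2 ≤ s by omega)
      nlinarith
  · rw [pr_le_geomShift_eq_zero hs] at *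
    nlinarith

end FinProb

/-! ### The choice of the parameters -/

namespace Params

open FinProb

/-- The largest shift. -/
def shiftBound (E A : ℕ) : ℕ := 192 * E * A + 2

/-- The decay rate of the shifts. -/
noncomputable def decay (E : ℕ) : ℝ := 1 - 1 / (192 * E)

/-- The random shifts. -/
noncomputable def shift (E A : ℕ) : Fin (2 ^ A) → ℕ :=
  geomShift (2 ^ A) (decay E) (shiftBound E A)

/-- The number of carving stages. -/
def stages (E A : ℕ) : ℕ := Nat.clog 2 (16 * E * A ^ 2)

/-- The maximal number of carved balls that may overlap in one stage. -/
def overlap (A : ℕ) : ℕ := 18 * A + 2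

/-- The number of layers among which each carved ball chooses. -/
def layers (E A : ℕ) : ℕ := 2 * E * stages E A * overlap A

/-- Distance beyond which clusters are independent. -/
def sep (E A : ℕ) : ℕ := 2 * (shiftBound E A + 2)

/-- The radius within which a vertex is affected by the stages from `i` on. -/
def radius (E A i : ℕ) : ℕ :=
  sep E A + 1 + (stages E A - i) * (2 * layers E A + 2 * sep E A)

/-- The carving stages. -/
noncomputable def stage (E A i : ℕ) : CovInst.Stage where
  inner := radius E A (i + 1) + sep E A
  layers := layers E A
  view := (2 * i + 2) * radius E A 0
  rate := (2 ^ i : ℕ) * (4 * A)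

/-- The radius of the neighbourhood on which the output of a vertex depends. -/
def viewRadius (E A : ℕ) : ℕ := (2 * stages E A + 4) * radius E A 0

variable {E A : ℕ}

theorem decay_nonneg (hE : 0 < E) : 0 ≤ decay E := by
  have : (1 : ℝ) ≤ E := by exact_mod_cast hE
  rw [decay, sub_nonneg, div_le_one (by positivity)]
  linarith

theorem decay_le_one : decay E ≤ 1 := by
  rw [decay]
  have : (0 : ℝ) ≤ 1 / (192 * E) := by positivity
  linarith

/-- Bernoulli's inequality, with `3 / 192 = 1 / 64`. -/
theorem one_sub_decay_pow_le (hE : 0 < E) : 1 - decay E ^ 3 ≤ 1 / (64 * E) := by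
  have h := one_add_mul_le_pow (a := decay E - 1) (by have := decay_nonneg hE; linarith) 3
  have h1 : 1 + (decay E - 1) = decay E := by ring
  rw [h1] at h
  have h2 : 3 * (1 - decay E) = 1 / (64 * (E : ℝ)) := by
    rw [decay]
    field_simp
    norm_num
  push_cast at h
  linarith

theorem exp_neg_le (A : ℕ) : Real.exp (-(A : ℝ)) ≤ 1 / 2 ^ A := by
  rw [Real.exp_neg, ← one_div]
  refine one_div_le_one_div_of_le (by positivity) ?_
  have h := Real.add_one_le_exp (1 : ℝ)
  calc (2 : ℝ) ^ A ≤ Real.exp 1 ^ A := pow_le_pow_left₀ (by norm_num) (by linarith) A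
    _ = Real.exp A := by rw [← Real.exp_nat_mul, mul_one]

/-- The exponent `192 * E * A` brings `1 - 1 / (192 * E)` down to at most `exp (-A)`. The extra two
in `shiftBound` make up for the two lost at the cutoff in `slowTail_geomShift`. -/
theorem decay_pow_le (hE : 0 < E) : decay E ^ (shiftBound E A - 2) ≤ 1 / 2 ^ A := by
  have hE' : (0 : ℝ) < E := by exact_mod_cast hE
  have h1 : decay E ≤ Real.exp (-(1 / (192 * E))) := by
    have := Real.add_one_le_exp (-(1 / (192 * (E : ℝ))))
    rw [decay]
    linarith
  refine (pow_le_pow_left₀ (decay_nonneg hE) h1 _).trans (le_trans (le_of_eq ?_) (exp_neg_le A))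
  rw [← Real.exp_nat_mul, shiftBound, Nat.add_sub_cancel]
  congr 1
  push_cast
  field_simp

theorem slowTail_shift (hE : 0 < E) :
    CovInst.SlowTail (shift E A) (1 / (64 * E)) (2 / 2 ^ A) := by
  intro s
  have h := slowTail_geomShift (M := 2 ^ A) (R := shiftBound E A) (by positivity)
    (decay_nonneg hE) decay_le_one s
  have h1 := one_sub_decay_pow_le hE
  have h2 := decay_pow_le (A := A) hE
  have h3 := mul_le_mul_of_nonneg_right h1 (pr_nonneg fun x => s ≤ shift E A x)
  push_cast at h
  have h4 : (2 : ℝ) / 2 ^ A = 1 / 2 ^ A + 1 / 2 ^ A := by ring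
  rw [h4]
  exact h.trans (add_le_add h3 (by linarith))

theorem stages_pos (hE : 0 < E) (hA : 0 < A) : 0 < stages E A :=
  Nat.clog_pos (by norm_num) (by nlinarith [Nat.mul_pos hE (pow_pos hA 2)])

theorem le_two_pow_stages (E A : ℕ) : 16 * E * A ^ 2 ≤ 2 ^ stages E A :=
  Nat.le_pow_clog (by norm_num) _

theorem layers_pos (hE : 0 < E) (hA : 0 < A) : 0 < layers E A := by
  have := stages_pos hE hA
  rw [layers, overlap]
  positivity

theorem radius_succ {i : ℕ} (hi : i < stages E A) :
    radius E A i = radius E A (i + 1) + 2 * layers E A + 2 * sep E A := by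
  have : stages E A - i = (stages E A - (i + 1)) + 1 := by omega
  rw [radius, radius, this]
  ring

theorem radius_le (i : ℕ) : radius E A i ≤ radius E A 0 := by
  rw [radius, radius]
  gcongr
  omega

/-- A stage uses up one `sep` on either side of its layers; these are the changes of radius in
comparing densities with optima. -/
theorem reach_stage {i : ℕ} (hi : i < stages E A) :
    (stage E A i).reach + sep E A = radius E A i := by
  rw [radius_succ hi, CovInst.Carving.reach, stage]
  simp only
  ring

theorem stages_le {ℓ : ℕ} (hEℓ : E ≤ 2 ^ ℓ) (hA : 4 + ℓ ≤ A) : stages E A ≤ 3 * A := by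
  rw [stages, Nat.clog_le_iff_le_pow (by norm_num)]
  have h1 : A ^ 2 ≤ (2 ^ A) ^ 2 := Nat.pow_le_pow_left A.lt_two_pow_self.le 2
  calc 16 * E * A ^ 2 ≤ 2 ^ 4 * 2 ^ ℓ * (2 ^ A) ^ 2 := by gcongr; norm_num
    _ = 2 ^ (4 + ℓ) * 2 ^ (2 * A) := by rw [← pow_add, ← pow_mul, mul_comm A 2]
    _ ≤ 2 ^ A * 2 ^ (2 * A) := by gcongr; norm_num
    _ = 2 ^ (3 * A) := by rw [← pow_add]; ring_nf

variable {W : Type} [Fintype W] [DecidableEq W]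

/-- With these parameters, the abstract algorithm fails with probability at most
`1023 * 4 ^ ℓ / 2 ^ A`. -/
theorem pr_output_le {J : CovInst W} (hJ : J.WellFormed) {V : Finset W} {ℓ n : ℕ}
    (hV : V.card ≤ n) (hVw : ∀ x, J.wt x ≠ 0 → x ∈ V) (hVb : ∀ x ∈ V, ∀ k, J.ball k x ⊆ V)
    (hE : 0 < E) (hEℓ : E ≤ 2 ^ ℓ) (hn : n ≤ 2 ^ ℓ) (hA : 12 * ℓ ≤ A) (hℓ : 0 < ℓ) :
    pr (fun ω : Fin (stages E A + 1) → W → Fin (2 ^ A) =>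
        ¬ E * J.cost (J.output (shiftBound E A) (shift E A) (stage E A) (stages E A)
            fun i => ω (Fin.ofNat (stages E A + 1) i)) ≤ (E + 1) * J.opt Finset.univ) ≤
      1023 * 4 ^ ℓ / 2 ^ A := by
  have hA0 : 0 < A := by omega
  have hE' : (1 : ℝ) ≤ E := by exact_mod_cast hE
  have hEℓ' : (E : ℝ) ≤ 2 ^ ℓ := by exact_mod_cast hEℓ
  have hn' : (n : ℝ) ≤ 2 ^ ℓ := by exact_mod_cast hn
  have hA' : (1 : ℝ) ≤ A := by exact_mod_cast hA0
  have hA2 : (A : ℝ) ≤ 2 ^ A := by exact_mod_cast A.lt_two_pow_self.le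
  set z : ℝ := 2 ^ ℓ with hz
  have hz1 : 1 ≤ z := one_le_pow₀ (by norm_num)
  have hz2 : z ^ 2 = 4 ^ ℓ := by rw [hz, ← pow_mul, mul_comm, pow_mul]; norm_num
  set m : ℝ := 2 ^ A with hm
  have hmz : 64 * z ^ 2 ≤ m := by
    have : (2 : ℝ) ^ (6 + 2 * ℓ) ≤ 2 ^ A := pow_le_pow_right₀ (by norm_num) (by omega)
    rw [pow_add, mul_comm 2 ℓ, pow_mul] at this
    linarith
  have hm0 : 0 < m := by positivity
  have hne : n * (2 / m) ≤ 1 / (32 * E) := by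
    rw [mul_div_assoc', div_le_div_iff₀ hm0 (by positivity)]
    nlinarith [mul_le_mul hn' hEℓ' (by positivity) (by positivity)]
  have h := CovInst.pr_output_le (M := 2 ^ A) (t := stages E A) (R := shiftBound E A)
    (sh := shift E A) (σ := stage E A) hJ (by positivity) (fun x => geomShift_le x)
    (slowTail_shift hE) (n := n) (V := V)
    (by
      rw [div_le_div_iff₀ (by positivity) (by norm_num)]
      linarith)
    (by positivity) hV hVw hVb
    (α := 1 / (16 * E)) (by positivity)
    (by
      rw [div_le_one (by positivity)]
      linarith)
    (by
      -- With `κ = 1 / (64 * E)` it suffices that `1 + 2 * κ ≤ (1 - κ) * (1 + 4 * κ)`, which holds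
      -- because `κ ≤ 1 / 64`.
      have h1 : (1 : ℝ) / (16 * E) = 4 * (1 / (64 * E)) := by field_simp; norm_num
      have h2 : (1 : ℝ) / (32 * E) = 2 * (1 / (64 * E)) := by field_simp; norm_num
      have h3 : (1 : ℝ) / (64 * E) ≤ 1 / 64 := by
        apply one_div_le_one_div_of_le <;> linarith
      have h4 : (0 : ℝ) ≤ 1 / (64 * E) := by positivity
      rw [h2] at hne
      rw [h1]
      nlinarith)
    (r := radius E A) (P := fun i => (2 * i + 1) * radius E A 0) (L := layers E A)
    (B := overlap A) (B' := A) (p := A) (E := E) (K := 4 * A)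
    (by positivity) (layers_pos hE hA0) hE (fun _ _ => rfl) (fun _ _ => rfl)
    (fun i hi => by
      have h1 := reach_stage hi
      have h2 := radius_le (E := E) (A := A) i
      have h3 : (stage E A i).view = (2 * i + 1) * radius E A 0 + radius E A 0 := by
        simp only [stage]; ring
      change (2 * i + 1) * radius E A 0 + _ ≤ _
      omega)
    (fun i hi => (reach_stage hi).le)
    (fun i hi => le_rfl)
    (fun i hi => by
      have h1 := radius_succ hi
      have h2 := radius_le (E := E) (A := A) i
      have h3 : (2 * (i + 1) + 1) * radius E A 0 = (2 * i + 2) * radius E A 0 + radius E A 0 := by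
        ring
      simp only [stage]
      omega)
    (by simp)
    (by simp [radius, sep])
    le_rfl
    (by
      -- The allowance `1 / (8 * E)` is split evenly between `α` and the dependence term; the number
      -- of stages is chosen for the latter.
      have h1 : (16 * E * A ^ 2 : ℝ) ≤ 2 ^ stages E A := by exact_mod_cast le_two_pow_stages E A
      have h2 : (A : ℝ) * A / 2 ^ stages E A ≤ 1 / (16 * E) := by
        rw [div_le_div_iff₀ (by positivity) (by positivity)]
        nlinarith
      have h3 : (1 : ℝ) / (8 * E) = 1 / (16 * E) + 1 / (16 * E) := by field_simp; norm_num
      linarith)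
  refine h.trans ?_
  have hexp : Real.exp 1 ≤ 4 := by have := Real.exp_one_lt_d9; linarith
  have hnm : (n : ℝ) / m ≤ 1 := by
    rw [div_le_one hm0]
    nlinarith
  have h1 : Real.exp (-(4 * (A : ℝ) / 2)) ≤ 1 / m ^ 2 := by
    have h1 := exp_neg_le (2 * A)
    push_cast at h1
    rw [show -(4 * (A : ℝ) / 2) = -(2 * A) by ring, hm, ← pow_mul, mul_comm A 2]
    exact h1
  -- The numerator is at most `4 ^ (8 * A + 1) = 2 ^ (16 * A + 2)`, so an overlap of `18 * A + 2`
  -- leaves `2 ^ (-2 * A)`.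
  have h2 : Real.exp (2 * (4 * A) + n / (2 ^ A : ℕ)) / 2 ^ overlap A ≤ 1 / m ^ 2 := by
    have h3 : Real.exp (2 * (4 * A) + n / (2 ^ A : ℕ)) ≤ 4 ^ (8 * A + 1) := by
      calc Real.exp (2 * (4 * A) + n / (2 ^ A : ℕ)) ≤ Real.exp ((8 * A + 1 : ℕ) * 1) := by
            refine Real.exp_le_exp.2 ?_
            push_cast
            linarith
        _ = Real.exp 1 ^ (8 * A + 1) := Real.exp_nat_mul _ _
        _ ≤ 4 ^ (8 * A + 1) := pow_le_pow_left₀ (Real.exp_nonneg _) hexp _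
    have h4 : (4 : ℝ) ^ (8 * A + 1) * m ^ 2 = 2 ^ overlap A := by
      rw [show (4 : ℝ) = 2 ^ 2 by norm_num, hm, ← pow_mul, ← pow_mul, ← pow_add, overlap]
      congr 1
      ring
    rw [div_le_div_iff₀ (by positivity) (by positivity), one_mul, ← h4]
    gcongr
  have h3 : (1 : ℝ) / 4 ^ A = 1 / m ^ 2 := by
    rw [hm, ← pow_mul, mul_comm, pow_mul]; norm_num
  have h4 : (1 + 4 * (2 / m)) ^ n ≤ 4 := by
    have h5 := Real.add_one_le_exp (4 * (2 / m))
    calc (1 + 4 * (2 / m)) ^ n ≤ Real.exp (4 * (2 / m)) ^ n :=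
          pow_le_pow_left₀ (by positivity) (by linarith) n
      _ = Real.exp (n * (4 * (2 / m))) := (Real.exp_nat_mul _ _).symm
      _ ≤ Real.exp 1 := by
          refine Real.exp_le_exp.2 ?_
          have : (1 : ℝ) / (32 * E) ≤ 1 / 32 := by
            apply one_div_le_one_div_of_le <;> linarith
          linarith
      _ ≤ 4 := hexp
  have h5 : (stages E A : ℝ) ≤ 3 * m := by
    have : (stages E A : ℝ) ≤ 3 * A := by exact_mod_cast stages_le hEℓ (by omega)
    linarith
  have h6 : ((shiftBound E A : ℕ) : ℝ) + 1 ≤ 195 * (z * m) := by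
    rw [shiftBound]
    push_cast
    have h7 : (E : ℝ) * A ≤ z * m := mul_le_mul hEℓ' hA2 (by positivity) (by positivity)
    have h8 : (1 : ℝ) ≤ E * A := one_le_mul_of_one_le_of_one_le hE' hA'
    linarith
  have h7 : (4 : ℝ) ^ A = m ^ 2 := by
    rw [hm, ← pow_mul, mul_comm, pow_mul]; norm_num
  calc _ ≤ 3 * m * (z * (1 / m ^ 2) + z * (1 / m ^ 2)) +
        (1 / m ^ 2 + z * (195 * (z * m) * (4 / m ^ 2))) := by
        rw [h7] at *
        gcongr
    _ = (6 * z + 1 / m + 780 * z ^ 2) / m := by field_simp; ring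
    _ ≤ 1023 * z ^ 2 / m := by
        have : 1 / m ≤ 1 := by
          rw [div_le_one hm0]; nlinarith
        gcongr
        nlinarith
    _ = _ := by rw [hz2]

end Params

/-! ### The distributed algorithm -/

namespace Params

open FinProb Flood

/-- Uniform bits provide a uniform identifier and uniform random numbers for all stages. -/
noncomputable def bitsEquiv (t A : ℕ) :
    (Fin (A * (t + 2)) → Bool) ≃ Fin (2 ^ A) × (Fin (t + 1) → Fin (2 ^ A)) :=
  Fintype.equivOfCardEq (by simp [pow_mul, pow_succ'])

/-- The distributed algorithm. -/
noncomputable def algorithm (E A : ℕ) : LocalAlgorithm CoveringInput :=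
  floodAlg
    (fun r => ((bitsEquiv (stages E A) A fun i => r i).1,
      fun i => (bitsEquiv (stages E A) A fun i => r i).2 (Fin.ofNat (stages E A + 1) i)))
    (fun J ω x => x ∈ J.output (shiftBound E A) (shift E A) (stage E A) (stages E A) ω)
    (viewRadius E A)

/-- Identifiers have `A` bits, so collisions contribute at most `4 ^ ℓ / 2 ^ A`. This rounds the
`1023` of `Params.pr_output_le` up to `2 ^ 10`. -/
theorem randomBits_algorithm_le {m n E A ℓ : ℕ} {I : CoveringILP m n}
    (P : PortNumbering I.hypergraph.commGraph) {Q : Fin n → Bool} (hQ : I.IsOptimal Q)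
    (hE : 0 < E) (hEℓ : E ≤ 2 ^ ℓ) (hn : n ≤ 2 ^ ℓ) (hA : 12 * ℓ ≤ A) (hℓ : 0 < ℓ)
    {ε : ℝ} (hε : 0 ≤ ε) (hEε : 1 ≤ E * ε ∨ I.weight Q < E) :
    randomBits (Fin n) {r | ¬ I.IsApprox (1 + ε)
      ((algorithm E A).run P (I.localInput P) r)} ≤ ENNReal.ofReal (2 ^ (2 * ℓ + 10) / 2 ^ A) := by
  classical
  have hA0 : 0 < A := by omega
  refine (randomBits_floodAlg_le (W := Fin (2 ^ A)) (bitsEquiv (stages E A) A)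
    (fun x => geomShift_le x) (fun i hi => ?_) (fun J J' hJ hJ' ω ω' x h =>
      h.mem_output_iff hJ hJ' (fun x => geomShift_le x) (fun _ _ => layers_pos hE hA0) ?_
        (fun i hi => ?_) (fun i _ => le_rfl)) P hQ hE hε hEε (η := 1023 * 4 ^ ℓ / 2 ^ A)
        (fun ι hι => ?_) (by positivity)).trans (ENNReal.ofReal_le_ofReal ?_)
  · simp only [stage, sep]
    omega
  · rw [radius, sep]
    omega
  · have := reach_stage hi
    have := radius_le (E := E) (A := A) i
    omega
  · refine pr_output_le (V := Finset.univ.image ι) (n := n) (idInst_wellFormed hι hQ.1)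
      (Finset.card_image_le.trans (by simp)) (fun x hx => ?_) (fun x hx k y hy => ?_)
      hE hEℓ hn hA hℓ
    · obtain ⟨v, rfl⟩ := exists_of_idInst_wt_ne_zero hx
      exact Finset.mem_image_of_mem ι (Finset.mem_univ v)
    · obtain ⟨v, -, rfl⟩ := Finset.mem_image.1 hx
      obtain ⟨u, rfl, -⟩ := exists_near_of_idInst_near hι (CovInst.mem_ball.1 hy)
      exact Finset.mem_image_of_mem ι (Finset.mem_univ u)
  · have hn' : (n : ℝ) ≤ 2 ^ ℓ := by exact_mod_cast hn
    have h1 : (n : ℝ) ^ 2 ≤ 4 ^ ℓ := by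
      calc (n : ℝ) ^ 2 ≤ (2 ^ ℓ) ^ 2 := by gcongr
        _ = 4 ^ ℓ := by rw [← pow_mul, mul_comm, pow_mul]; norm_num
    rw [Fintype.card_fin, Nat.cast_pow, Nat.cast_ofNat, ← add_div]
    gcongr
    rw [pow_add, pow_mul]
    norm_num
    linarith

/-! ### Asymptotics of the number of rounds -/

theorem rounds_algorithm (E A : ℕ) : (algorithm E A).rounds = viewRadius E A + 1 := rfl

/-- One factor `stages` comes from the number of layers, one from adding up the radii of all stages,
and one from the views, which are `radius E A 0` times a multiple growing with the stage. -/
theorem rounds_le {E A : ℕ} (hE : 0 < E) (hA : 0 < A) :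
    (algorithm E A).rounds ≤ 8000 * (stages E A ^ 3 * (E * A)) := by
  have ht := stages_pos hE hA
  rw [rounds_algorithm, viewRadius, radius, Nat.sub_zero, layers, overlap, sep, shiftBound]
  set t := stages E A
  have h1 : 1 ≤ E * A := Nat.mul_pos hE hA
  set x := E * A with hx
  have e1 : 192 * E * A = 192 * x := by rw [hx]; ring
  have e2 : 2 * E * t * (18 * A + 2) ≤ 40 * t * x := by
    rw [hx]
    nlinarith [Nat.mul_le_mul_left (E * t) hA]
  rw [e1]
  have h2 : 2 * (192 * x + 2 + 2) ≤ 392 * x := by omega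
  have h3 : 2 * (192 * x + 2 + 2) + 1 + t * (2 * (2 * E * t * (18 * A + 2)) +
      2 * (2 * (192 * x + 2 + 2))) ≤ 393 * x + t * (80 * t * x + 784 * x) := by
    have : 2 * (2 * E * t * (18 * A + 2)) + 2 * (2 * (192 * x + 2 + 2)) ≤
      80 * t * x + 784 * x := by nlinarith
    have := Nat.mul_le_mul_left t this
    omega
  have h4 : 393 * x + t * (80 * t * x + 784 * x) ≤ 1257 * (t ^ 2 * x) := by
    have h5 : x ≤ t * x := Nat.le_mul_of_pos_left x ht
    have h6 : t * x ≤ t ^ 2 * x := by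
      have := Nat.mul_le_mul_left t h5
      nlinarith
    nlinarith
  have h7 := Nat.mul_le_mul (show 2 * t + 4 ≤ 6 * t by omega) (h3.trans h4)
  have h8 : 1 ≤ t ^ 3 * x := Nat.mul_pos (pow_pos ht 3) h1
  calc _ ≤ 6 * t * (1257 * (t ^ 2 * x)) + 1 := Nat.add_le_add_right h7 1
    _ = 7542 * (t ^ 3 * x) + 1 := by ring
    _ ≤ _ := by omega

/-- The accuracy of the algorithm: the weight of its output is at most `1 + 1 / E` times the
optimum. -/
noncomputable def accuracy (N : ℕ) (ε : ℝ) : ℕ := min ⌈1 / ε⌉₊ (N + 1)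

/-- The number of bits of an identifier. -/
def idBits (k N : ℕ) : ℕ := (k + 12) * (Nat.log 2 N + 1)

section

variable {N : ℕ} {ε : ℝ}

theorem accuracy_pos (hε : 0 < ε) : 0 < accuracy N ε :=
  lt_min (Nat.ceil_pos.2 (by positivity)) N.succ_pos

theorem accuracy_le (hε : 0 < ε) (hε1 : ε ≤ 1) : (accuracy N ε : ℝ) ≤ 2 / ε := by
  have h1 : (accuracy N ε : ℝ) ≤ (⌈1 / ε⌉₊ : ℕ) := by exact_mod_cast min_le_left _ _
  have h2 := Nat.ceil_lt_add_one (a := 1 / ε) (by positivity)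
  have h3 : 1 ≤ 1 / ε := by rwa [le_div_iff₀ hε, one_mul]
  have h4 : 2 / ε = 1 / ε + 1 / ε := by ring
  linarith

/-- The cap `N + 1` keeps the accuracy linear in `N` however small `ε` is. Once it takes effect the
accuracy exceeds the optimum, and `isApprox_of_cost` uses integrality. -/
theorem accuracy_spec (hε : 0 < ε) {w : ℕ} (hw : w ≤ N) :
    1 ≤ accuracy N ε * ε ∨ w < accuracy N ε := by
  rcases le_total ⌈1 / ε⌉₊ (N + 1) with h | h
  · left
    rw [accuracy, min_eq_left h, ← div_le_iff₀ hε]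
    exact Nat.le_ceil _
  · right
    rw [accuracy, min_eq_right h]
    omega

theorem accuracy_le_two_pow : accuracy N ε ≤ 2 ^ (Nat.log 2 N + 1) :=
  (min_le_right _ _).trans (Nat.lt_pow_succ_log_self (by norm_num) N)

theorem log_two_succ_le (hN : N ≠ 0) : ((Nat.log 2 N + 1 : ℕ) : ℝ) ≤ 2 * Real.log N + 1 := by
  have h1 : ((2 : ℕ) ^ Nat.log 2 N : ℝ) ≤ N := by exact_mod_cast Nat.pow_log_le_self 2 hN
  have h2 := Real.log_le_log (by positivity) h1
  rw [Real.log_pow] at h2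
  have h3 := Real.log_two_gt_d9
  push_cast at h2 ⊢
  have h4 : (0 : ℝ) ≤ Nat.log 2 N := Nat.cast_nonneg _
  nlinarith

theorem stages_le_log {E A : ℕ} (hE : 0 < E) (hA : 0 < A) :
    (stages E A : ℝ) ≤ 2 * (4 + Real.log E + 2 * Real.log A) := by
  have hE' : (0 : ℝ) < E := by exact_mod_cast hE
  have hA' : (0 : ℝ) < A := by exact_mod_cast hA
  have h1 : 2 ^ (stages E A - 1) < 16 * E * A ^ 2 :=
    Nat.pow_pred_clog_lt_self (by norm_num) (by nlinarith [Nat.mul_pos hE (pow_pos hA 2)])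
  have h2 : (2 : ℝ) ^ stages E A ≤ 32 * E * A ^ 2 := by
    have h3 : 2 ^ stages E A = 2 * 2 ^ (stages E A - 1) := by
      rw [← pow_succ', Nat.sub_add_cancel (stages_pos hE hA)]
    have h4 : 2 ^ stages E A ≤ 32 * E * A ^ 2 := by rw [h3]; linarith
    exact_mod_cast h4
  have h5 := Real.log_le_log (by positivity) h2
  rw [Real.log_pow, Real.log_mul (by positivity) (by positivity),
    Real.log_mul (by norm_num) (by positivity), Real.log_pow] at h5
  have h6 : Real.log 32 ≤ 4 := by
    rw [show (32 : ℝ) = 2 ^ 5 by norm_num, Real.log_pow]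
    have := Real.log_two_lt_d9
    push_cast
    linarith
  have h7 := Real.log_two_gt_d9
  have h8 : (0 : ℝ) ≤ stages E A := Nat.cast_nonneg _
  push_cast at h5
  nlinarith

end

/-- Of the `k + 12` blocks of `ℓ ≥ 1` bits, twelve absorb `2 * ℓ + 10`, and each of the others
absorbs a factor `n`. -/
theorem failure_le {k n N : ℕ} (hn : 0 < n) (hN : n ≤ N) :
    (2 : ℝ) ^ (2 * (Nat.log 2 N + 1) + 10) / 2 ^ idBits k N ≤ 1 / (n : ℝ) ^ k := by
  have hlt := Nat.lt_pow_succ_log_self (b := 2) (by norm_num) N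
  rw [idBits]
  set ℓ := Nat.log 2 N + 1 with hℓ
  have hn' : (0 : ℝ) < n := by exact_mod_cast hn
  have h1 : (n : ℝ) ≤ 2 ^ ℓ := by exact_mod_cast hN.trans hlt.le
  rw [div_le_div_iff₀ (by positivity) (by positivity), one_mul]
  calc (2 : ℝ) ^ (2 * ℓ + 10) * n ^ k ≤ 2 ^ (12 * ℓ) * (2 ^ ℓ) ^ k := by
        gcongr
        · norm_num
        · omega
    _ = 2 ^ ((k + 12) * ℓ) := by rw [← pow_mul, ← pow_add]; ring_nf

theorem log_log_three_pos : 0 < Real.log (Real.log 3) := by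
  refine Real.log_pos ?_
  rw [Real.lt_log_iff_exp_lt (by norm_num)]
  have := Real.exp_one_lt_d9
  linarith

/-- The number of rounds, as a function of the number of variables. -/
theorem exists_rounds_le (k c : ℕ) : ∃ C : ℝ, ∀ (n N : ℕ) (ε : ℝ), 3 ≤ n → 0 < ε → ε ≤ 1 →
    n ≤ N → N ≤ (n ^ (c + 1)) ^ c →
    ((algorithm (accuracy N ε) (idBits k N)).rounds : ℝ) ≤
      C * ((Real.log (Real.log n) + Real.log (1 / ε)) ^ 3 * Real.log n / ε) := by
  -- For `n ≥ 3`, `log log n` is at least the positive number `s₀`, so additive constants can be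
  -- absorbed into multiples of `S`.
  set s₀ := Real.log (Real.log 3) with hs₀
  have hs₀pos : 0 < s₀ := log_log_three_pos
  -- The ratio of `A` to `log n`, from `N ≤ n ^ ((c + 1) * c)` and `log_two_succ_le`.
  set C₀ : ℝ := (k + 12) * (2 * ((c + 1) * c) + 1) with hC₀
  have hC₀1 : 1 ≤ C₀ := by
    have h1 : (1 : ℝ) ≤ k + 12 := by have : (0 : ℝ) ≤ k := k.cast_nonneg; linarith
    have h2 : (1 : ℝ) ≤ 2 * ((c + 1) * c) + 1 := by
      have : (0 : ℝ) ≤ 2 * ((c + 1) * c) := by positivity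
      linarith
    exact one_le_mul_of_one_le_of_one_le h1 h2
  have hlogC₀ : 0 ≤ Real.log C₀ := Real.log_nonneg hC₀1
  set C₁ : ℝ := 2 * ((5 + 2 * Real.log C₀) / s₀ + 2) with hC₁
  refine ⟨16000 * C₁ ^ 3 * C₀, fun n N ε hn hε hε1 hnN hN => ?_⟩
  have hn3 : (3 : ℝ) ≤ n := by exact_mod_cast hn
  have hlog3 : 1 < Real.log 3 := by
    rw [Real.lt_log_iff_exp_lt (by norm_num)]
    have := Real.exp_one_lt_d9
    linarith
  set X := Real.log n with hX
  have hX3 : Real.log 3 ≤ X := Real.log_le_log (by norm_num) hn3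
  have hX1 : 1 ≤ X := hlog3.le.trans hX3
  have hlogX : s₀ ≤ Real.log X := Real.log_le_log (by linarith) hX3
  have hlogε : 0 ≤ Real.log (1 / ε) := Real.log_nonneg (by rwa [le_div_iff₀ hε, one_mul])
  set S := Real.log X + Real.log (1 / ε) with hS
  have hS0 : s₀ ≤ S := by linarith
  set E := accuracy N ε with hE
  have hE0 : 0 < E := accuracy_pos hε
  have hE2 : (E : ℝ) ≤ 2 / ε := accuracy_le hε hε1
  set A := idBits k N with hA
  have hA0 : 0 < A := Nat.mul_pos (by omega) (by omega)
  have hAX : (A : ℝ) ≤ C₀ * X := by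
    have h1 := log_two_succ_le (N := N) (by omega)
    have h2 : Real.log N ≤ (c + 1) * c * X := by
      have h3 : (N : ℝ) ≤ (n : ℝ) ^ ((c + 1) * c) := by
        rw [pow_mul]
        exact_mod_cast hN
      have h4 := Real.log_le_log (by have : 0 < N := by omega
                                     exact_mod_cast this) h3
      rw [Real.log_pow] at h4
      exact_mod_cast h4
    have h5 : ((Nat.log 2 N + 1 : ℕ) : ℝ) ≤ (2 * ((c + 1) * c) + 1) * X := by linarith
    rw [hA, idBits, Nat.cast_mul, hC₀, mul_assoc]
    push_cast at h5 ⊢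
    gcongr
  have hlogA : Real.log A ≤ Real.log C₀ + Real.log X := by
    rw [← Real.log_mul (by linarith) (by linarith)]
    exact Real.log_le_log (by exact_mod_cast hA0) hAX
  have hlogE : Real.log E ≤ 1 + Real.log (1 / ε) := by
    have h1 := Real.log_le_log (by exact_mod_cast hE0) hE2
    rw [show 2 / ε = 2 * (1 / ε) by ring, Real.log_mul (by norm_num) (by positivity)] at h1
    have := Real.log_two_lt_d9
    linarith
  have ht : (stages E A : ℝ) ≤ C₁ * S := by
    have h1 := stages_le_log hE0 hA0
    have h2 : 5 + 2 * Real.log C₀ ≤ (5 + 2 * Real.log C₀) / s₀ * S := by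
      rw [div_mul_eq_mul_div, le_div_iff₀ hs₀pos]
      gcongr
    rw [hC₁]
    linarith
  have hr : ((algorithm E A).rounds : ℝ) ≤ 8000 * ((stages E A : ℝ) ^ 3 * (E * A)) := by
    exact_mod_cast rounds_le hE0 hA0
  calc ((algorithm E A).rounds : ℝ) ≤ 8000 * ((stages E A : ℝ) ^ 3 * (E * A)) := hr
    _ ≤ 8000 * ((C₁ * S) ^ 3 * (2 / ε * (C₀ * X))) := by
        have : 0 ≤ C₁ * S := (Nat.cast_nonneg _).trans ht
        gcongr
    _ = 16000 * C₁ ^ 3 * C₀ * (S ^ 3 * X / ε) := by ring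

end Params

/-- For every `k` there is a family of randomized `LOCAL` algorithms, given the polynomial upper
bound `N` and the accuracy `ε`, that solves every covering ILP up to a factor `1 + ε` with
probability at least `1 - 1 / n ^ k`, within the stated number of rounds. The bound on the
probability of failure is a bound on the outer measure. -/
theorem theorem3 (k : ℕ) :
    ∃ 𝒜 : (N : ℕ) → (ε : ℝ) → LocalAlgorithm CoveringInput,
      ∀ c : ℕ, ∃ C : ℝ,
        ∀ (m n : ℕ) (I : CoveringILP m n) (P : PortNumbering I.hypergraph.commGraph)
          (Q : Fin n → Bool) (N : ℕ) (ε : ℝ),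
          3 ≤ n → 0 < ε → ε ≤ 1 →
          I.IsOptimal Q →
          ∑ i, I.w i ≤ n ^ c →
          max n (I.weight Q) ≤ N → N ≤ (max n (I.weight Q)) ^ c →
          ((𝒜 N ε).rounds : ℝ) ≤
              C * ((Real.log (Real.log n) + Real.log (1 / ε)) ^ 3 * Real.log n / ε) ∧
            randomBits (Fin n) {r | ¬ I.IsApprox (1 + ε) ((𝒜 N ε).run P (I.localInput P) r)} ≤
              ENNReal.ofReal (1 / (n : ℝ) ^ k) := by
  classical
  refine ⟨fun N ε => Params.algorithm (Params.accuracy N ε) (Params.idBits k N), fun c => ?_⟩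
  obtain ⟨C, hC⟩ := Params.exists_rounds_le k c
  refine ⟨C, fun m n I P Q N ε hn hε hε1 hQ hw hN hN' => ⟨?_, ?_⟩⟩
  · refine hC n N ε hn hε hε1 ((le_max_left _ _).trans hN) (hN'.trans (Nat.pow_le_pow_left ?_ c))
    have hQw : I.weight Q ≤ ∑ i, I.w i :=
      Finset.sum_le_sum fun i _ => by split_ifs <;> simp
    -- The exponent `c + 1` instead of `c` leaves room for `n` itself, even when `c = 0`.
    exact max_le (Nat.le_self_pow (by omega) n)
      ((hQw.trans hw).trans (Nat.pow_le_pow_right (by omega) (by omega)))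
  · have hnN : n ≤ N := (le_max_left _ _).trans hN
    have hQN : I.weight Q ≤ N := (le_max_right _ _).trans hN
    refine (Params.randomBits_algorithm_le P hQ (Params.accuracy_pos hε)
      Params.accuracy_le_two_pow (hnN.trans (Nat.lt_pow_succ_log_self (by norm_num) N).le)
      (Nat.mul_le_mul_right _ (by omega)) (by omega) hε.le
      (Params.accuracy_spec hε hQN)).trans (ENNReal.ofReal_le_ofReal ?_)
    exact Params.failure_le (by omega) hnN
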